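/- **Setting.** Let $K$ be a field of characteristic $0$ and let $q\in K$ be transcendental over $\mathbb Q$ (for instance $K=\mathbb Q(q)$ with $q$ an indeterminate). Let $\beta\in\mathbb Z_{>0}$ and $t=q^\beta$. Let $\Lambda$ be the ring of symmetric functions over $K$, with power sums $p_r$, monomial functions $m_\lambda$, and scalar product $$\langle p_\lambda,p_\mu\rangle_{q,t}=\delta_{\lambda\mu}\prod_{r\ge1}r^{m_r}m_r!\prod_i\frac{1-q^{\lambda_i}}{1-t^{\lambda_i}},$$ where $m_r$ is the number of parts of $\lambda$ equal to $r$. The Macdonald functions $P_\lambda=P_\lambda(x;q,t)\in\Lambda$ are characterized by $P_\lambda=m_\lambda+\sum_{\mu<\lambda}u_{\lambda\mu}m_\mu$ (dominance order, $u_{\lambda\mu}\in K$) and $\langle P_\lambda,P_\mu\rangle_{q,t}=0$ for $\lambda\ne\mu$. In $m$ variables put $$\Delta(x)=\prod_{i\ne j}\frac{(x_i/x_j;q)_\infty}{(tx_i/x_j;q)_\infty}=\prod_{i\neq j}\prod_{k=0}^{\beta-1}(1-q^kx_i/x_j),\qquad \langle f,g\rangle'_{m;q,t}=\frac1{m!}\,\mathrm{CT}\bigl[f(x^{-1})g(x)\Delta(x)\bigr],$$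 where CT is the constant term. Here $\oint\prod\frac{dx}{2\pi i x}$ also denotes the constant term (in the integrated variables) of a formal series. Let $N\ge0$, $0<r_1<r_2<\dots<r_N$ and $s_1,\dots,s_N>0$ be integers, $\lambda^{(a)}=(s_a^{r_a})+\dots+(s_1^{r_1})$, $\lambda=\lambda^{(N)}$ (with $\lambda=\emptyset$ if $N=0$), and $$C^+_\lambda=\prod_{a=1}^N\frac{\langle P_{\lambda^{(a)}},P_{\lambda^{(a)}}\rangle_{q,t}}{r_a!\,\langle P_{\lambda^{(a)}},P_{\lambda^{(a)}}\rangle'_{r_a;q,t}} .$$ **Oscillators.** Let $A^{ab}=2\delta^{a,b}-\delta^{a,b+1}-\delta^{a,b-1}$, $a,b\in\{1,\dots,N+1\}$. The oscillators $a^a_n$ ($n\in\mathbb Z$) and $Q^a$ satisfy $$[a^a_n,a^b_m]=\begin{cases}0&A^{ab}=0,\\ -n\frac{1-t^{|n|}}{1-q^{|n|}}\delta_{n+m,0}&A^{ab}=-1,\\ n\Bigl(\frac{1-t^n}{1-q^n}+\frac{1-t^{-n}}{1-q^{-n}}\Bigr)\delta_{n+m,0}&A^{ab}=2\end{cases}$$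 (read as $0$ for $n=0$), and $[a^a_0,Q^b]=\beta A^{ab}$, all other commutators with $Q^b$ being $0$. They act (the $Q^a$ through $e^{Q^a}$) on the Fock space $\bigoplus_{\gamma\in\mathbb Z^{N+1}}K[a^a_{-n}:n>0]\,|\gamma\rangle$, where $a^a_n|\gamma\rangle=0$ for $n>0$, $a^a_0|\gamma\rangle=\gamma^a|\gamma\rangle$, and $e^{Q^b}$ maps $|\gamma\rangle$ to $|\gamma'\rangle$ with $\gamma'^a=\gamma^a+\beta A^{ab}$. The functional $\langle\gamma|$ is dual to $|\gamma\rangle$: $\langle\gamma|\gamma'\rangle=\delta_{\gamma\gamma'}$ and $\langle\gamma|a^a_{-n}=0$ for $n>0$. Put $$\phi^a_{\le0}(z)=\sum_{n>0}\frac{a^a_{-n}}nz^n+Q^a,\quad \phi^a_{\ge0}(z)=-\sum_{n>0}\frac{a^a_n}nz^{-n}+a^a_0\log z,\quad :\!e^{\phi^a(z)}\!:\;=e^{\phi^a_{\le0}(z)}e^{\phi^a_{\ge0}(z)} .$$ **Proposition 4.1.** For every number $n\ge0$ of variables $x_1,\dots,x_n$, as power series in $x_1,\dots,x_n$, $$P_\lambda(x_1,\dots,x_n;q,t)=C^+_\lambda\Bigl(-q^{\frac12(\beta-1)}\Bigr)^{\frac12\beta\sum_{a=1}^Nr_a(r_a-1)}\oint\prod_{a=1}^N\prod_{j=1}^{r_a}\frac{dx^a_j}{2\pi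 i x^a_j}\;\langle\tilde\alpha|\prod_{a=1}^N\prod_{j=1}^{r_a}:\!e^{\phi^a(x^a_j)}\!:\;\prod_{i=1}^{n}e^{\phi^{N+1}_{\le0}(x_i)}|\alpha\rangle ,$$ where products of operators are ordered with the first factor leftmost, the power of $-q^{(\beta-1)/2}$ means $\bigl((-1)^{\beta}q^{\beta(\beta-1)/2}\bigr)^{\sum_a r_a(r_a-1)/2}$, and, with $r_{N+1}=n$, $r_{N+2}=0$ and $s_{N+1}$ an arbitrary integer, $$\alpha^a=\beta(r_{a+1}-r_a+1)+s_a,\qquad \tilde\alpha^a=\alpha^a+\beta\sum_{b=1}^{N+1}A^{ab}r_b\qquad(a=1,\dots,N+1).$$ -/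

import Mathlib

namespace MacBoson

noncomputable section

/-! ### Symmetric functions and the two scalar products -/

/-- The ring of symmetric functions over a field `K` of characteristic zero, as the polynomial
ring in the power sums: the variable `X r` is the power sum `p_{r+1}`. -/
abbrev SymFun (K : Type*) [Field K] : Type _ := MvPolynomial ℕ K

/-- The projection `f ↦ f(x_1, …, x_n)` of the ring of symmetric functions to polynomials in `n`
variables. -/
def toVars {K : Type*} [Field K] (n : ℕ) : SymFun K →ₐ[K] MvPolynomial (Fin n) K :=
  MvPolynomial.aeval fun r => MvPolynomial.psum (Fin n) K (r + 1)

/-- `λ_1 + ⋯ + λ_r`, where the parts of `λ` are in decreasing order. -/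
def partialSum {d : ℕ} (lam : d.Partition) (r : ℕ) : ℕ :=
  ((lam.parts.sort (· ≥ ·)).take r).sum

/-- The strict natural (dominance) ordering `mu < lam` on partitions of `d`. -/
def DomLT {d : ℕ} (mu lam : d.Partition) : Prop :=
  mu ≠ lam ∧ ∀ r, partialSum mu r ≤ partialSum lam r

/-- `z_λ(q,t) = ∏_r r^{m_r} m_r! ∏_i (1 - q^{λ_i}) / (1 - t^{λ_i})` for the partition in which
`r + 1` occurs `m r` times. -/
def zNorm {K : Type*} [Field K] (q t : K) (m : ℕ →₀ ℕ) : K :=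
  m.prod fun r k => ((r + 1 : ℕ) : K) ^ k * (k.factorial : K) *
    ((1 - q ^ (r + 1)) / (1 - t ^ (r + 1))) ^ k

/-- The bilinear scalar product with `⟨p_λ, p_μ⟩_{q,t} = δ_{λμ} z_λ(q,t)`. -/
def scalarQT {K : Type*} [Field K] (q t : K) (f g : SymFun K) : K :=
  ∑ m ∈ f.support, f.coeff m * g.coeff m * zNorm q t m

/-- The two conditions that characterize the family of Macdonald symmetric functions:
(A) `P_λ = m_λ + ∑_{μ < λ} u_{λμ} m_μ`, an identity in the ring of symmetric functions, that is,
in any number of variables; (B) `⟨P_λ, P_μ⟩_{q,t} = 0` for `λ ≠ μ`. -/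
structure IsMacdonaldFamily {K : Type*} [Field K] (q t : K)
    (P : (d : ℕ) → d.Partition → SymFun K) : Prop where
  triangular : ∀ (d : ℕ) (lam : d.Partition), ∃ u : d.Partition → K,
    (∀ mu, u mu ≠ 0 → DomLT mu lam) ∧
    ∀ n : ℕ, toVars n (P d lam) = MvPolynomial.msymm (Fin n) K lam +
      ∑ mu : d.Partition, MvPolynomial.C (u mu) * MvPolynomial.msymm (Fin n) K mu
  orthogonal : ∀ (d e : ℕ) (lam : d.Partition) (mu : e.Partition),
    (⟨d, lam⟩ : Σ k : ℕ, k.Partition) ≠ ⟨e, mu⟩ → scalarQT q t (P d lam) (P e mu) = 0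

/-- The Macdonald symmetric function `P_λ(x;q,t)`: the member at `λ` of the family characterized
by `IsMacdonaldFamily`. -/
def macdonaldP {K : Type*} [Field K] (q t : K) {d : ℕ} (lam : d.Partition) : SymFun K :=
  Classical.epsilon (IsMacdonaldFamily q t) d lam

/-- Laurent polynomials in `x_1, …, x_n`. -/
abbrev Laurent (K : Type*) [Field K] (n : ℕ) : Type _ := AddMonoidAlgebra K (Fin n → ℤ)

/-- The Laurent monomial `x^e`. -/
def lmono (K : Type*) [Field K] {n : ℕ} (e : Fin n → ℤ) : Laurent K n :=
  AddMonoidAlgebra.single e 1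

/-- `Δ(x;q,t)` for `t = q^β`. It is
`∏_{i≠j} (x_i/x_j;q)_∞ / (q^β x_i/x_j;q)_∞ = ∏_{i≠j} ∏_{k<β} (1 - q^k x_i/x_j)`; see
`qPochhammer_quotient` for the quotient of infinite products. -/
def macDelta {K : Type*} [Field K] (q : K) (β n : ℕ) : Laurent K n :=
  ∏ i : Fin n, ∏ j ∈ Finset.univ.filter (fun j : Fin n => j ≠ i), ∏ k ∈ Finset.range β,
    (1 - AddMonoidAlgebra.single (Pi.single i 1 - Pi.single j 1 : Fin n → ℤ) (q ^ k))

/-- For `|q| < 1` one has `(z;q)_∞ = (∏_{k<β} (1 - q^k z)) (q^β z;q)_∞`. -/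
theorem qPochhammer_quotient (q z : ℂ) (hq : ‖q‖ < 1) (β : ℕ) :
    (∏' k : ℕ, (1 - z * q ^ k)) =
      (∏ k ∈ Finset.range β, (1 - q ^ k * z)) * ∏' k : ℕ, (1 - (q ^ β * z) * q ^ k) := by
  have hs : Summable fun k : ℕ => -(z * (q ^ k * q ^ β)) :=
    (((summable_geometric_of_norm_lt_one hq).mul_right (q ^ β)).mul_left z).neg
  have h : Multipliable fun k : ℕ => 1 - z * q ^ (k + β) := by
    simpa only [sub_eq_add_neg, pow_add] using Complex.multipliable_one_add_of_summable hs
  have h2 := h.prod_mul_tprod_nat_mul' (f := fun k : ℕ => 1 - z * q ^ k) (k := β)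
  rw [← h2]
  congr 1
  · exact Finset.prod_congr rfl fun k _ => by rw [mul_comm]
  · exact tprod_congr fun k => by rw [pow_add]; ring

/-- `⟨f, g⟩'_{n;q,t} = (1/n!) · (constant term in f(x̄) g(x) Δ(x;q,t))` for `t = q^β`,
where `x̄ = (1/x_1, …, 1/x_n)`. -/
def scalarPrime {K : Type*} [Field K] (q : K) (β n : ℕ) (f g : MvPolynomial (Fin n) K) : K :=
  (n.factorial : K)⁻¹ *
    (MvPolynomial.aeval (fun i : Fin n => lmono K (-Pi.single i 1)) f *
      MvPolynomial.aeval (fun i : Fin n => lmono K (Pi.single i 1)) g *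
      macDelta q β n).coeff 0

/-! ### Partitions as sums of rectangles -/

/-- The parts (possibly followed by zeros) of `∑_{a ∈ S} (s_a^{r_a})`: the `i`-th part is the sum
of the `s_a` with `a ∈ S` and `i ≤ r_a`. -/
def rectParts {N : ℕ} (r s : Fin N → ℕ) (S : Finset (Fin N)) : Multiset ℕ :=
  (Multiset.range (∑ a, r a)).map fun i => ∑ a ∈ S, if i < r a then s a else 0

/-- The partition `∑_{a ∈ S} (s_a^{r_a})`. -/
def rectPartition {N : ℕ} (r s : Fin N → ℕ) (S : Finset (Fin N)) :
    (rectParts r s S).sum.Partition :=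
  Nat.Partition.ofMultiset (rectParts r s S)

/-- The constant
`C⁺_λ = ∏_a ⟨P_{λ^{(a)}}, P_{λ^{(a)}}⟩_{q,t} / (r_a! ⟨P_{λ^{(a)}}, P_{λ^{(a)}}⟩'_{r_a;q,t})`
at `t = q^β`, where `λ^{(a)} = (s_a^{r_a}) + ⋯ + (s_1^{r_1})`. -/
def cPlus {K : Type*} [Field K] (q : K) (β : ℕ) {N : ℕ} (r s : Fin N → ℕ) : K :=
  ∏ a : Fin N,
    let P := macdonaldP q (q ^ β) (rectPartition r s (Finset.Iic a))
    scalarQT q (q ^ β) P P /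
      (((r a).factorial : K) * scalarPrime q β (r a) (toVars (r a) P) (toVars (r a) P))

/-! ### Oscillators of type `A` and their Fock space -/

/-- The Cartan matrix `A^{ab} = 2δ^{a,b} - δ^{a,b+1} - δ^{a,b-1}` of size `M`. -/
def cartanA {M : ℕ} (a b : Fin M) : ℤ :=
  2 * (if a = b then 1 else 0) - (if a.val = b.val + 1 then 1 else 0) -
    (if a.val + 1 = b.val then 1 else 0)

/-- The scalar `c` in `[a^a_n, a^b_m] = c δ_{n+m,0}`. -/
def oscComm {K : Type*} [Field K] (q t : K) {M : ℕ} (a b : Fin M) (n : ℤ) : K :=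
  if cartanA a b = 0 then 0
  else if cartanA a b = -1 then -(n : K) * ((1 - t ^ n.natAbs) / (1 - q ^ n.natAbs))
  else (n : K) * ((1 - t ^ n) / (1 - q ^ n) + (1 - t ^ (-n)) / (1 - q ^ (-n)))

/-- Polynomials in the creation operators; the variable `X (a, n)` is `a^a_{-(n+1)}`. -/
abbrev Creation (K : Type*) [Field K] (M : ℕ) : Type _ := MvPolynomial (Fin M × ℕ) K

/-- The Fock space: the direct sum over the charges `γ ∈ ℤ^M` of the modules
`K[a^a_{-n} : n > 0] |γ⟩`. -/
abbrev Fock (K : Type*) [Field K] (M : ℕ) : Type _ := (Fin M → ℤ) →₀ Creation K M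

/-- The vector `|α⟩`. -/
def ket (K : Type*) [Field K] {M : ℕ} (α : Fin M → ℤ) : Fock K M := Finsupp.single α 1

/-- The functional `⟨α|`: it is dual to `|α⟩`, and it kills the images of the creation operators
and all sectors of charge different from `α`. -/
def bra (K : Type*) [Field K] {M : ℕ} (α : Fin M → ℤ) : Fock K M →ₗ[K] K :=
  MvPolynomial.lcoeff K 0 ∘ₗ Finsupp.lapply α

/-- The oscillator `a^a_n`. For `n < 0` it is multiplication by a variable, for `n = 0` it is the
charge `γ^a`, for `n > 0` it is the derivation given by the commutation relations. -/
def osc {K : Type*} [Field K] (q t : K) {M : ℕ} (a : Fin M) : ℤ → Module.End K (Fock K M)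
  | Int.ofNat 0 => Finsupp.lsum K fun γ => ((γ a : ℤ) : K) • Finsupp.lsingle γ
  | Int.ofNat (n + 1) => Finsupp.mapRange.linearMap
      (∑ b : Fin M, oscComm q t a b ((n : ℤ) + 1) •
        (MvPolynomial.pderiv (R := K) (b, n)).toLinearMap)
  | Int.negSucc n => Finsupp.mapRange.linearMap (LinearMap.mulLeft K (MvPolynomial.X (a, n)))

/-- The operator `e^{Q^a}`, where `[a^b_0, Q^a] = β A^{ba}` and all other commutators with `Q^a`
vanish: it adds `β A^{ba}` to the charge `γ^b`. -/
def expQ (K : Type*) [Field K] (β : ℕ) {M : ℕ} (a : Fin M) : Module.End K (Fock K M) :=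
  Finsupp.lmapDomain (Creation K M) K fun γ b => γ b + (β : ℤ) * cartanA b a

section
variable {K : Type*} [Field K] (q t : K) {M : ℕ} (a : Fin M) (γ : Fin M → ℤ) (p : Creation K M)

theorem osc_zero_single :
    osc q t a 0 (Finsupp.single γ p) = Finsupp.single γ (((γ a : ℤ) : K) • p) := by
  change Finsupp.lsum K (fun γ => ((γ a : ℤ) : K) • Finsupp.lsingle γ) (Finsupp.single γ p) = _
  simp

theorem osc_pos_single (n : ℕ) :
    osc q t a ((n + 1 : ℕ) : ℤ) (Finsupp.single γ p) = Finsupp.single γ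
      (∑ b : Fin M, oscComm q t a b ((n : ℤ) + 1) • MvPolynomial.pderiv (b, n) p) := by
  change Finsupp.mapRange.linearMap _ (Finsupp.single γ p) = _
  rw [Finsupp.mapRange.linearMap_apply, Finsupp.mapRange_single]
  simp

theorem osc_neg_single (n : ℕ) :
    osc q t a (Int.negSucc n) (Finsupp.single γ p) =
      Finsupp.single γ (MvPolynomial.X (a, n) * p) := by
  change Finsupp.mapRange.linearMap _ (Finsupp.single γ p) = _
  rw [Finsupp.mapRange.linearMap_apply, Finsupp.mapRange_single]
  rfl

theorem expQ_single (β : ℕ) :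
    expQ K β a (Finsupp.single γ p) =
      Finsupp.single (fun b => γ b + (β : ℤ) * cartanA b a) p := by
  rw [expQ, Finsupp.lmapDomain_apply, Finsupp.mapDomain_single]

end

/-- `[a^a_0, Q^b] = β A^{ab}`, in exponentiated form, and `[a^a_n, Q^b] = 0` for `n ≠ 0`. -/
theorem osc_expQ {K : Type*} [Field K] (q t : K) (β : ℕ) {M : ℕ} (a b : Fin M) (n : ℤ) :
    osc q t a n * expQ K β b - expQ K β b * osc q t a n =
      (if n = 0 then (β : K) * (cartanA a b : K) else 0) • expQ K β b := by
  refine Finsupp.lhom_ext fun γ p => ?_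
  simp only [LinearMap.sub_apply, Module.End.mul_apply, LinearMap.smul_apply, expQ_single]
  rcases n with (_ | n) | n
  · simp only [Int.ofNat_eq_natCast, Nat.cast_zero, osc_zero_single, expQ_single, if_true,
      ← Finsupp.single_sub, Finsupp.smul_single, ← sub_smul]
    push_cast
    rw [add_sub_cancel_left]
  · have : ((n + 1 : ℕ) : ℤ) ≠ 0 := by omega
    simp only [Int.ofNat_eq_natCast, this, osc_pos_single, expQ_single, if_false, sub_self,
      zero_smul]
  · simp only [osc_neg_single, expQ_single, reduceCtorEq, if_false, sub_self, zero_smul]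

theorem oscComm_neg {K : Type*} [Field K] (q t : K) {M : ℕ} (a b : Fin M) (n : ℤ) :
    oscComm q t b a (-n) = -oscComm q t a b n := by
  have h : cartanA b a = cartanA a b := by
    simp only [cartanA, eq_comm]
    ring
  simp only [oscComm, h, Int.natAbs_neg, neg_neg, Int.cast_neg]
  split_ifs <;> ring

theorem oscComm_ite {K : Type*} [Field K] (q t : K) {M : ℕ} (a b : Fin M) (n m : ℤ) :
    (if n + m = 0 then oscComm q t a b n else 0) =
      -(if m + n = 0 then oscComm q t b a m else 0) := by
  by_cases h : n + m = 0
  · obtain rfl : n = -m := by omega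
    rw [if_pos h, if_pos (by omega), oscComm_neg]
  · rw [if_neg h, if_neg (by omega), neg_zero]

theorem pderiv_comm' {K σ : Type*} [Field K] (i j : σ) (p : MvPolynomial σ K) :
    MvPolynomial.pderiv i (MvPolynomial.pderiv j p) =
      MvPolynomial.pderiv j (MvPolynomial.pderiv i p) := by
  classical
  have h : (⁅MvPolynomial.pderiv (R := K) i, MvPolynomial.pderiv (R := K) j⁆ :
      Derivation K (MvPolynomial σ K) (MvPolynomial σ K)) = 0 := by
    refine MvPolynomial.derivation_ext fun k => ?_
    rw [Derivation.commutator_apply, MvPolynomial.pderiv_X, MvPolynomial.pderiv_X,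
      Pi.single_apply, Pi.single_apply]
    split_ifs <;> simp
  have := congrArg (fun D => D p) h
  rwa [Derivation.commutator_apply, Derivation.coe_zero, Pi.zero_apply, sub_eq_zero] at this

/-- The commutation relations of the oscillators. -/
theorem osc_commutator {K : Type*} [Field K] (q t : K) {M : ℕ} (a b : Fin M) (n m : ℤ) :
    osc q t a n * osc q t b m = osc q t b m * osc q t a n +
      (if n + m = 0 then oscComm q t a b n else 0) • (1 : Module.End K (Fock K M)) := by
  have key : ∀ (a b : Fin M) (n k : ℕ),
      osc q t a ((n + 1 : ℕ) : ℤ) * osc q t b (Int.negSucc k) =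
        osc q t b (Int.negSucc k) * osc q t a ((n + 1 : ℕ) : ℤ) +
      (if ((n + 1 : ℕ) : ℤ) + Int.negSucc k = 0 then oscComm q t a b ((n + 1 : ℕ) : ℤ) else 0) •
        (1 : Module.End K (Fock K M)) := by
    intro a b n k
    refine Finsupp.lhom_ext fun γ p => ?_
    simp only [LinearMap.add_apply, Module.End.mul_apply, LinearMap.smul_apply, osc_neg_single,
      osc_pos_single, ← Finsupp.single_add, Module.End.one_apply, Finsupp.smul_single]
    congr 1
    have hk : ((n + 1 : ℕ) : ℤ) + Int.negSucc k = 0 ↔ k = n := by omega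
    simp only [hk, MvPolynomial.pderiv_mul, Finset.mul_sum, mul_smul_comm, smul_add,
      Finset.sum_add_distrib, MvPolynomial.pderiv_X, Pi.single_apply, Prod.mk.injEq]
    rw [add_comm]
    congr 1
    by_cases h : k = n
    · simp [h]
    · simp [h]
  have h0 : ∀ (a b : Fin M) (m : ℤ), osc q t a 0 * osc q t b m = osc q t b m * osc q t a 0 := by
    intro a b m
    refine Finsupp.lhom_ext fun γ p => ?_
    simp only [Module.End.mul_apply]
    rcases m with (_ | m) | m
    · simp only [Int.ofNat_eq_natCast, Nat.cast_zero, osc_zero_single]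
      rw [smul_comm]
    · simp only [Int.ofNat_eq_natCast, osc_zero_single, osc_pos_single, Finset.smul_sum]
      congr 1
      refine Finset.sum_congr rfl fun c _ => ?_
      rw [Derivation.map_smul, smul_comm]
    · simp only [osc_zero_single, osc_neg_single, mul_smul_comm]
  have c0 : ∀ a b : Fin M, oscComm q t a b 0 = 0 := by
    intro a b; simp [oscComm]
  have flip : ∀ {A B : Module.End K (Fock K M)} {c : K}, A * B = B * A + c • 1 →
      B * A = A * B + (-c) • 1 := by
    intro A B c h
    rw [h, add_assoc, ← add_smul, add_neg_cancel, zero_smul, add_zero]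
  rcases n with (_ | n) | n
  · simp only [Int.ofNat_eq_natCast, Nat.cast_zero, h0, c0, ite_self, zero_smul, add_zero]
  · rcases m with (_ | m) | m
    · simp only [Int.ofNat_eq_natCast, Nat.cast_zero, ← h0]
      rw [if_neg (by omega), zero_smul, add_zero]
    · rw [if_neg (by simp only [Int.ofNat_eq_natCast]; omega), zero_smul, add_zero]
      refine Finsupp.lhom_ext fun γ p => ?_
      simp only [Module.End.mul_apply, Int.ofNat_eq_natCast, osc_pos_single, map_sum,
        Derivation.map_smul, Finset.smul_sum]
      rw [Finset.sum_comm]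
      refine congrArg (Finsupp.single γ) ?_
      refine Finset.sum_congr rfl fun c _ => Finset.sum_congr rfl fun d _ => ?_
      rw [smul_comm, pderiv_comm']
    · exact key a b n m
  · rcases m with (_ | m) | m
    · simp only [Int.ofNat_eq_natCast, Nat.cast_zero, ← h0]
      rw [if_neg (by omega), zero_smul, add_zero]
    · have e := oscComm_ite q t a b (Int.negSucc n) ((m + 1 : ℕ) : ℤ)
      have h := flip (key b a m n)
      rw [← e] at h
      exact h
    · rw [if_neg (by omega), zero_smul, add_zero]
      refine Finsupp.lhom_ext fun γ p => ?_
      simp only [Module.End.mul_apply, osc_neg_single]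
      rw [mul_left_comm]

/-! ### Vertex operators -/

/-- The exponential of a power series without constant term over a `K`-algebra. -/
def expSeries (K : Type*) {R : Type*} [Field K] [Ring R] [Algebra K R] (f : PowerSeries R) :
    PowerSeries R :=
  PowerSeries.mk fun k =>
    ∑ j ∈ Finset.range (k + 1), ((j.factorial : K)⁻¹) • PowerSeries.coeff k (f ^ j)

/-- `∑_{n>0} (a^a_{-n} / n) z^n`, as a series in `z`. -/
def creationField {K : Type*} [Field K] (q t : K) {M : ℕ} (a : Fin M) :
    PowerSeries (Module.End K (Fock K M)) :=
  PowerSeries.mk fun n => if n = 0 then 0 else ((n : K)⁻¹) • osc q t a (-(n : ℤ))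

/-- `-∑_{n>0} (a^a_n / n) z^{-n}`, as a series in `z^{-1}`. -/
def annihilationField {K : Type*} [Field K] (q t : K) {M : ℕ} (a : Fin M) :
    PowerSeries (Module.End K (Fock K M)) :=
  PowerSeries.mk fun n => if n = 0 then 0 else -((n : K)⁻¹) • osc q t a (n : ℤ)

/-- `e^{φ^a_{≤0}(z)} = exp(∑_{n>0} (a^a_{-n} / n) z^n) e^{Q^a}`: the coefficient of `z^k`. -/
def expPhiNonpos {K : Type*} [Field K] (q t : K) (β : ℕ) {M : ℕ} (a : Fin M) (k : ℤ) :
    Module.End K (Fock K M) :=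
  if 0 ≤ k then PowerSeries.coeff k.toNat (expSeries K (creationField q t a)) * expQ K β a else 0

/-- The coefficient of `z^{-l}` in `exp(-∑_{n>0} (a^a_n / n) z^{-n})`. -/
def expAnnihilation {K : Type*} [Field K] (q t : K) {M : ℕ} (a : Fin M) (l : ℕ) :
    Module.End K (Fock K M) :=
  PowerSeries.coeff l (expSeries K (annihilationField q t a))

/-- The vectors of degree less than `D`, where `a^a_{-n}` has degree `n`. -/
def degLT (K : Type*) [Field K] (M D : ℕ) : Submodule K (Fock K M) where
  carrier := {v | ∀ γ, ∀ d ∈ (v γ).support, (d.sum fun i e => (i.2 + 1) * e) < D}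
  zero_mem' := by simp
  add_mem' {v w} hv hw γ d hd := by
    classical
    rcases Finset.mem_union.mp (MvPolynomial.support_add hd) with h | h
    exacts [hv γ d h, hw γ d h]
  smul_mem' c v hv γ d hd := hv γ d (MvPolynomial.support_smul hd)

theorem osc_mem_degLT {K : Type*} [Field K] (q t : K) {M : ℕ} (a : Fin M) (n D : ℕ)
    {v : Fock K M} (hv : v ∈ degLT K M D) :
    osc q t a ((n + 1 : ℕ) : ℤ) v ∈ degLT K M (D - (n + 1)) := by
  intro γ d hd
  change d ∈ ((Finsupp.mapRange.linearMap (∑ b : Fin M, oscComm q t a b ((n : ℤ) + 1) •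
        (MvPolynomial.pderiv (R := K) (b, n)).toLinearMap) v) γ).support at hd
  rw [Finsupp.mapRange.linearMap_apply, Finsupp.mapRange_apply, LinearMap.sum_apply,
    MvPolynomial.mem_support_iff, MvPolynomial.coeff_sum] at hd
  obtain ⟨b, -, hb⟩ := Finset.exists_ne_zero_of_sum_ne_zero hd
  simp only [LinearMap.smul_apply, MvPolynomial.coeff_smul, smul_eq_mul] at hb
  have hb := right_ne_zero_of_mul hb
  change MvPolynomial.coeff d (MvPolynomial.pderiv (b, n) (v γ)) ≠ 0 at hb
  rw [MvPolynomial.coeff_pderiv] at hb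
  have h := hv γ _ (MvPolynomial.mem_support_iff.mpr (left_ne_zero_of_mul hb))
  rw [Finsupp.sum_add_index' (by simp) (by intros; ring)] at h
  simp at h
  omega

theorem coeff_pow_mem_degLT {K : Type*} [Field K] (q t : K) {M : ℕ} (a : Fin M) (j : ℕ) :
    ∀ (l D : ℕ) (v : Fock K M), v ∈ degLT K M D →
      PowerSeries.coeff l (annihilationField q t a ^ j) v ∈ degLT K M (D - l) := by
  induction j with
  | zero =>
    intro l D v hv
    rw [pow_zero, PowerSeries.coeff_one]
    split_ifs with h
    · simpa [h] using hv
    · exact Submodule.zero_mem _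
  | succ j ih =>
    intro l D v hv
    rw [pow_succ, PowerSeries.coeff_mul, LinearMap.sum_apply]
    refine Submodule.sum_mem _ fun p hp => ?_
    rw [Module.End.mul_apply, annihilationField, PowerSeries.coeff_mk]
    rcases p with ⟨i, _ | n⟩
    · simp
    · have hp : i + (n + 1) = l := by simpa using hp
      rw [← hp, add_comm i, ← Nat.sub_sub]
      refine ih _ _ _ ?_
      simp only [Nat.succ_ne_zero, if_false, LinearMap.smul_apply]
      exact Submodule.smul_mem _ _ (osc_mem_degLT q t a n D hv)

/-- On a given vector only finitely many coefficients act nontrivially. -/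
theorem expAnnihilation_locally_finite {K : Type*} [Field K] (q t : K) {M : ℕ} (a : Fin M)
    (v : Fock K M) : ∃ L : ℕ, ∀ l, L ≤ l → expAnnihilation q t a l v = 0 := by
  classical
  set wt : (Fin M × ℕ →₀ ℕ) → ℕ := fun d => d.sum fun i e => (i.2 + 1) * e
  have hv : v ∈ degLT K M ((v.support.sup fun γ => (v γ).support.sup wt) + 1) := by
    intro γ d hd
    have hγ : γ ∈ v.support := by
      rw [Finsupp.mem_support_iff]
      rintro h
      simp [h] at hd
    exact Nat.lt_succ_of_le ((Finset.le_sup (f := wt) hd).trans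
      (Finset.le_sup (f := fun γ => (v γ).support.sup wt) hγ))
  refine ⟨(v.support.sup fun γ => (v γ).support.sup wt) + 1, fun l hl => ?_⟩
  rw [expAnnihilation, expSeries, PowerSeries.coeff_mk, LinearMap.sum_apply]
  refine Finset.sum_eq_zero fun j _ => ?_
  have h := coeff_pow_mem_degLT q t a j l _ v hv
  rw [Nat.sub_eq_zero_of_le hl] at h
  rw [LinearMap.smul_apply]
  have : PowerSeries.coeff l (annihilationField q t a ^ j) v = 0 := by
    refine Finsupp.ext fun γ => ?_
    refine MvPolynomial.support_eq_empty.mp (Finset.eq_empty_of_forall_notMem fun d hd => ?_)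
    exact absurd (h γ d hd) (Nat.not_lt_zero _)
  rw [this, smul_zero]

/-- The sum of a pointwise finite sequence of operators. -/
def locallyFiniteSum {K V : Type*} [Field K] [AddCommGroup V] [Module K V]
    (T : ℕ → Module.End K V) (hT : ∀ v, (Function.support fun l => T l v).Finite) :
    Module.End K V where
  toFun v := ∑ᶠ l, T l v
  map_add' v w := by
    simp only [map_add]
    exact finsum_add_distrib (hT v) (hT w)
  map_smul' c v := by
    simp only [map_smul, RingHom.id_apply]
    exact (smul_finsum' c (hT v)).symm

theorem mode_locally_finite {K : Type*} [Field K] (q t : K) (β : ℕ) {M : ℕ} (a : Fin M) (m c : ℤ)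
    (v : Fock K M) :
    (Function.support fun l : ℕ =>
      (expPhiNonpos q t β a (m + l - c) * expAnnihilation q t a l) v).Finite := by
  obtain ⟨L, hL⟩ := expAnnihilation_locally_finite q t a v
  refine (Set.finite_lt_nat L).subset fun l hl => ?_
  by_contra h
  exact hl (by simp [hL l (not_lt.mp h)])

/-- The normally ordered exponential `:e^{φ^a(z)}: = e^{φ^a_{≤0}(z)} e^{φ^a_{≥0}(z)}` with
`e^{φ^a_{≥0}(z)} = exp(-∑_{n>0} (a^a_n / n) z^{-n}) z^{a^a_0}`: the coefficient of `z^m`. On the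
sector of charge `γ` the operator `z^{a^a_0}` is `z^{γ^a}`. -/
def vertexMode {K : Type*} [Field K] (q t : K) (β : ℕ) {M : ℕ} (a : Fin M) (m : ℤ) :
    Module.End K (Fock K M) :=
  Finsupp.lsum K fun γ =>
    locallyFiniteSum
        (fun l : ℕ => expPhiNonpos q t β a (m + l - γ a) * expAnnihilation q t a l)
        (mode_locally_finite q t β a m (γ a)) ∘ₗ
      Finsupp.lsingle γ

/-! ### The matrix element and its integral -/

/-- Formal distributions `∑_e c_e x^e`, `e ∈ ℤ^ι`, with coefficients in `R`. -/
abbrev FormalDistribution (ι R : Type*) : Type _ := (ι → ℤ) → R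

/-- `∮ ∏_i dx_i / (2πi x_i) F(x)`: the constant term of `F`. -/
def oint {ι R : Type*} (F : FormalDistribution ι R) : R := F 0

/-- `(r_1, …, r_N, r_{N+1})` with `r_{N+1} = n`. -/
def rExt {N : ℕ} (r : Fin N → ℕ) (n : ℕ) : Fin (N + 1) → ℕ := Fin.snoc r n

/-- The charges `α^a = β (r_{a+1} - r_a + 1) + s_a`, `a = 1, …, N + 1`, with `r_{N+1} = n`,
`r_{N+2} = 0`, and `s_{N+1} = s'`. -/
def chargeIn (β : ℕ) {N : ℕ} (r s : Fin N → ℕ) (n : ℕ) (s' : ℤ) : Fin (N + 1) → ℤ := fun a =>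
  let R : Fin (N + 2) → ℕ := Fin.snoc (rExt r n) 0
  let S : Fin (N + 1) → ℤ := Fin.snoc (fun b => (s b : ℤ)) s'
  (β : ℤ) * ((R a.succ : ℤ) - (R a.castSucc : ℤ) + 1) + S a

/-- The charges `α̃^a = α^a + β ∑_{b=1}^{N+1} A^{ab} r_b`. -/
def chargeOut (β : ℕ) {N : ℕ} (r s : Fin N → ℕ) (n : ℕ) (s' : ℤ) : Fin (N + 1) → ℤ := fun a =>
  chargeIn β r s n s' a + (β : ℤ) * ∑ b : Fin (N + 1), cartanA a b * (rExt r n b : ℤ)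

/-- The matrix element
`⟨α̃| ∏_{a=1}^N ∏_{j=1}^{r_a} :e^{φ^a(x^a_j)}: ∏_{i=1}^n e^{φ^{N+1}_{≤0}(x_i)} |α⟩`, with
`t = q^β` and ordered products (the first factor is leftmost), as a formal distribution in the
`x^a_j` with values in the power series in `x_1, …, x_n`. -/
def matrixElement {K : Type*} [Field K] (q : K) (β : ℕ) {N : ℕ} (r s : Fin N → ℕ) (n : ℕ)
    (s' : ℤ) : FormalDistribution (Σ a : Fin N, Fin (r a)) (MvPowerSeries (Fin n) K) :=
  fun e μ => bra K (chargeOut β r s n s')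
    (((List.ofFn fun a : Fin N =>
          (List.ofFn fun j : Fin (r a) => vertexMode q (q ^ β) β a.castSucc (e ⟨a, j⟩)).prod).prod *
        (List.ofFn fun i : Fin n => expPhiNonpos q (q ^ β) β (Fin.last N) (μ i)).prod)
      (ket K (chargeIn β r s n s')))

/-- `(-q^{(β-1)/2})^{(β/2) ∑_a r_a (r_a - 1)}`, that is,
`((-1)^β q^{β(β-1)/2})^{∑_a r_a (r_a - 1)/2}` with integral exponents. -/
def signPower {K : Type*} [Field K] (q : K) (β : ℕ) {N : ℕ} (r : Fin N → ℕ) : K :=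
  ((-1) ^ β * q ^ (β.choose 2)) ^ (∑ a, (r a).choose 2)

end

end MacBoson

open MacBoson

/-! The matrix element is evaluated from right to left, one block of equal-type vertex operators at
a time. Each block turns out to be a passage from the product `⟨ , ⟩_{q,t}` to the constant term
product.

Number the types from 0. Once the operators of type at least `k` have acted, the state is a
polynomial `p` in the creation operators of type at least `k`. Sending `a^k_{-n}` to
`(1-t^n)/(1-q^n) p_n` and the other creation operators to 0 (`thetaHom`) turns `p` into a symmetric
function `f_k`. The claim (`bra_take_prod`) is that the remaining operators followed by the dual
vacuum send `p` to a constant times `⟨f_k, P⟩_{q,t}`, where `P` belongs to the sum of the first `k`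
rectangles. For `k = 0` this holds because `P_∅ = 1` and pairing with 1 is taking the constant
coefficient. For `k = N` the function `f_N` is a product of coefficients of `exp(∑ p_n z^n /
⟨p_n,p_n⟩)`, and these pair with `P_λ` to give its monomial coefficients
(`scalarForm_prod_adjointSeries`), which is the assertion up to a constant.

The step from `a` to `a + 1` has four ingredients. Normal ordering `r_a` equal vertex operators
produces, up to sign, a power of `∏ z_j` times `Δ(z)` (`vertexMode_pow_single`); this uses `t =
q^β`. Moving them past the creation operators of the next type evaluates `f_{a+1}` at `z⁻¹`, while
their own creation parts reproduce the values of the previous `P` at `z`. The charges are tuned so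
that the power of `∏ z_j` is `s_a`, and in `r_a` variables multiplication by it adds the rectangle
`(s_a^{r_a})` to the diagram (`toVars_rectP`). The result is `r_a! ⟨f_{a+1}, P⟩'` for the new `P`,
and this is proportional to `⟨f_{a+1}, P⟩_{q,t}` because the Macdonald functions are orthogonal for
both products (`scalarForm_smul_primeForm`). The accumulated constants are inverse to `C⁺_λ` times
the sign power (`cPlus_mul_signPower`).

The required Macdonald theory comes from one operator `opE`, the constant term of a vertex operator
on symmetric functions. It is visibly self-adjoint for `⟨ , ⟩_{q,t}`; in `n` variables it is an
affine function of Macdonald's `q`-difference operator (`diffProd_mul_opE`); it is triangular on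
monomial functions, with eigenvalues that separate partitions because `q` is transcendental. This
yields existence, so that the chosen family really has the two defining properties, and from these
properties alone its members are eigenfunctions (`opE_macP`). The difference operator is also
self-adjoint for the constant term product, which gives the second orthogonality. -/

namespace MacBoson

noncomputable section

/-! ### The Euler derivation on power series -/

/-- The Euler derivation `z d/dz` on power series. -/
def eulerD {R : Type*} [Ring R] (f : PowerSeries R) : PowerSeries R :=
  PowerSeries.mk fun k => k • PowerSeries.coeff k f

section
variable {R : Type*} [Ring R]

@[simp] theorem coeff_eulerD (f : PowerSeries R) (k : ℕ) :
    PowerSeries.coeff k (eulerD f) = k • PowerSeries.coeff k f := PowerSeries.coeff_mk _ _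

theorem eulerD_one : eulerD (1 : PowerSeries R) = 0 := by
  ext k; rw [coeff_eulerD, PowerSeries.coeff_one]; split_ifs with h <;> simp [h]

theorem eulerD_mul (f g : PowerSeries R) : eulerD (f * g) = eulerD f * g + f * eulerD g := by
  ext k
  simp only [coeff_eulerD, PowerSeries.coeff_mul, map_add, Finset.smul_sum,
    ← Finset.sum_add_distrib]
  refine Finset.sum_congr rfl fun p hp => ?_
  rw [← Finset.HasAntidiagonal.mem_antidiagonal.mp hp, add_smul, smul_mul_assoc, mul_smul_comm]

theorem eulerD_pow (f : PowerSeries R) (h : Commute f (eulerD f)) (j : ℕ) :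
    eulerD (f ^ (j + 1)) = (j + 1) • (eulerD f * f ^ j) := by
  induction j with
  | zero => simp
  | succ j ih =>
    rw [pow_succ, eulerD_mul, ih, smul_mul_assoc, mul_assoc, ← pow_succ,
      (h.pow_left (j + 1)).eq, succ_nsmul _ (j + 1)]

theorem commute_of_coeff {f g : PowerSeries R}
    (h : ∀ i j, Commute (PowerSeries.coeff i f) (PowerSeries.coeff j g)) : Commute f g := by
  ext k
  rw [PowerSeries.coeff_mul, PowerSeries.coeff_mul, ← Finset.Nat.sum_antidiagonal_swap]
  exact Finset.sum_congr rfl fun p _ => (h _ _).eq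

theorem coeff_pow_eq_zero {f : PowerSeries R} (h0 : PowerSeries.coeff 0 f = 0) (i : ℕ) :
    ∀ b, b < i → PowerSeries.coeff b (f ^ i) = 0 := by
  induction i with
  | zero => simp
  | succ i ih =>
    intro b hb
    rw [pow_succ, PowerSeries.coeff_mul]
    refine Finset.sum_eq_zero fun p hp => ?_
    have hp := Finset.HasAntidiagonal.mem_antidiagonal.mp hp
    rcases Nat.eq_zero_or_pos p.2 with h | h
    · rw [h, h0, mul_zero]
    · rw [ih _ (by omega), zero_mul]

variable {K : Type*} [Field K] [Algebra K R]

theorem coeff_zero_expSeries (f : PowerSeries R) : PowerSeries.coeff 0 (expSeries K f) = 1 := by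
  simp [expSeries]

/-- Termwise `z d/dz` maps `f^{j+1}/(j+1)!` to `(z f') f^j/j!`. The ring need not be commutative, as
the coefficients will be operators; commuting coefficients of `f` are enough. -/
theorem eulerD_expSeries [CharZero K] {f : PowerSeries R} (h0 : PowerSeries.coeff 0 f = 0)
    (h : ∀ i j, Commute (PowerSeries.coeff i f) (PowerSeries.coeff j f)) :
    eulerD (expSeries K f) = eulerD f * expSeries K f := by
  have hc : Commute f (eulerD f) := commute_of_coeff fun i j => by
    rw [coeff_eulerD]; exact (h i j).smul_right j
  ext k
  -- The truncation of the exponential depends on the coefficient. Since `f^i` starts in degree `i`,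
  -- one truncation at `k` serves all lower coefficients at once.
  have e : ∀ b, b < k → PowerSeries.coeff b (expSeries K f) =
      ∑ i ∈ Finset.range k, ((i.factorial : K)⁻¹) • PowerSeries.coeff b (f ^ i) := by
    intro b hb
    rw [expSeries, PowerSeries.coeff_mk]
    refine Finset.sum_subset (Finset.range_mono hb) fun i _ hi => ?_
    rw [coeff_pow_eq_zero h0 i b (by simpa using hi), smul_zero]
  rw [PowerSeries.coeff_mul]
  have e2 : ∑ p ∈ Finset.HasAntidiagonal.antidiagonal k, PowerSeries.coeff p.1 (eulerD f) *
      PowerSeries.coeff p.2 (expSeries K f) = ∑ p ∈ Finset.HasAntidiagonal.antidiagonal k,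
      PowerSeries.coeff p.1 (eulerD f) *
      ∑ i ∈ Finset.range k, ((i.factorial : K)⁻¹) • PowerSeries.coeff p.2 (f ^ i) := by
    refine Finset.sum_congr rfl fun p hp => ?_
    have hp := Finset.HasAntidiagonal.mem_antidiagonal.mp hp
    rcases Nat.eq_zero_or_pos p.1 with h | h
    · simp [h]
    · rw [e _ (by omega)]
  rw [e2]
  simp only [Finset.mul_sum]
  rw [Finset.sum_comm, coeff_eulerD, expSeries, PowerSeries.coeff_mk, Finset.sum_range_succ',
    smul_add]
  have e3 : k • (((Nat.factorial 0 : ℕ) : K)⁻¹ • PowerSeries.coeff k (f ^ 0)) = 0 := by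
    rw [pow_zero, PowerSeries.coeff_one]; split_ifs with h <;> simp [h]
  rw [e3, add_zero, Finset.smul_sum]
  refine Finset.sum_congr rfl fun j _ => ?_
  have e4 := congrArg (PowerSeries.coeff k) (eulerD_pow f hc j)
  rw [coeff_eulerD, map_nsmul, PowerSeries.coeff_mul] at e4
  simp only [mul_smul_comm]
  rw [← Finset.smul_sum, smul_comm, e4, ← Nat.cast_smul_eq_nsmul K, smul_smul,
    Nat.factorial_succ]
  congr 1
  have : ((j + 1 : ℕ) : K) ≠ 0 := Nat.cast_ne_zero.mpr j.succ_ne_zero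
  have : ((j.factorial : ℕ) : K) ≠ 0 := Nat.cast_ne_zero.mpr j.factorial_ne_zero
  push_cast at *
  field_simp

/-- A power series is determined by its logarithmic derivative and its constant term. -/
theorem eq_of_eulerD_eq [CharZero K] {l F G : PowerSeries R} (hl : PowerSeries.coeff 0 l = 0)
    (hF : eulerD F = l * F) (hG : eulerD G = l * G)
    (h0 : PowerSeries.coeff 0 F = PowerSeries.coeff 0 G) : F = G := by
  ext k
  induction k using Nat.strong_induction_on with
  | _ k ih =>
    rcases Nat.eq_zero_or_pos k with rfl | hk
    · exact h0
    have e : k • PowerSeries.coeff k F = k • PowerSeries.coeff k G := by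
      rw [← coeff_eulerD, ← coeff_eulerD, hF, hG, PowerSeries.coeff_mul, PowerSeries.coeff_mul]
      refine Finset.sum_congr rfl fun p hp => ?_
      have hp := Finset.HasAntidiagonal.mem_antidiagonal.mp hp
      rcases Nat.eq_zero_or_pos p.1 with h | h
      · simp [h, hl]
      · rw [ih _ (by omega)]
    rw [← Nat.cast_smul_eq_nsmul K, ← Nat.cast_smul_eq_nsmul K] at e
    exact smul_right_injective R (Nat.cast_ne_zero.mpr hk.ne' : (k : K) ≠ 0) e

end

/-! ### Logarithmic derivatives of products and of geometric series -/

section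
variable {R : Type*} [CommRing R]

theorem eulerD_map {S : Type*} [CommRing S] (φ : R →+* S) (f : PowerSeries R) :
    eulerD (PowerSeries.map φ f) = PowerSeries.map φ (eulerD f) := by
  ext k; simp

theorem eulerD_prod {ι : Type*} (s : Finset ι) (l H : ι → PowerSeries R)
    (h : ∀ i ∈ s, eulerD (H i) = l i * H i) :
    eulerD (∏ i ∈ s, H i) = (∑ i ∈ s, l i) * ∏ i ∈ s, H i := by
  classical
  induction s using Finset.induction_on with
  | empty => simp [eulerD_one]
  | insert a s ha ih =>
    rw [Finset.prod_insert ha, Finset.sum_insert ha, eulerD_mul, h a (by simp),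
      ih fun i hi => h i (by simp [hi])]
    ring

theorem eulerD_of_mul_eq_one {l H G : PowerSeries R} (h : eulerD H = l * H) (hG : H * G = 1) :
    eulerD G = -l * G := by
  have e := eulerD_mul H G
  rw [hG, eulerD_one, h] at e
  calc eulerD G = (H * G) * eulerD G := by rw [hG, one_mul]
    _ = (l * H * G + H * eulerD G) * G - l * (H * G) * G := by ring
    _ = _ := by rw [← e, hG]; ring

/-- The geometric series `∑ y^n z^n`. -/
def geomSeries (y : R) : PowerSeries R := PowerSeries.mk fun n => y ^ n

theorem one_sub_mul_geomSeries (y : R) :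
    (1 - PowerSeries.C y * PowerSeries.X) * geomSeries y = 1 := by
  ext k
  rw [sub_mul, one_mul, mul_assoc, map_sub, PowerSeries.coeff_C_mul]
  rcases k with _ | k
  · simp [geomSeries]
  · rw [PowerSeries.coeff_succ_X_mul]
    simp [geomSeries, PowerSeries.coeff_one, pow_succ, mul_comm]

theorem eulerD_one_sub (y : R) : eulerD (1 - PowerSeries.C y * PowerSeries.X) =
    (1 - geomSeries y) * (1 - PowerSeries.C y * PowerSeries.X) := by
  rw [sub_mul, mul_comm (geomSeries y), one_sub_mul_geomSeries, one_mul]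
  ext k
  rw [coeff_eulerD]
  simp only [map_sub, PowerSeries.coeff_one, PowerSeries.coeff_C_mul, PowerSeries.coeff_X]
  split_ifs with h1 h2 h2 <;> simp_all

theorem eulerD_geomSeries (y : R) : eulerD (geomSeries y) = -(1 - geomSeries y) * geomSeries y :=
  eulerD_of_mul_eq_one (eulerD_one_sub y) (one_sub_mul_geomSeries y)

theorem coeff_one_sub_geomSeries (y : R) (n : ℕ) :
    PowerSeries.coeff n (1 - geomSeries y) = if n = 0 then 0 else -y ^ n := by
  rw [map_sub, PowerSeries.coeff_one, geomSeries, PowerSeries.coeff_mk]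
  split_ifs with h <;> simp [h]

end

/-- This recursion drives the inductions on degree below: two families of operators or functions
agree once they obey it with the same data. -/
theorem nsmul_coeff_eq_sum_range {R : Type*} [Ring R] {f F : PowerSeries R}
    (h : eulerD F = eulerD f * F) (k : ℕ) :
    k • PowerSeries.coeff k F = ∑ n ∈ Finset.range k,
      (n + 1) • (PowerSeries.coeff (n + 1) f * PowerSeries.coeff (k - (n + 1)) F) := by
  rw [← coeff_eulerD, h, PowerSeries.coeff_mul,
    Finset.Nat.sum_antidiagonal_eq_sum_range_succ (fun i j =>
      PowerSeries.coeff i (eulerD f) * PowerSeries.coeff j F), Finset.sum_range_succ']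
  simp [mul_assoc]

theorem map_coeff_expSeries {K R S : Type*} [Field K] [Ring R] [Ring S] [Algebra K R]
    [Algebra K S] (φ : R →ₐ[K] S) (f : PowerSeries R) (k : ℕ) :
    φ (PowerSeries.coeff k (expSeries K f)) =
      PowerSeries.coeff k (expSeries K (PowerSeries.map (φ : R →+* S) f)) := by
  simp only [expSeries, PowerSeries.coeff_mk, map_sum, map_smul, ← map_pow,
    PowerSeries.coeff_map]
  rfl

/-! ### Shift homomorphisms -/

section Shift
variable {K σ : Type*} [Field K] (w : σ → ℕ) (a : σ → K)

/-- The algebra homomorphism `f ↦ f(x_i + a_i z^{w_i})`. -/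
def shiftHom : MvPolynomial σ K →ₐ[K] Polynomial (MvPolynomial σ K) :=
  MvPolynomial.aeval fun i =>
    Polynomial.C (MvPolynomial.X i) + Polynomial.C (MvPolynomial.C (a i)) * Polynomial.X ^ w i

theorem shiftHom_X (i : σ) : shiftHom w a (MvPolynomial.X i) =
    Polynomial.C (MvPolynomial.X i) + Polynomial.C (MvPolynomial.C (a i)) * Polynomial.X ^ w i :=
  MvPolynomial.aeval_X _ _

theorem coeff_zero_shiftHom (hw : ∀ i, 0 < w i) (p : MvPolynomial σ K) :
    (shiftHom w a p).coeff 0 = p := by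
  have h : ((Polynomial.aeval (R := MvPolynomial σ K) (0 : MvPolynomial σ K)).restrictScalars
      K).comp (shiftHom w a) = AlgHom.id K _ := by
    refine MvPolynomial.algHom_ext fun i => ?_
    simp [shiftHom_X, (hw i).ne']
  have := DFunLike.congr_fun h p
  simpa [Polynomial.coeff_zero_eq_aeval_zero] using this

/-- The chain rule in `z`. There may be infinitely many variables, so the sum runs over any finite
set containing those that occur in `p`; enlarging the set only adds zeros. -/
theorem X_mul_derivative_shiftHom (hw : ∀ i, 0 < w i) (p : MvPolynomial σ K) :
    ∃ T₀ : Finset σ, ∀ T, T₀ ⊆ T → Polynomial.X * Polynomial.derivative (shiftHom w a p) =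
      ∑ i ∈ T, Polynomial.C (MvPolynomial.C ((w i : K) * a i)) *
        (shiftHom w a (MvPolynomial.pderiv i p) * Polynomial.X ^ w i) := by
  classical
  induction p using MvPolynomial.induction_on with
  | C c =>
    refine ⟨∅, fun T _ => ?_⟩
    rw [← MvPolynomial.algebraMap_eq, AlgHom.commutes]
    simp [← MvPolynomial.algebraMap_eq, Polynomial.algebraMap_apply]
  | add p p' h h' =>
    obtain ⟨T₀, h⟩ := h
    obtain ⟨T₁, h'⟩ := h'
    refine ⟨T₀ ∪ T₁, fun T hT => ?_⟩
    rw [map_add, map_add, mul_add, h T (Finset.union_subset_left hT),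
      h' T (Finset.union_subset_right hT), ← Finset.sum_add_distrib]
    refine Finset.sum_congr rfl fun i _ => ?_
    rw [map_add, map_add, add_mul, mul_add]
  | mul_X p j h =>
    obtain ⟨T₀, h⟩ := h
    refine ⟨insert j T₀, fun T hT => ?_⟩
    have hj : j ∈ T := hT (Finset.mem_insert_self _ _)
    have e : Polynomial.X * Polynomial.derivative (shiftHom w a (MvPolynomial.X j)) =
        Polynomial.C (MvPolynomial.C ((w j : K) * a j)) * Polynomial.X ^ w j := by
      obtain ⟨m, hm⟩ := Nat.exists_eq_add_of_lt (hw j)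
      rw [zero_add] at hm
      rw [shiftHom_X, hm, map_add, Polynomial.derivative_C, Polynomial.derivative_C_mul,
        Polynomial.derivative_X_pow, Nat.add_sub_cancel, zero_add, map_mul, map_mul, map_natCast,
        map_natCast, map_natCast, pow_succ]
      ring
    have e1 : Polynomial.X * Polynomial.derivative (shiftHom w a (p * MvPolynomial.X j)) =
        (Polynomial.X * Polynomial.derivative (shiftHom w a p)) * shiftHom w a (MvPolynomial.X j) +
        shiftHom w a p *
          (Polynomial.X * Polynomial.derivative (shiftHom w a (MvPolynomial.X j))) := by
      rw [map_mul, Polynomial.derivative_mul]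
      ring
    have e2 : ∀ i, shiftHom w a (MvPolynomial.pderiv i (p * MvPolynomial.X j)) =
        shiftHom w a (MvPolynomial.pderiv i p) * shiftHom w a (MvPolynomial.X j) +
        if j = i then shiftHom w a p else 0 := by
      intro i
      rw [MvPolynomial.pderiv_mul, MvPolynomial.pderiv_X, map_add, map_mul, map_mul]
      rcases eq_or_ne j i with rfl | hi
      · rw [Pi.single_eq_same, map_one, mul_one, if_pos rfl]
      · rw [Pi.single_eq_of_ne' hi.symm, map_zero, mul_zero, if_neg hi]
    rw [e1, h T ((Finset.subset_insert _ _).trans hT), e, Finset.sum_mul]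
    have e3 : ∀ i ∈ T.erase j, Polynomial.C (MvPolynomial.C ((w i : K) * a i)) *
        (shiftHom w a (MvPolynomial.pderiv i p) * Polynomial.X ^ w i) *
          shiftHom w a (MvPolynomial.X j) = Polynomial.C (MvPolynomial.C ((w i : K) * a i)) *
        (shiftHom w a (MvPolynomial.pderiv i (p * MvPolynomial.X j)) * Polynomial.X ^ w i) := by
      intro i hi
      rw [e2, if_neg (Finset.ne_of_mem_erase hi).symm, add_zero]
      ring
    rw [← Finset.add_sum_erase T _ hj, ← Finset.add_sum_erase T _ hj, e2, if_pos rfl,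
      Finset.sum_congr rfl e3]
    ring

/-- Variables of weight above `k` do not contribute to `z^k`, which gives a range of summation
independent of `p`. -/
theorem nsmul_coeff_shiftHom (hw : ∀ i, 0 < w i) (p : MvPolynomial σ K) (k : ℕ) (T : Finset σ)
    (hT : ∀ i, i ∈ T ↔ w i ≤ k) : k • (shiftHom w a p).coeff k = ∑ i ∈ T, ((w i : K) * a i) •
        (shiftHom w a (MvPolynomial.pderiv i p)).coeff (k - w i) := by
  classical
  obtain ⟨T₀, h⟩ := X_mul_derivative_shiftHom w a hw p
  have h := congrArg (fun f => Polynomial.coeff f k) (h (T₀ ∪ T) Finset.subset_union_left)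
  have e : (Polynomial.X * Polynomial.derivative (shiftHom w a p)).coeff k =
      k • (shiftHom w a p).coeff k := by
    rcases k with _ | k
    · simp
    · rw [Polynomial.coeff_X_mul, Polynomial.coeff_derivative, nsmul_eq_mul, mul_comm]
      push_cast; rfl
  simp only [e, Polynomial.finsetSum_coeff, Polynomial.coeff_C_mul, MvPolynomial.C_mul',
    Polynomial.coeff_mul_X_pow'] at h
  rw [h]
  refine (Finset.sum_subset Finset.subset_union_right fun i _ hi => ?_).symm.trans
    (Finset.sum_congr rfl fun i hi => ?_)
  · rw [if_neg (fun h => hi ((hT i).mpr h)), smul_zero]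
  · rw [if_pos ((hT i).mp hi)]

end Shift

/-- The shift homomorphism `p_n ↦ p_n + a_n z^n` of the ring of symmetric functions. -/
abbrev symShift {K : Type*} [Field K] (a : ℕ → K) : SymFun K →ₐ[K] Polynomial (SymFun K) :=
  shiftHom Nat.succ a

theorem nsmul_coeff_symShift {K : Type*} [Field K] (a : ℕ → K) (p : SymFun K) (k : ℕ) :
    k • (symShift a p).coeff k = ∑ n ∈ Finset.range k, (((n + 1 : ℕ) : K) * a n) •
        (symShift a (MvPolynomial.pderiv n p)).coeff (k - (n + 1)) :=
  nsmul_coeff_shiftHom _ a (fun i => i.succ_pos) p k _ fun i => by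
    rw [Finset.mem_range, Nat.succ_le_iff]

/-! ### The scalar product -/

section Scalar
variable {K : Type*} [Field K] {q t : K}

theorem scalarQT_eq_sum (f g : SymFun K) (S : Finset (ℕ →₀ ℕ)) (hS : f.support ⊆ S) :
    scalarQT q t f g = ∑ m ∈ S, f.coeff m * g.coeff m * zNorm q t m :=
  Finset.sum_subset hS fun m _ hm => by
    rw [MvPolynomial.notMem_support_iff.mp hm, zero_mul, zero_mul]

theorem scalarQT_comm (f g : SymFun K) : scalarQT q t f g = scalarQT q t g f := by
  classical
  rw [scalarQT_eq_sum f g _ Finset.subset_union_left,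
    scalarQT_eq_sum g f _ Finset.subset_union_right]
  exact Finset.sum_congr rfl fun m _ => by ring

theorem scalarQT_add_left (f f' g : SymFun K) :
    scalarQT q t (f + f') g = scalarQT q t f g + scalarQT q t f' g := by
  classical
  rw [scalarQT_eq_sum _ g _ MvPolynomial.support_add,
    scalarQT_eq_sum f g _ Finset.subset_union_left,
    scalarQT_eq_sum f' g _ Finset.subset_union_right, ← Finset.sum_add_distrib]
  exact Finset.sum_congr rfl fun m _ => by rw [MvPolynomial.coeff_add]; ring

theorem scalarQT_smul_left (c : K) (f g : SymFun K) :
    scalarQT q t (c • f) g = c * scalarQT q t f g := by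
  rw [scalarQT_eq_sum _ g _ MvPolynomial.support_smul, scalarQT, Finset.mul_sum]
  exact Finset.sum_congr rfl fun m _ => by rw [MvPolynomial.coeff_smul, smul_eq_mul]; ring

variable (q t) in
/-- The scalar product as a bilinear map. -/
def scalarForm : SymFun K →ₗ[K] SymFun K →ₗ[K] K :=
  LinearMap.mk₂ K (scalarQT q t) scalarQT_add_left scalarQT_smul_left
    (fun f g g' => by simp only [scalarQT_comm f, scalarQT_add_left])
    (fun c f g => by simp only [scalarQT_comm f, scalarQT_smul_left, smul_eq_mul])

@[simp] theorem scalarForm_apply (f g : SymFun K) : scalarForm q t f g = scalarQT q t f g := rfl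

theorem scalarForm_monomial (m : ℕ →₀ ℕ) (g : SymFun K) :
    scalarForm q t (MvPolynomial.monomial m 1) g = g.coeff m * zNorm q t m := by
  classical
  rw [scalarForm_apply, scalarQT_eq_sum _ g {m} MvPolynomial.support_monomial_subset]
  simp

theorem scalarForm_one (g : SymFun K) : scalarForm q t 1 g = g.coeff 0 := by
  have := scalarForm_monomial (q := q) (t := t) 0 g
  simpa [zNorm] using this

variable (q t) in
/-- `⟨p_n, p_n⟩` for the power sum of degree `n + 1`. -/
def powerNorm (n : ℕ) : K := ((n + 1 : ℕ) : K) * ((1 - q ^ (n + 1)) / (1 - t ^ (n + 1)))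

theorem zNorm_add_single (m : ℕ →₀ ℕ) (n : ℕ) :
    zNorm q t (m + Finsupp.single n 1) = ((m n + 1 : ℕ) : K) * powerNorm q t n * zNorm q t m := by
  classical
  have h1 : zNorm q t m = zNorm q t (m.erase n) * (((n + 1 : ℕ) : K) ^ m n * ((m n).factorial : K) *
      ((1 - q ^ (n + 1)) / (1 - t ^ (n + 1))) ^ m n) := by
    rw [zNorm, ← Finsupp.mul_prod_erase' m n _ (by simp), mul_comm, zNorm]
  have h2 : zNorm q t (m + Finsupp.single n 1) = zNorm q t (m.erase n) *
      (((n + 1 : ℕ) : K) ^ (m n + 1) * ((m n + 1).factorial : K) *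
      ((1 - q ^ (n + 1)) / (1 - t ^ (n + 1))) ^ (m n + 1)) := by
    rw [zNorm, ← Finsupp.mul_prod_erase' _ n _ (by simp), mul_comm, zNorm, Finsupp.erase_add,
      Finsupp.erase_single, add_zero]
    simp
  rw [h1, h2, powerNorm, Nat.factorial_succ]
  push_cast
  ring

/-- Multiplication by a power sum is adjoint to a multiple of the derivative in it: raising the
multiplicity of a part changes the norm by exactly the factor that differentiation brings down. -/
theorem scalarForm_X_mul (n : ℕ) (f h : SymFun K) : scalarForm q t (MvPolynomial.X n * f) h =
    powerNorm q t n * scalarForm q t f (MvPolynomial.pderiv n h) := by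
  induction f using MvPolynomial.induction_on' with
  | monomial m c =>
    have e1 : MvPolynomial.X n * MvPolynomial.monomial m c =
        c • MvPolynomial.monomial (m + Finsupp.single n 1) (1 : K) := by
      rw [MvPolynomial.X, MvPolynomial.monomial_mul, MvPolynomial.smul_monomial, add_comm]; simp
    have e2 : MvPolynomial.monomial m c = c • MvPolynomial.monomial m (1 : K) := by
      rw [MvPolynomial.smul_monomial]; simp
    rw [e1, e2]
    simp only [map_smul, LinearMap.smul_apply, scalarForm_monomial, zNorm_add_single,
      MvPolynomial.coeff_pderiv, smul_eq_mul]
    push_cast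
    ring
  | add f f' h1 h2 =>
    simp only [mul_add, map_add, LinearMap.add_apply, h1, h2]

/-- The series `exp(∑_n (a_n / ⟨p_n, p_n⟩) p_n z^n)`, whose coefficients are adjoint to those of
the shift homomorphism `p_n ↦ p_n + a_n z^n`. -/
def adjointSeries (q t : K) (a : ℕ → K) : PowerSeries (SymFun K) :=
  expSeries K (PowerSeries.mk fun n =>
    if n = 0 then 0 else MvPolynomial.C (a (n - 1) / powerNorm q t (n - 1)) *
      MvPolynomial.X (n - 1))

theorem eulerD_adjointSeries [CharZero K] (q t : K) (a : ℕ → K) :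
    eulerD (adjointSeries q t a) = eulerD (PowerSeries.mk fun n =>
      if n = 0 then 0 else MvPolynomial.C (a (n - 1) / powerNorm q t (n - 1)) *
        MvPolynomial.X (n - 1)) * adjointSeries q t a :=
  eulerD_expSeries (by simp) fun _ _ => Commute.all _ _

theorem nsmul_coeff_adjointSeries [CharZero K] (q t : K) (a : ℕ → K) (k : ℕ) :
    k • PowerSeries.coeff k (adjointSeries q t a) = ∑ n ∈ Finset.range k,
      (((n + 1 : ℕ) : K) * (a n / powerNorm q t n)) •
        (MvPolynomial.X n * PowerSeries.coeff (k - (n + 1)) (adjointSeries q t a)) := by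
  rw [nsmul_coeff_eq_sum_range (eulerD_adjointSeries q t a)]
  refine Finset.sum_congr rfl fun n _ => ?_
  rw [PowerSeries.coeff_mk, if_neg n.succ_ne_zero, Nat.add_sub_cancel, mul_smul,
    Nat.cast_smul_eq_nsmul, MvPolynomial.C_mul', smul_mul_assoc]

/-- Both sides satisfy the same recursion in `k`. Each `X n` moves across the form as `powerNorm`
times a derivative, and this norm cancels the denominator in the exponent of the series. -/
theorem scalarForm_adjointSeries [CharZero K] (hz : ∀ n, powerNorm q t n ≠ 0) (a : ℕ → K) (k : ℕ) :
    ∀ f h : SymFun K, scalarForm q t (PowerSeries.coeff k (adjointSeries q t a) * f) h =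
      scalarForm q t f ((symShift a h).coeff k) := by
  induction k using Nat.strong_induction_on with
  | _ k ih =>
    intro f h
    rcases Nat.eq_zero_or_pos k with rfl | hk
    · rw [coeff_zero_shiftHom _ _ (fun i => i.succ_pos), adjointSeries, coeff_zero_expSeries,
        one_mul]
    have hk' : (k : K) ≠ 0 := Nat.cast_ne_zero.mpr hk.ne'
    refine mul_left_cancel₀ hk' ?_
    rw [← nsmul_eq_mul, ← nsmul_eq_mul, ← LinearMap.smul_apply, ← map_nsmul, ← map_nsmul,
      ← smul_mul_assoc, nsmul_coeff_adjointSeries,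
      nsmul_coeff_symShift, Finset.sum_mul, map_sum, map_sum, LinearMap.sum_apply]
    refine Finset.sum_congr rfl fun n hn => ?_
    have hn := Finset.mem_range.mp hn
    rw [smul_mul_assoc, map_smul, map_smul, LinearMap.smul_apply, mul_assoc, scalarForm_X_mul,
      ih _ (by omega)]
    simp only [smul_eq_mul]
    field_simp [hz n]

theorem eq_zero_of_scalarForm (hz : ∀ n, powerNorm q t n ≠ 0) [CharZero K] {f : SymFun K}
    (h : ∀ g, scalarForm q t f g = 0) : f = 0 := by
  have hz' : ∀ m, zNorm q t m ≠ 0 := by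
    intro m
    refine Finset.prod_ne_zero_iff.mpr fun r _ => ?_
    have h1 : ((r + 1 : ℕ) : K) ≠ 0 := Nat.cast_ne_zero.mpr r.succ_ne_zero
    have h2 := right_ne_zero_of_mul (hz r)
    exact mul_ne_zero (mul_ne_zero (pow_ne_zero _ h1) (Nat.cast_ne_zero.mpr
      (Nat.factorial_ne_zero _))) (pow_ne_zero _ h2)
  refine MvPolynomial.ext _ _ fun m => ?_
  have := h (MvPolynomial.monomial m 1)
  rw [scalarForm_apply, scalarQT_comm, ← scalarForm_apply, scalarForm_monomial] at this
  simpa [hz' m] using this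

/-! ### The reproducing kernel -/

theorem toVars_X {n : ℕ} (r : ℕ) : toVars n (MvPolynomial.X r : SymFun K) =
    MvPolynomial.psum (Fin n) K (r + 1) := MvPolynomial.aeval_X _ _

/-- Separating one variable `z` changes each power sum `p_r` into `p_r + z^r`, which is the shift
with all constants equal to 1. -/
theorem finSuccEquiv_toVars (n : ℕ) (f : SymFun K) :
    MvPolynomial.finSuccEquiv K n (toVars (n + 1) f) =
      Polynomial.map (toVars (K := K) n).toRingHom (symShift (fun _ => 1) f) := by
  have h : (MvPolynomial.finSuccEquiv K n).toAlgHom.comp (toVars (n + 1)) =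
      (Polynomial.mapAlgHom (toVars (K := K) n)).comp (symShift (fun _ => 1)) := by
    refine MvPolynomial.algHom_ext fun r => ?_
    simp only [AlgHom.comp_apply, toVars_X, shiftHom_X, MvPolynomial.psum,
      Fin.sum_univ_succ]
    simp [toVars_X, MvPolynomial.psum, MvPolynomial.finSuccEquiv_X_zero,
      MvPolynomial.finSuccEquiv_X_succ, add_comm]
  exact DFunLike.congr_fun h f

/-- The coefficient form of the reproducing kernel. Each factor is adjoint to splitting off one
variable, so variables are removed one by one until only the constant coefficient is left. -/
theorem scalarForm_prod_adjointSeries [CharZero K] (hz : ∀ n, powerNorm q t n ≠ 0) (n : ℕ)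
    (v : Fin n →₀ ℕ) (f : SymFun K) :
    scalarForm q t (∏ j, PowerSeries.coeff (v j) (adjointSeries q t fun _ => 1)) f =
      (toVars n f).coeff v := by
  induction n generalizing f with
  | zero =>
    have h : (MvPolynomial.constantCoeff (R := K) (σ := Fin 0)).comp
        (toVars (K := K) 0).toRingHom = MvPolynomial.constantCoeff := by
      refine MvPolynomial.ringHom_ext (fun c => ?_) fun r => ?_
      · simp [← MvPolynomial.algebraMap_eq]
      · simp [toVars_X, MvPolynomial.psum]
    have h := DFunLike.congr_fun h f
    rw [Subsingleton.elim v 0, Finset.univ_eq_empty, Finset.prod_empty, scalarForm_one]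
    exact h.symm
  | succ n ih =>
    rw [Fin.prod_univ_succ, scalarForm_adjointSeries hz, ← Finsupp.cons_tail v,
      ← MvPolynomial.finSuccEquiv_coeff_coeff, finSuccEquiv_toVars, Polynomial.coeff_map]
    have := ih (Finsupp.tail v) ((symShift (fun _ => 1) f).coeff (v 0))
    simpa [Finsupp.tail_apply] using this

/-! ### A self-adjoint operator -/

/-- The shift `p_n ↦ p_n - (1 - q^n) z^n`. -/
abbrev qShift (q : K) : SymFun K →ₐ[K] Polynomial (SymFun K) :=
  symShift fun n => -(1 - q ^ (n + 1))

/-- The series adjoint to the shift `qShift`. -/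
abbrev qSeries (q t : K) : PowerSeries (SymFun K) :=
  adjointSeries q t fun n => -(1 - q ^ (n + 1))

/-- The Macdonald operator on the ring of symmetric functions, the constant term of a vertex
operator. -/
def opE (q t : K) : SymFun K →ₗ[K] SymFun K :=
  Polynomial.lsum (fun k => ((t ^ k)⁻¹ : K) •
    LinearMap.mulLeft K (PowerSeries.coeff k (qSeries q t))) ∘ₗ (qShift q).toLinearMap

theorem opE_eq_sum (f : SymFun K) (N : ℕ) (hN : (qShift q f).natDegree < N) :
    opE q t f = ∑ k ∈ Finset.range N,
      ((t ^ k)⁻¹ : K) • (PowerSeries.coeff k (qSeries q t) * (qShift q f).coeff k) := by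
  rw [opE, LinearMap.comp_apply, Polynomial.lsum_apply]
  exact Polynomial.sum_over_range' _ (by simp) N hN

/-- Adjointness of `qSeries` and `qShift` rewrites the left side as `∑ t^{-k} ⟨f_k, g_k⟩`, with
`f_k` and `g_k` the coefficients of the shifted functions; this is symmetric in `f` and `g`. -/
theorem scalarForm_opE [CharZero K] (hz : ∀ n, powerNorm q t n ≠ 0) (f g : SymFun K) :
    scalarForm q t (opE q t f) g = scalarForm q t f (opE q t g) := by
  have key : ∀ f g N, (qShift q f).natDegree < N → scalarForm q t (opE q t f) g =
      ∑ k ∈ Finset.range N,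
        (t ^ k)⁻¹ * scalarForm q t ((qShift q f).coeff k) ((qShift q g).coeff k) := by
    intro f g N hN
    rw [opE_eq_sum f N hN, map_sum, LinearMap.sum_apply]
    refine Finset.sum_congr rfl fun k _ => ?_
    rw [map_smul, LinearMap.smul_apply, scalarForm_adjointSeries hz, smul_eq_mul]
  have symm : ∀ f g : SymFun K, scalarForm q t f g = scalarForm q t g f :=
    fun f g => scalarQT_comm f g
  rw [symm f, key f g (max (qShift q f).natDegree (qShift q g).natDegree + 1) (by omega),
    key g f (max (qShift q f).natDegree (qShift q g).natDegree + 1) (by omega)]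
  exact Finset.sum_congr rfl fun k _ => by rw [symm]

end Scalar

/-! ### The operator in finitely many variables -/

/-- A partial fraction expansion with cleared denominators. -/
theorem partial_fractions {S : Type*} [CommRing S] [IsDomain S] {n : ℕ} (a : Fin n → S)
    (ha : Function.Injective a) (ha0 : ∀ i, a i ≠ 0) (t v : S) (u : Fin n → S)
    (hu : ∀ i, v * ∏ j ∈ Finset.univ.erase i, (t * a i - a j) =
      u i * ∏ j ∈ Finset.univ.erase i, (a i - a j)) (y : S) :
    v * ∏ j, (t * y - a j) = v * ∏ j, (y - a j) +
      (t - 1) * y * ∑ i, u i * ∏ j ∈ Finset.univ.erase i, (y - a j) := by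
  classical
  open Polynomial in
  let P : Polynomial S := C v * ∏ j, (C t * X - C (a j)) - (C v * ∏ j, (X - C (a j)) +
    C (t - 1) * X * ∑ i, C (u i) * ∏ j ∈ Finset.univ.erase i, (X - C (a j)))
  have hev : ∀ z, P.eval z = v * ∏ j, (t * z - a j) - (v * ∏ j, (z - a j) +
      (t - 1) * z * ∑ i, u i * ∏ j ∈ Finset.univ.erase i, (z - a j)) := by
    intro z
    simp [P, Polynomial.eval_prod, Polynomial.eval_finsetSum]
  suffices hP : P = 0 by
    have := hev y
    rw [hP, Polynomial.eval_zero] at this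
    exact sub_eq_zero.mp this.symm
  have hdeg : P.natDegree ≤ n := by
    have h1 : ∀ c d : S, (Polynomial.C c * Polynomial.X - Polynomial.C d).natDegree ≤ 1 := by
      intro c d; compute_degree
    have h1' : ∀ d : S, (Polynomial.X - Polynomial.C d).natDegree ≤ 1 := by
      intro d; compute_degree
    have h2 : ∀ (s : Finset (Fin n)) (f : Fin n → Polynomial S), (∀ i, (f i).natDegree ≤ 1) →
        (∏ i ∈ s, f i).natDegree ≤ s.card := by
      intro s f hf
      refine (Polynomial.natDegree_prod_le _ _).trans ((Finset.sum_le_sum fun i _ => hf i).trans ?_)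
      simp
    refine (Polynomial.natDegree_sub_le _ _).trans (max_le ?_ ((Polynomial.natDegree_add_le _ _).trans
      (max_le ?_ ?_)))
    · refine (Polynomial.natDegree_C_mul_le _ _).trans ((h2 _ _ fun i => h1 _ _).trans ?_)
      simp
    · refine (Polynomial.natDegree_C_mul_le _ _).trans ((h2 _ _ fun i => h1' _).trans ?_)
      simp
    · rw [mul_assoc]
      refine (Polynomial.natDegree_C_mul_le _ _).trans ?_
      rw [Finset.mul_sum]
      refine Polynomial.natDegree_sum_le_of_forall_le _ _ fun i _ => ?_
      have hn : 0 < n := i.pos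
      rw [mul_left_comm]
      refine (Polynomial.natDegree_C_mul_le _ _).trans (Polynomial.natDegree_mul_le.trans ?_)
      have := h2 (Finset.univ.erase i) (fun j => Polynomial.X - Polynomial.C (a j))
        fun i => h1' _
      rw [Finset.card_erase_of_mem (Finset.mem_univ _), Finset.card_univ, Fintype.card_fin] at this
      rw [Polynomial.natDegree_X]
      omega
  -- There are `n + 1` distinct zeros against degree at most `n`. At 0 the two products coincide,
  -- and at `a i` only the `i`-th summand survives, which is what `hu` prescribes.
  refine Polynomial.eq_zero_of_natDegree_lt_card_of_eval_eq_zero' P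
    (insert 0 (Finset.univ.image a)) (fun z hz => ?_) ?_
  · rw [hev, sub_eq_zero]
    rcases Finset.mem_insert.mp hz with rfl | hz
    · simp
    · obtain ⟨i, -, rfl⟩ := Finset.mem_image.mp hz
      rw [Finset.prod_eq_zero (f := fun j => a i - a j) (Finset.mem_univ i) (sub_self _), mul_zero, zero_add,
        Finset.sum_eq_single_of_mem i (Finset.mem_univ i), ← hu,
        ← Finset.mul_prod_erase Finset.univ _ (Finset.mem_univ i)]
      · ring
      · intro j _ hj
        rw [Finset.prod_eq_zero (f := fun j => a i - a j) (Finset.mem_erase.mpr ⟨hj.symm, Finset.mem_univ i⟩) (sub_self _),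
          mul_zero]
  · rw [Finset.card_insert_of_notMem, Finset.card_image_of_injective _ ha, Finset.card_univ,
      Fintype.card_fin]
    · omega
    · simpa using ha0

/-! ### The `q`-difference operator with cleared denominators -/

section
variable (K : Type*) [Field K] (n : ℕ)

/-- `∏_{i ≠ j} (x_i - x_j)`, over ordered pairs. -/
def diffProd : MvPolynomial (Fin n) K :=
  ∏ i, ∏ j ∈ Finset.univ.erase i, (MvPolynomial.X i - MvPolynomial.X j)

variable {K n}

/-- `∏_{i ≠ j} (x_i - x_j)` times `∏_{j ≠ i} (t x_i - x_j) / (x_i - x_j)`. -/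
def diffNum (t : K) (i : Fin n) : MvPolynomial (Fin n) K :=
  (∏ j ∈ Finset.univ.erase i, (MvPolynomial.C t * MvPolynomial.X i - MvPolynomial.X j)) *
    ∏ k ∈ Finset.univ.erase i, ∏ j ∈ Finset.univ.erase k, (MvPolynomial.X k - MvPolynomial.X j)

theorem diffNum_mul (t : K) (i : Fin n) :
    diffProd K n * ∏ j ∈ Finset.univ.erase i,
        (MvPolynomial.C t * MvPolynomial.X i - MvPolynomial.X j) =
      diffNum t i * ∏ j ∈ Finset.univ.erase i, (MvPolynomial.X i - MvPolynomial.X j) := by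
  rw [diffProd, diffNum, ← Finset.mul_prod_erase Finset.univ _ (Finset.mem_univ i)]
  ring

/-- The operator `x_i ↦ q x_i`. -/
def qScale (q : K) (i : Fin n) : MvPolynomial (Fin n) K →ₐ[K] MvPolynomial (Fin n) K :=
  MvPolynomial.aeval fun j => MvPolynomial.C (if j = i then q else 1) * MvPolynomial.X j

theorem coeff_qScale (q : K) (i : Fin n) (f : MvPolynomial (Fin n) K) (m : Fin n →₀ ℕ) :
    (qScale q i f).coeff m = q ^ m i * f.coeff m := by
  classical
  induction f using MvPolynomial.induction_on' with
  | monomial m' c =>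
    have : qScale q i (MvPolynomial.monomial m' c) = MvPolynomial.monomial m' (q ^ m' i * c) := by
      rw [qScale, MvPolynomial.aeval_monomial, MvPolynomial.monomial_eq, map_mul, map_pow,
        Finsupp.prod_fintype _ _ (by simp), Finsupp.prod_fintype _ _ (by simp)]
      simp only [mul_pow, Finset.prod_mul_distrib, MvPolynomial.algebraMap_eq]
      rw [Finset.prod_eq_single_of_mem i (Finset.mem_univ i)]
      · simp; ring
      · intro j _ hj
        simp [hj]
    rw [this, MvPolynomial.coeff_monomial, MvPolynomial.coeff_monomial]
    split_ifs with h
    · rw [h]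
    · simp
  | add f g hf hg => rw [map_add, MvPolynomial.coeff_add, hf, hg, MvPolynomial.coeff_add, mul_add]

theorem toVars_C (c : K) : toVars n (MvPolynomial.C c : SymFun K) = MvPolynomial.C c := by
  rw [← MvPolynomial.algebraMap_eq, AlgHom.commutes, MvPolynomial.algebraMap_eq]

/-- Scaling `x_i` by `q` lowers `p_r` by `(1 - q^r) x_i^r`, which is the effect of `qShift` at `z =
x_i`. -/
theorem toVars_qShift (q : K) (i : Fin n) (f : SymFun K) (N : ℕ)
    (hN : (qShift q f).natDegree < N) : qScale q i (toVars n f) =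
      ∑ k ∈ Finset.range N, toVars n ((qShift q f).coeff k) * MvPolynomial.X i ^ k := by
  have h : (qScale q i).comp (toVars n) =
      ((Polynomial.aeval (R := MvPolynomial (Fin n) K) (MvPolynomial.X i)).restrictScalars K).comp
        ((Polynomial.mapAlgHom (toVars (K := K) n)).comp (qShift q)) := by
    refine MvPolynomial.algHom_ext fun r => ?_
    simp only [AlgHom.comp_apply, toVars_X, shiftHom_X, MvPolynomial.psum, map_sum, map_pow,
      qScale, MvPolynomial.aeval_X]
    simp only [AlgHom.coe_restrictScalars', map_add, map_mul, map_pow, Polynomial.coe_mapAlgHom,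
      Polynomial.map_C, Polynomial.map_X, Polynomial.aeval_C, Polynomial.aeval_X, RingHom.coe_coe,
      toVars_X, MvPolynomial.psum, Algebra.algebraMap_self_apply]
    rw [← Finset.add_sum_erase _ _ (Finset.mem_univ i),
      ← Finset.add_sum_erase _ _ (Finset.mem_univ i), Finset.sum_congr rfl fun j hj => by
        rw [if_neg (Finset.ne_of_mem_erase hj), map_one, one_mul]]
    rw [toVars_C, if_pos rfl, mul_pow, ← map_pow, map_neg, map_sub, map_one, Nat.succ_eq_add_one]
    ring
  have h := DFunLike.congr_fun h f
  simp only [AlgHom.comp_apply, AlgHom.coe_restrictScalars', Polynomial.coe_mapAlgHom] at h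
  rw [h, Polynomial.aeval_eq_sum_range' (lt_of_le_of_lt Polynomial.natDegree_map_le hN)]
  exact Finset.sum_congr rfl fun k _ => by simp

variable {q t : K}

/-- The exponent is `-∑ (1 - t^n) p_n z^n / n`, the logarithm of `∏ (1 - x_i z)/(1 - t x_i z)`.
Logarithmic derivatives and constant terms are compared. -/
theorem map_qSeries [CharZero K] (hz : ∀ n, powerNorm q t n ≠ 0) :
    PowerSeries.map (toVars (K := K) n).toRingHom (qSeries q t) =
      ∏ i : Fin n, ((1 - PowerSeries.C (MvPolynomial.X i) * PowerSeries.X) *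
        geomSeries (MvPolynomial.C t * MvPolynomial.X i)) := by
  have h1 := congrArg (PowerSeries.map (toVars (K := K) n).toRingHom)
    (eulerD_adjointSeries q t fun n => -(1 - q ^ (n + 1)))
  rw [map_mul, ← eulerD_map, ← eulerD_map] at h1
  refine eq_of_eulerD_eq (K := K) (by simp) h1 ((eulerD_prod _ (fun i => (1 - geomSeries
    (MvPolynomial.X i)) + -(1 - geomSeries (MvPolynomial.C t * MvPolynomial.X i))) _
    fun i _ => ?_).trans ?_) ?_
  · rw [eulerD_mul, eulerD_one_sub, eulerD_geomSeries]
    ring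
  · congr 1
    ext k : 1
    rw [coeff_eulerD, map_sum, PowerSeries.coeff_map, PowerSeries.coeff_mk]
    simp only [map_add, map_neg, coeff_one_sub_geomSeries]
    rcases k with _ | k
    · simp
    · have hz := hz k
      have h2 : ((k + 1 : ℕ) : K) ≠ 0 := Nat.cast_ne_zero.mpr k.succ_ne_zero
      have h3 : (1 - q ^ (k + 1)) ≠ 0 := by
        rintro h; simp [powerNorm, h] at hz
      have h4 : (1 - t ^ (k + 1)) ≠ 0 := by
        rintro h; simp [powerNorm, h] at hz
      -- The factor `1 - q^{k+1}` cancels against the one in the norm, so the result depends on `t`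
      -- only.
      have e : (k + 1) • (-(1 - q ^ (k + 1)) / powerNorm q t k) = -(1 - t ^ (k + 1)) := by
        rw [powerNorm, nsmul_eq_mul]
        field_simp
      simp only [Nat.succ_ne_zero, if_false, Nat.add_sub_cancel]
      rw [← map_nsmul, ← smul_mul_assoc, ← map_nsmul, e]
      change _ = toVars (K := K) n _
      rw [map_mul, toVars_C, toVars_X, MvPolynomial.psum, Finset.mul_sum]
      refine Finset.sum_congr rfl fun i _ => ?_
      rw [map_neg, map_sub, map_one, map_pow, mul_pow]
      ring
  · rw [PowerSeries.coeff_map, qSeries, adjointSeries, coeff_zero_expSeries, map_one,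
      PowerSeries.coeff_zero_eq_constantCoeff_apply, map_prod]
    refine (Finset.prod_eq_one fun i _ => ?_).symm
    rw [map_mul, ← PowerSeries.coeff_zero_eq_constantCoeff_apply,
      ← PowerSeries.coeff_zero_eq_constantCoeff_apply]
    simp [geomSeries]

/-- Replacing `z` by `z/t` creates the weights `t^{-k}` and turns the product into `t^{-n} ∏ (t -
x_i z)/(1 - x_i z)`. Its partial fraction expansion has the residues `∏ (t x_i - x_j)/(x_i - x_j)`
of the Macdonald operator. -/
theorem diffProd_mul_coeff_qSeries [CharZero K] (ht : t ≠ 0) (hz : ∀ n, powerNorm q t n ≠ 0)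
    (k : ℕ) : MvPolynomial.C (t ^ n * (t ^ k)⁻¹) * diffProd K n *
        toVars n (PowerSeries.coeff k (qSeries q t)) =
      (if k = 0 then diffProd K n else 0) +
        MvPolynomial.C (t - 1) * ∑ i, diffNum t i * MvPolynomial.X i ^ k := by
  set R := MvPolynomial (Fin n) K
  let x : Fin n → R := MvPolynomial.X
  have hx : ∀ i, x i ≠ 0 := fun i => MvPolynomial.X_ne_zero i
  have hX : Function.Injective fun i : Fin n => PowerSeries.C (x i) * (PowerSeries.X : PowerSeries R) := by
    intro i j h
    exact MvPolynomial.X_injective (PowerSeries.C_injective (mul_right_cancel₀ PowerSeries.X_ne_zero h))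
  -- The points are `x_i z` and the evaluation point is `y = 1`. The ratios of differences of these
  -- points do not involve `z`, so `diffNum` supplies the numerators.
  have hpf := partial_fractions (fun i : Fin n => PowerSeries.C (x i) * (PowerSeries.X : PowerSeries R))
    hX (fun i => mul_ne_zero (by
      rw [Ne, map_eq_zero_iff _ PowerSeries.C_injective]; exact hx i) PowerSeries.X_ne_zero)
    (PowerSeries.C (MvPolynomial.C t)) (PowerSeries.C (diffProd K n))
    (fun i => PowerSeries.C (diffNum t i)) (fun i => by
      simp only [← mul_assoc, ← sub_mul, ← map_mul, ← map_sub, Finset.prod_mul_distrib,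
        ← map_prod]
      rw [diffNum_mul]) 1
  set F : PowerSeries R := PowerSeries.rescale (MvPolynomial.C t⁻¹)
    (PowerSeries.map (toVars (K := K) n).toRingHom (qSeries q t)) with hF
  have hprod : (∏ i : Fin n, (1 - PowerSeries.C (x i) * PowerSeries.X)) ≠ 0 := by
    refine Finset.prod_ne_zero_iff.mpr fun i _ h => ?_
    have := one_sub_mul_geomSeries (x i)
    rw [h, zero_mul] at this
    exact zero_ne_one this
  have hFp : PowerSeries.C (MvPolynomial.C t ^ n) * F *
      ∏ i : Fin n, (1 - PowerSeries.C (x i) * PowerSeries.X) =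
      ∏ i : Fin n, (PowerSeries.C (MvPolynomial.C t) - PowerSeries.C (x i) * PowerSeries.X) := by
    rw [hF, map_qSeries hz, map_prod, mul_assoc, ← Finset.prod_mul_distrib]
    have : PowerSeries.C ((MvPolynomial.C t : R) ^ n) =
        ∏ i : Fin n, PowerSeries.C (MvPolynomial.C t : R) := by
      simp
    rw [this, ← Finset.prod_mul_distrib]
    refine Finset.prod_congr rfl fun i _ => ?_
    have h1 : PowerSeries.rescale (MvPolynomial.C t⁻¹ : R) (geomSeries (MvPolynomial.C t * x i)) =
        geomSeries (x i) := by
      ext k : 1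
      rw [PowerSeries.coeff_rescale, geomSeries, geomSeries, PowerSeries.coeff_mk,
        PowerSeries.coeff_mk, ← mul_pow, ← mul_assoc, ← map_mul, inv_mul_cancel₀ ht, map_one,
        one_mul]
    have h2 : PowerSeries.rescale (MvPolynomial.C t⁻¹ : R)
        (1 - PowerSeries.C (x i) * PowerSeries.X) =
        1 - PowerSeries.C (x i) * (PowerSeries.C (MvPolynomial.C t⁻¹) * PowerSeries.X) := by
      rw [map_sub, map_one, map_mul, PowerSeries.rescale_X]
      congr 2
      ext k : 1
      rw [PowerSeries.coeff_rescale, PowerSeries.coeff_C]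
      split_ifs with h <;> simp [h]
    have h3 : PowerSeries.C (MvPolynomial.C t : R) * PowerSeries.C (MvPolynomial.C t⁻¹) = 1 := by
      rw [← map_mul, ← map_mul, mul_inv_cancel₀ ht, map_one, map_one]
    change _ * (PowerSeries.rescale _ ((1 - PowerSeries.C (x i) * PowerSeries.X) *
      geomSeries (MvPolynomial.C t * x i)) * _) = _
    rw [map_mul, h1, h2, mul_assoc (1 - _) (geomSeries _), mul_comm (geomSeries _),
      one_sub_mul_geomSeries]
    linear_combination (-PowerSeries.C (x i) * PowerSeries.X) * h3
  have hmain : PowerSeries.C (MvPolynomial.C t ^ n) * PowerSeries.C (diffProd K n) * F =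
      PowerSeries.C (diffProd K n) + (PowerSeries.C (MvPolynomial.C t) - 1) *
        ∑ i, PowerSeries.C (diffNum t i) * geomSeries (x i) := by
    refine mul_right_cancel₀ hprod ?_
    simp only [mul_one] at hpf
    have hsum : (∑ i, PowerSeries.C (diffNum t i) * geomSeries (x i)) *
        ∏ i : Fin n, (1 - PowerSeries.C (x i) * PowerSeries.X) =
        ∑ i, PowerSeries.C (diffNum t i) *
          ∏ j ∈ Finset.univ.erase i, (1 - PowerSeries.C (x j) * PowerSeries.X) := by
      rw [Finset.sum_mul]
      refine Finset.sum_congr rfl fun i _ => ?_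
      rw [← Finset.mul_prod_erase Finset.univ _ (Finset.mem_univ i), mul_assoc,
        ← mul_assoc (geomSeries _), mul_comm (geomSeries _), one_sub_mul_geomSeries, one_mul]
    rw [mul_comm (PowerSeries.C (MvPolynomial.C t ^ n)), mul_assoc, mul_assoc, ← mul_assoc _ F,
      hFp, add_mul, hpf, mul_assoc (_ - _), hsum]
  have h := congrArg (PowerSeries.coeff k) hmain
  rw [← map_mul, PowerSeries.coeff_C_mul, hF, PowerSeries.coeff_rescale, PowerSeries.coeff_map,
    map_add, PowerSeries.coeff_C, ← map_one PowerSeries.C, ← map_sub, PowerSeries.coeff_C_mul,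
    map_sum] at h
  simp only [PowerSeries.coeff_C_mul, geomSeries, PowerSeries.coeff_mk] at h
  rw [map_sub, map_one, ← h, map_mul, ← inv_pow, map_pow, map_pow]
  change _ = _ * (_ * toVars n _)
  ring

/-- In the expansion of the coefficients of `qSeries` the `k = 0` term reproduces `f`, and the
powers `x_i^k` reassemble the shifted function into `f` with `x_i` scaled by `q`. -/
theorem diffProd_mul_opE [CharZero K] (ht : t ≠ 0) (hz : ∀ n, powerNorm q t n ≠ 0)
    (f : SymFun K) : MvPolynomial.C (t ^ n) * diffProd K n * toVars n (opE q t f) =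
      diffProd K n * toVars n f +
        MvPolynomial.C (t - 1) * ∑ i, diffNum t i * qScale q i (toVars n f) := by
  set N := (qShift q f).natDegree + 1 with hN
  have hN : (qShift q f).natDegree < N := by omega
  rw [opE_eq_sum f N hN, map_sum, Finset.mul_sum]
  have h1 : ∀ k ∈ Finset.range N, MvPolynomial.C (t ^ n) * diffProd K n *
      toVars n ((t ^ k)⁻¹ • (PowerSeries.coeff k (qSeries q t) * (qShift q f).coeff k)) =
      (if k = 0 then diffProd K n else 0) * toVars n ((qShift q f).coeff k) +
        ∑ i, MvPolynomial.C (t - 1) *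
          (diffNum t i * (toVars n ((qShift q f).coeff k) * MvPolynomial.X i ^ k)) := by
    intro k _
    have e := congrArg (· * toVars n ((qShift q f).coeff k))
      (diffProd_mul_coeff_qSeries (n := n) ht hz k)
    simp only [add_mul] at e
    rw [map_smul, map_mul, ← MvPolynomial.C_mul']
    rw [map_mul] at e
    rw [← mul_assoc, ← mul_assoc, mul_right_comm _ _ (MvPolynomial.C _), e, Finset.mul_sum,
      Finset.sum_mul]
    congr 1
    exact Finset.sum_congr rfl fun i _ => by ring
  rw [Finset.sum_congr rfl h1, Finset.sum_add_distrib, Finset.sum_comm]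
  congr 1
  · rw [Finset.sum_eq_single_of_mem 0 (by simp [N]) (by intro k _ hk; simp [hk]), if_pos rfl,
      coeff_zero_shiftHom _ _ fun i => i.succ_pos]
  · rw [Finset.mul_sum]
    refine Finset.sum_congr rfl fun i _ => ?_
    rw [toVars_qShift q i f N hN, Finset.mul_sum, Finset.mul_sum]

end

/-! ### Dominance of exponents -/

section Exponents
variable {n : ℕ}

/-- The sum of the first `r` entries of an exponent vector. -/
def headSum (r : ℕ) (α : Fin n →₀ ℕ) : ℕ := ∑ i : Fin n, if i.val < r then α i else 0

theorem headSum_add (r : ℕ) (α γ : Fin n →₀ ℕ) : headSum r (α + γ) = headSum r α + headSum r γ := by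
  rw [headSum, headSum, headSum, ← Finset.sum_add_distrib]
  exact Finset.sum_congr rfl fun i _ => by split_ifs <;> simp

theorem headSum_succ (α : Fin n →₀ ℕ) (i : Fin n) :
    headSum (i.val + 1) α = headSum i.val α + α i := by
  have : α i = ∑ j : Fin n, if j = i then α j else 0 := by simp
  rw [headSum, headSum, this, ← Finset.sum_add_distrib]
  refine Finset.sum_congr rfl fun j _ => ?_
  by_cases h : j = i
  · simp [h]
  · have : j.val ≠ i.val := fun e => h (Fin.ext e)
    simp only [h, if_false, add_zero]
    congr 1
    simp only [eq_iff_iff]; omega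

/-- The dominance order on exponent vectors of the same degree. -/
def ExpLE (α γ : Fin n →₀ ℕ) : Prop :=
  (∀ r, headSum r α ≤ headSum r γ) ∧ headSum n α = headSum n γ

theorem ExpLE.refl (α : Fin n →₀ ℕ) : ExpLE α α := ⟨fun _ => le_rfl, rfl⟩

theorem ExpLE.add {α α' γ γ' : Fin n →₀ ℕ} (h : ExpLE α γ) (h' : ExpLE α' γ') :
    ExpLE (α + α') (γ + γ') := by
  refine ⟨fun r => ?_, ?_⟩
  · rw [headSum_add, headSum_add]; exact add_le_add (h.1 r) (h'.1 r)
  · rw [headSum_add, headSum_add, h.2, h'.2]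

theorem eq_of_headSum {α γ : Fin n →₀ ℕ} (h : ∀ r, headSum r α = headSum r γ) : α = γ := by
  ext i
  have h1 := headSum_succ α i
  have h2 := headSum_succ γ i
  rw [h, h] at h1
  omega

/-- A strictly increasing functional for the dominance order. -/
def expWeight (α : Fin n →₀ ℕ) : ℕ := ∑ i : Fin n, (n - i.val) * α i

/-- The entry of index `i` occurs in the head sums of length `i + 1` to `n`. Hence the weight is
monotone for dominance, and equal weights of comparable vectors force equality. -/
theorem expWeight_eq (α : Fin n →₀ ℕ) : expWeight α = ∑ r ∈ Finset.range (n + 1), headSum r α := by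
  simp only [headSum]
  rw [Finset.sum_comm]
  refine Finset.sum_congr rfl fun i _ => ?_
  rw [← Finset.sum_filter, Finset.sum_const, smul_eq_mul]
  congr 1
  have : Finset.filter (fun r => i.val < r) (Finset.range (n + 1)) = Finset.Ico (i.val + 1) (n + 1) := by
    ext r; simp; omega
  rw [this, Nat.card_Ico]; omega

theorem expWeight_add (α γ : Fin n →₀ ℕ) : expWeight (α + γ) = expWeight α + expWeight γ := by
  simp [expWeight, mul_add, Finset.sum_add_distrib]

theorem headSum_of_le (α : Fin n →₀ ℕ) {r : ℕ} (hr : n ≤ r) : headSum r α = headSum n α := by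
  refine Finset.sum_congr rfl fun i _ => ?_
  rw [if_pos (by omega), if_pos i.isLt]

theorem ExpLE.expWeight_le {α γ : Fin n →₀ ℕ} (h : ExpLE α γ) : expWeight α ≤ expWeight γ := by
  rw [expWeight_eq, expWeight_eq]; exact Finset.sum_le_sum fun r _ => h.1 r

theorem ExpLE.eq_of_expWeight {α γ : Fin n →₀ ℕ} (h : ExpLE α γ)
    (hw : expWeight α = expWeight γ) : α = γ := by
  rw [expWeight_eq, expWeight_eq] at hw
  have := (Finset.sum_eq_sum_iff_of_le fun r _ => h.1 r).mp hw
  refine eq_of_headSum fun r => ?_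
  rcases le_or_gt r n with hr | hr
  · exact this r (by simp; omega)
  · rw [headSum_of_le _ hr.le, headSum_of_le _ hr.le, h.2]

end Exponents

/-! ### Polynomials with a dominating exponent -/

section Dominated
variable {K : Type*} [Field K] {n : ℕ}

/-- All exponents of the polynomial `F` are dominated by `δ`. -/
def DominatedBy (F : MvPolynomial (Fin n) K) (δ : Fin n →₀ ℕ) : Prop :=
  ∀ α, F.coeff α ≠ 0 → ExpLE α δ

theorem DominatedBy.add {F G : MvPolynomial (Fin n) K} {δ : Fin n →₀ ℕ} (hF : DominatedBy F δ)
    (hG : DominatedBy G δ) : DominatedBy (F + G) δ := by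
  intro α h
  by_cases h' : F.coeff α = 0
  · exact hG α fun e => h (by rw [MvPolynomial.coeff_add, h', e, add_zero])
  · exact hF α h'

theorem DominatedBy.C_mul {F : MvPolynomial (Fin n) K} {δ : Fin n →₀ ℕ} (hF : DominatedBy F δ)
    (c : K) : DominatedBy (MvPolynomial.C c * F) δ := by
  intro α h
  rw [MvPolynomial.coeff_C_mul] at h
  exact hF α (right_ne_zero_of_mul h)

theorem DominatedBy.sum {ι : Type*} (s : Finset ι) {F : ι → MvPolynomial (Fin n) K}
    {δ : Fin n →₀ ℕ} (hF : ∀ i, DominatedBy (F i) δ) : DominatedBy (∑ i ∈ s, F i) δ := by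
  classical
  induction s using Finset.induction_on with
  | empty => intro α h; simp at h
  | insert a s ha ih => rw [Finset.sum_insert ha]; exact (hF a).add ih

/-- The coefficient of a product at the sum of a maximal exponent of the second factor and the
dominating exponent of the first one. -/
theorem coeff_mul_of_max {V G : MvPolynomial (Fin n) K} {δ α : Fin n →₀ ℕ}
    (hV : DominatedBy V δ) (φ : (Fin n →₀ ℕ) → ℤ) (hadd : ∀ a b, φ (a + b) = φ a + φ b)
    (hφ : ∀ ε, ExpLE ε δ → φ ε ≤ φ δ)
    (hα : ∀ γ, G.coeff γ ≠ 0 → φ γ < φ α ∨ φ γ = φ α ∧ expWeight γ ≤ expWeight α) :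
    (V * G).coeff (δ + α) = V.coeff δ * G.coeff α := by
  classical
  rw [MvPolynomial.coeff_mul]
  refine Finset.sum_eq_single_of_mem (δ, α) (by simp) fun p hp hne => ?_
  by_contra h0
  have hp := Finset.HasAntidiagonal.mem_antidiagonal.mp hp
  have h1 := hV _ (left_ne_zero_of_mul h0)
  have h2 := hα _ (right_ne_zero_of_mul h0)
  have e1 := congrArg φ hp
  have e2 := congrArg expWeight hp
  rw [hadd, hadd] at e1
  rw [expWeight_add, expWeight_add] at e2
  have h3 := hφ _ h1
  have h4 := h1.expWeight_le
  -- The bounds on `φ` add up to an equality, so both are equalities. Then the same holds for the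
  -- weights, and strict monotonicity of the weight identifies the exponents.
  have e3 : p.1 = δ := h1.eq_of_expWeight (by omega)
  have e4 : p.2 = α := by rw [e3] at hp; exact add_left_cancel hp
  exact hne (Prod.ext e3 e4)

/-- A lexicographic maximum: `φ` is the direction to be bounded, and the weight breaks ties so that
the leading coefficient of a product cannot cancel. -/
theorem exists_max_exponent {G : MvPolynomial (Fin n) K} (φ : (Fin n →₀ ℕ) → ℤ) {γ₀ : Fin n →₀ ℕ}
    (hG : G.coeff γ₀ ≠ 0) : ∃ α, G.coeff α ≠ 0 ∧ ∀ γ, G.coeff γ ≠ 0 →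
      φ γ < φ α ∨ φ γ = φ α ∧ expWeight γ ≤ expWeight α := by
  obtain ⟨α, hα, h⟩ := Finset.exists_max_image G.support
    (fun γ => toLex (φ γ, expWeight γ)) ⟨γ₀, MvPolynomial.mem_support_iff.mpr hG⟩
  refine ⟨α, MvPolynomial.mem_support_iff.mp hα, fun γ hγ => ?_⟩
  have := h γ (MvPolynomial.mem_support_iff.mpr hγ)
  rwa [Prod.Lex.toLex_le_toLex] at this

theorem coeff_mul_of_dominated {F G : MvPolynomial (Fin n) K} {δ ε : Fin n →₀ ℕ}
    (hF : DominatedBy F δ) (hG : DominatedBy G ε) :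
    (F * G).coeff (δ + ε) = F.coeff δ * G.coeff ε :=
  coeff_mul_of_max hF (fun _ => 0) (by simp) (by simp) fun γ hγ =>
    Or.inr ⟨rfl, (hG γ hγ).expWeight_le⟩

theorem DominatedBy.mul {F G : MvPolynomial (Fin n) K} {δ ε : Fin n →₀ ℕ}
    (hF : DominatedBy F δ) (hG : DominatedBy G ε) : DominatedBy (F * G) (δ + ε) := by
  classical
  intro α h
  rw [MvPolynomial.coeff_mul] at h
  obtain ⟨p, hp, h⟩ := Finset.exists_ne_zero_of_sum_ne_zero h
  rw [← Finset.HasAntidiagonal.mem_antidiagonal.mp hp]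
  exact (hF _ (left_ne_zero_of_mul h)).add (hG _ (right_ne_zero_of_mul h))

theorem dominatedBy_prod {ι : Type*} (s : Finset ι) (F : ι → MvPolynomial (Fin n) K)
    (δ : ι → Fin n →₀ ℕ) (h : ∀ i ∈ s, DominatedBy (F i) (δ i)) :
    DominatedBy (∏ i ∈ s, F i) (∑ i ∈ s, δ i) ∧
      (∏ i ∈ s, F i).coeff (∑ i ∈ s, δ i) = ∏ i ∈ s, (F i).coeff (δ i) := by
  classical
  induction s using Finset.induction_on with
  | empty =>
    refine ⟨fun α h => ?_, by simp⟩
    rw [Finset.prod_empty, MvPolynomial.coeff_one] at h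
    rw [Finset.sum_empty, show α = 0 by by_contra hα; exact h (if_neg (Ne.symm hα))]
    exact ExpLE.refl 0
  | insert a s ha ih =>
    obtain ⟨h1, h2⟩ := ih fun i hi => h i (by simp [hi])
    rw [Finset.prod_insert ha, Finset.sum_insert ha, Finset.prod_insert ha,
      coeff_mul_of_dominated (h a (by simp)) h1, h2]
    exact ⟨(h a (by simp)).mul h1, rfl⟩

/-- To bound an additive functional on the exponents of `G`, take an exponent `α` of `G` at which it
is maximal, with ties broken by weight. The exponent `δ + α` survives in `V * G`, where the bound is
known. -/
theorem dominatedBy_of_mul {V G : MvPolynomial (Fin n) K} {δ ε : Fin n →₀ ℕ}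
    (hV : DominatedBy V δ) (hV0 : V.coeff δ ≠ 0) (h : DominatedBy (V * G) (δ + ε)) :
    DominatedBy G ε := by
  have key : ∀ φ : (Fin n →₀ ℕ) → ℤ, (∀ a b, φ (a + b) = φ a + φ b) →
      (∀ ε δ, ExpLE ε δ → φ ε ≤ φ δ) → ∀ γ, G.coeff γ ≠ 0 → φ γ ≤ φ ε := by
    intro φ hadd hφ γ hγ
    obtain ⟨α, hα, hmax⟩ := exists_max_exponent φ hγ
    have e := coeff_mul_of_max hV φ hadd (fun ε => hφ ε δ) hmax
    have := hφ _ _ (h (δ + α) (by rw [e]; exact mul_ne_zero hV0 hα))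
    rw [hadd, hadd] at this
    rcases hmax γ hγ with h | h <;> omega
  intro γ hγ
  have h1 : ∀ r, headSum r γ ≤ headSum r ε := fun r => by
    have := key (fun a => (headSum r a : ℤ)) (by intro a b; simp [headSum_add])
      (fun ε δ h => by exact_mod_cast h.1 r) γ hγ
    exact_mod_cast this
  refine ⟨h1, le_antisymm (h1 n) ?_⟩
  -- The negative of the total degree gives the reverse inequality, hence homogeneity.
  have := key (fun a => -(headSum n a : ℤ)) (by intro a b; simp [headSum_add]; ring)
      (fun ε δ h => by simp [h.2]) γ hγ
  simpa using this

/-- Dominance favours early variables: the leading variable is the one of smaller index, with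
coefficient `a` or `-1` accordingly. -/
theorem dominatedBy_linear (i j : Fin n) (hij : j ≠ i) (a : K) :
    DominatedBy (MvPolynomial.C a * MvPolynomial.X i - MvPolynomial.X j)
      (Finsupp.single (min i j) 1) ∧
    (MvPolynomial.C a * MvPolynomial.X i - MvPolynomial.X j).coeff (Finsupp.single (min i j) 1) =
      if i < j then a else -1 := by
  classical
  have hs : ∀ r (k : Fin n), headSum r (Finsupp.single k 1) = if k.val < r then 1 else 0 := by
    intro r k
    rw [headSum, Finset.sum_eq_single_of_mem k (Finset.mem_univ k)]
    · simp
    · intro l _ hl; simp [hl.symm]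
  have hle : ∀ k, min i j ≤ k → ExpLE (Finsupp.single k 1) (Finsupp.single (min i j) 1) := by
    intro k hk
    refine ⟨fun r => ?_, ?_⟩
    · rw [hs, hs]
      have : (min i j).val ≤ k.val := hk
      split_ifs <;> omega
    · rw [hs, hs, if_pos k.isLt, if_pos (min i j).isLt]
  refine ⟨?_, ?_⟩
  · intro α h
    rw [MvPolynomial.coeff_sub, MvPolynomial.coeff_C_mul, MvPolynomial.coeff_X,
      MvPolynomial.coeff_X] at h
    by_cases h1 : Finsupp.single i 1 = α
    · rw [← h1]; exact hle i (min_le_left _ _)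
    · by_cases h2 : Finsupp.single j 1 = α
      · rw [← h2]; exact hle j (min_le_right _ _)
      · simp [h1, h2] at h
  · rw [MvPolynomial.coeff_sub, MvPolynomial.coeff_C_mul, MvPolynomial.coeff_X,
      MvPolynomial.coeff_X]
    have inj : ∀ k l : Fin n, Finsupp.single k 1 = Finsupp.single l 1 ↔ k = l := fun k l =>
      (Finsupp.single_left_injective (one_ne_zero (α := ℕ))).eq_iff
    simp only [inj]
    rcases lt_or_gt_of_ne hij with h | h
    · rw [min_eq_right h.le, if_neg h.not_gt]; simp [hij.symm]
    · rw [min_eq_left h.le, if_pos h]; simp [hij]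

variable (n) in
/-- The dominating exponent of `∏_{i ≠ j} (x_i - x_j)`. -/
def diffExp : Fin n →₀ ℕ :=
  ∑ i : Fin n, ∑ j ∈ Finset.univ.erase i, Finsupp.single (min i j) 1

variable (K n) in
/-- The leading coefficient of `∏_{i ≠ j} (x_i - x_j)`. -/
def diffSign : K :=
  ∏ i : Fin n, ∏ j ∈ Finset.univ.erase i, if i < j then 1 else -1

theorem diffSign_ne_zero : diffSign K n ≠ 0 :=
  Finset.prod_ne_zero_iff.mpr fun i _ => Finset.prod_ne_zero_iff.mpr fun j _ => by
    split_ifs <;> simp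

theorem dominatedBy_row (t : K) (i : Fin n) :
    DominatedBy (∏ j ∈ Finset.univ.erase i,
        (MvPolynomial.C t * MvPolynomial.X i - MvPolynomial.X j))
      (∑ j ∈ Finset.univ.erase i, Finsupp.single (min i j) 1) ∧
    (∏ j ∈ Finset.univ.erase i, (MvPolynomial.C t * MvPolynomial.X i - MvPolynomial.X j)).coeff
      (∑ j ∈ Finset.univ.erase i, Finsupp.single (min i j) 1) =
      ∏ j ∈ Finset.univ.erase i, if i < j then t else -1 := by
  have h := dominatedBy_prod (Finset.univ.erase i)
    (fun j => MvPolynomial.C t * MvPolynomial.X i - MvPolynomial.X j)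
    (fun j => Finsupp.single (min i j) 1)
    (fun j hj => (dominatedBy_linear i j (Finset.ne_of_mem_erase hj) t).1)
  refine ⟨h.1, h.2.trans (Finset.prod_congr rfl fun j hj =>
    (dominatedBy_linear i j (Finset.ne_of_mem_erase hj) t).2)⟩

theorem dominatedBy_row_one (i : Fin n) :
    DominatedBy (∏ j ∈ Finset.univ.erase i,
        (MvPolynomial.X i - MvPolynomial.X j : MvPolynomial (Fin n) K))
      (∑ j ∈ Finset.univ.erase i, Finsupp.single (min i j) 1) ∧
    (∏ j ∈ Finset.univ.erase i,
        (MvPolynomial.X i - MvPolynomial.X j : MvPolynomial (Fin n) K)).coeff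
      (∑ j ∈ Finset.univ.erase i, Finsupp.single (min i j) 1) =
      ∏ j ∈ Finset.univ.erase i, if i < j then (1 : K) else -1 := by
  have := dominatedBy_row (1 : K) i
  simpa only [map_one, one_mul] using this

theorem dominatedBy_diffProd : DominatedBy (diffProd K n) (diffExp n) ∧
    (diffProd K n).coeff (diffExp n) = diffSign K n := by
  have h := dominatedBy_prod Finset.univ
    (fun i : Fin n => ∏ j ∈ Finset.univ.erase i,
      (MvPolynomial.X i - MvPolynomial.X j : MvPolynomial (Fin n) K))
    (fun i => ∑ j ∈ Finset.univ.erase i, Finsupp.single (min i j) 1)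
    (fun i _ => (dominatedBy_row_one i).1)
  exact ⟨h.1, h.2.trans (Finset.prod_congr rfl fun i _ => (dominatedBy_row_one (K := K) i).2)⟩

/-- Replacing `x_i` by `t x_i` in the `i`-th row multiplies the leading coefficient by `t` once for
each `j > i`. -/
theorem dominatedBy_diffNum (t : K) (i : Fin n) : DominatedBy (diffNum t i) (diffExp n) ∧
    (diffNum t i).coeff (diffExp n) = t ^ (n - 1 - i.val) * diffSign K n := by
  have h := dominatedBy_prod (Finset.univ.erase i)
    (fun i : Fin n => ∏ j ∈ Finset.univ.erase i,
      (MvPolynomial.X i - MvPolynomial.X j : MvPolynomial (Fin n) K))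
    (fun i => ∑ j ∈ Finset.univ.erase i, Finsupp.single (min i j) 1)
    (fun i _ => (dominatedBy_row_one i).1)
  have h' := dominatedBy_row t i
  have e : diffExp n = (∑ j ∈ Finset.univ.erase i, Finsupp.single (min i j) 1) +
      ∑ k ∈ Finset.univ.erase i, ∑ j ∈ Finset.univ.erase k, Finsupp.single (min k j) 1 := by
    rw [diffExp, ← Finset.add_sum_erase Finset.univ _ (Finset.mem_univ i)]
  have e2 : (∏ j ∈ Finset.univ.erase i, if i < j then t else -1) =
      t ^ (n - 1 - i.val) * ∏ j ∈ Finset.univ.erase i, if i < j then (1 : K) else -1 := by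
    have hc : t ^ (n - 1 - i.val) = ∏ j ∈ Finset.univ.erase i, if i < j then t else 1 := by
      rw [← Finset.prod_filter, Finset.prod_const]
      congr 1
      have : Finset.filter (fun j => i < j) (Finset.univ.erase i) = Finset.Ioi i := by
        ext j
        simp only [Finset.mem_filter, Finset.mem_erase, Finset.mem_univ, and_true, Finset.mem_Ioi]
        exact ⟨fun h => h.2, fun h => ⟨h.ne', h⟩⟩
      rw [this, Fin.card_Ioi]
    rw [hc, ← Finset.prod_mul_distrib]
    exact Finset.prod_congr rfl fun j _ => by split_ifs <;> simp
  rw [e, diffNum]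
  refine ⟨h'.1.mul h.1, ?_⟩
  rw [coeff_mul_of_dominated h'.1 h.1, h'.2, h.2, e2, mul_assoc, diffSign,
    ← Finset.mul_prod_erase Finset.univ _ (Finset.mem_univ i)]
  congr 2
  exact Finset.prod_congr rfl fun i _ => (dominatedBy_row_one (K := K) i).2

/-! ### Eigenvalues -/

/-- The eigenvalue `∑_i t^{n-i} q^{α_i}` at the exponent `α`. -/
def eigVal (q t : K) (α : Fin n →₀ ℕ) : K := ∑ i : Fin n, t ^ (n - 1 - i.val) * q ^ α i

theorem DominatedBy.qScale {G : MvPolynomial (Fin n) K} {δ : Fin n →₀ ℕ} (hG : DominatedBy G δ)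
    (q : K) (i : Fin n) : DominatedBy (qScale q i G) δ := by
  intro α h
  rw [coeff_qScale] at h
  exact hG α (right_ne_zero_of_mul h)

variable {q t : K}

/-- Cleared denominators have leading exponent `diffExp n`, which can be divided out. Comparing
coefficients at `diffExp n + ε` gives the diagonal entry of the operator. -/
theorem dominatedBy_opE [CharZero K] (ht : t ≠ 0) (hz : ∀ n, powerNorm q t n ≠ 0) {f : SymFun K}
    {ε : Fin n →₀ ℕ} (hf : DominatedBy (toVars n f) ε) :
    DominatedBy (toVars n (opE q t f)) ε ∧
    t ^ n * (toVars n (opE q t f)).coeff ε =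
      (1 + (t - 1) * eigVal q t ε) * (toVars n f).coeff ε := by
  have hD := dominatedBy_diffProd (K := K) (n := n)
  have hN := dominatedBy_diffNum (n := n) t
  have h := diffProd_mul_opE (n := n) ht hz f
  rw [mul_assoc] at h
  have h1 : DominatedBy (MvPolynomial.C (t ^ n) * (diffProd K n * toVars n (opE q t f)))
      (diffExp n + ε) := by
    rw [h]
    exact (hD.1.mul hf).add ((DominatedBy.sum _ fun i => (hN i).1.mul (hf.qScale q i)).C_mul _)
  have h2 : DominatedBy (toVars n (opE q t f)) ε := by
    refine dominatedBy_of_mul hD.1 (by rw [hD.2]; exact diffSign_ne_zero) fun α hα => ?_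
    refine h1 α ?_
    rw [MvPolynomial.coeff_C_mul]
    exact mul_ne_zero (pow_ne_zero _ ht) hα
  refine ⟨h2, ?_⟩
  have e := congrArg (MvPolynomial.coeff (diffExp n + ε)) h
  rw [MvPolynomial.coeff_add, MvPolynomial.coeff_C_mul, MvPolynomial.coeff_C_mul,
    coeff_mul_of_dominated hD.1 h2, coeff_mul_of_dominated hD.1 hf, hD.2,
    MvPolynomial.coeff_sum, Finset.sum_congr rfl fun i _ => by
      rw [coeff_mul_of_dominated (hN i).1 (hf.qScale q i), (hN i).2, coeff_qScale]] at e
  refine mul_left_cancel₀ (diffSign_ne_zero (K := K) (n := n)) ?_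
  rw [mul_left_comm, e, eigVal, add_mul, one_mul, mul_assoc, Finset.sum_mul, mul_add,
    mul_left_comm (diffSign K n), Finset.mul_sum _ _ (diffSign K n)]
  congr 2
  exact Finset.sum_congr rfl fun i _ => by ring

/-- The eigenvalue of an eigenvector is determined by a maximal exponent. -/
theorem eigVal_of_max {e : K} {G : MvPolynomial (Fin n) K}
    (hG : MvPolynomial.C e * (diffProd K n * G) = ∑ i, diffNum t i * qScale q i G)
    {α : Fin n →₀ ℕ} (hα : G.coeff α ≠ 0)
    (hmax : ∀ γ, G.coeff γ ≠ 0 → expWeight γ ≤ expWeight α) : e = eigVal q t α := by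
  have hD := dominatedBy_diffProd (K := K) (n := n)
  have hN := dominatedBy_diffNum (n := n) t
  have key : ∀ {V G' : MvPolynomial (Fin n) K}, DominatedBy V (diffExp n) →
      (∀ γ, G'.coeff γ ≠ 0 → G.coeff γ ≠ 0) →
      (V * G').coeff (diffExp n + α) = V.coeff (diffExp n) * G'.coeff α := by
    intro V G' hV hG'
    exact coeff_mul_of_max hV (fun _ => 0) (by simp) (by simp) fun γ hγ =>
      Or.inr ⟨rfl, hmax γ (hG' γ hγ)⟩
  have e := congrArg (MvPolynomial.coeff (diffExp n + α)) hG
  rw [MvPolynomial.coeff_C_mul, key hD.1 (fun _ h => h), hD.2, MvPolynomial.coeff_sum,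
    Finset.sum_congr rfl fun i _ => by
      rw [key (hN i).1 (fun γ h => by rw [coeff_qScale] at h; exact right_ne_zero_of_mul h),
        (hN i).2, coeff_qScale]] at e
  refine mul_right_cancel₀ (mul_ne_zero (diffSign_ne_zero (K := K) (n := n)) hα) ?_
  rw [e, eigVal, Finset.sum_mul]
  exact Finset.sum_congr rfl fun i _ => by ring

/-- The eigenvalues separate decreasing exponents. -/
theorem eigVal_injective [CharZero K] (hq : Transcendental ℚ q) {β : ℕ} (hβ : 0 < β) {α γ : Fin n →₀ ℕ}
    (hα : Antitone α) (hγ : Antitone γ) (h : eigVal q (q ^ β) α = eigVal q (q ^ β) γ) : α = γ := by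
  classical
  -- At `t = q^β` the eigenvalue is `∑ q^{F_i}`. Transcendence determines the set of exponents
  -- `F_i`; as `β > 0` makes them strictly decreasing for antitone `a`, this set determines `a`.
  let F : (Fin n →₀ ℕ) → Fin n → ℕ := fun a i => β * (n - 1 - i.val) + a i
  have hF : ∀ a : Fin n →₀ ℕ, Antitone a → StrictAnti (F a) := by
    intro a ha i j hij
    have h1 := ha hij.le
    have h2 : n - 1 - j.val < n - 1 - i.val := by
      have : i.val < j.val := hij
      omega
    have := Nat.mul_lt_mul_of_pos_left h2 hβ
    simp only [F]; omega
  let P : (Fin n →₀ ℕ) → Polynomial ℚ := fun a => ∑ i, Polynomial.X ^ F a i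
  have hP : ∀ a, Polynomial.aeval q (P a) = eigVal q (q ^ β) a := by
    intro a
    simp only [P, map_sum, map_pow, Polynomial.aeval_X, eigVal, F]
    exact Finset.sum_congr rfl fun i _ => by rw [pow_add, pow_mul]
  have hPe : P α = P γ := by
    refine transcendental_iff_injective.mp hq ?_
    rw [hP, hP, h]
  have hsub : ∀ a b : Fin n →₀ ℕ, P a = P b → Set.range (F a) ⊆ Set.range (F b) := by
    rintro a b hab _ ⟨i, rfl⟩
    have e := congrArg (fun p => Polynomial.coeff p (F a i)) hab
    simp only [P, Polynomial.finsetSum_coeff, Polynomial.coeff_X_pow] at e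
    by_contra hne
    have : ∑ j, (if F a i = F b j then (1 : ℚ) else 0) = 0 :=
      Finset.sum_eq_zero fun j _ => if_neg fun h => hne ⟨j, h.symm⟩
    rw [this, Finset.sum_boole] at e
    have : (Finset.univ.filter fun j => F a i = F a j).Nonempty := ⟨i, by simp⟩
    exact (Nat.cast_ne_zero.mpr this.card_pos.ne') e
  have hr : Set.range (F α) = Set.range (F γ) := (hsub _ _ hPe).antisymm (hsub _ _ hPe.symm)
  have hrev : ∀ a, Set.range (F a ∘ Fin.rev) = Set.range (F a) := fun a =>
    Fin.rev_surjective.range_comp _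
  have := (StrictMono.range_inj (f := F α ∘ Fin.rev) (g := F γ ∘ Fin.rev)
    (fun i j hij => hF _ hα (Fin.rev_lt_rev.mpr hij))
    (fun i j hij => hF _ hγ (Fin.rev_lt_rev.mpr hij))).mp (by rw [hrev, hrev, hr])
  ext i
  have := congrFun this i.rev
  simp only [Function.comp_apply, Fin.rev_rev, F] at this
  omega

theorem toVars_isSymmetric (f : SymFun K) : (toVars n f).IsSymmetric := by
  intro e
  have : (MvPolynomial.rename (R := K) e).comp (toVars n) = toVars n := by
    refine MvPolynomial.algHom_ext fun r => ?_
    rw [AlgHom.comp_apply, toVars_X]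
    exact MvPolynomial.psum_isSymmetric (Fin n) K (r + 1) e
  exact DFunLike.congr_fun this f

theorem coeff_perm {G : MvPolynomial (Fin n) K} (hG : G.IsSymmetric) (e : Equiv.Perm (Fin n))
    (α : Fin n →₀ ℕ) : G.coeff (α.mapDomain e) = G.coeff α := by
  conv_lhs => rw [← hG e]
  exact MvPolynomial.coeff_rename_mapDomain _ e.injective _ _

/-- Exchanging entries `α_i < α_j` with `i < j` keeps the coefficient of a symmetric polynomial and
raises the weight by `(j - i)(α_j - α_i)`. -/
theorem antitone_of_max {G : MvPolynomial (Fin n) K} (hG : G.IsSymmetric) {α : Fin n →₀ ℕ}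
    (hα : G.coeff α ≠ 0) (hmax : ∀ γ, G.coeff γ ≠ 0 → expWeight γ ≤ expWeight α) :
    Antitone α := by
  classical
  intro i j hij
  by_contra hlt
  have hlt := not_le.mp hlt
  have hij' : i < j := lt_of_le_of_ne hij fun e => by rw [e] at hlt; exact lt_irrefl _ hlt
  have h := hmax (α.mapDomain (Equiv.swap i j)) (by rwa [coeff_perm hG])
  have hm : ∀ k, α.mapDomain (Equiv.swap i j) k = α (Equiv.swap i j k) := by
    intro k
    have := Finsupp.mapDomain_apply (Equiv.swap i j).injective α (Equiv.swap i j k)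
    rwa [Equiv.swap_apply_self] at this
  have h' : ((expWeight (α.mapDomain (Equiv.swap i j)) : ℕ) : ℤ) ≤ expWeight α := by exact_mod_cast h
  have e : ((expWeight (α.mapDomain (Equiv.swap i j)) : ℕ) : ℤ) - expWeight α =
      ∑ k : Fin n, ((n - k.val : ℕ) : ℤ) * ((α (Equiv.swap i j k) : ℤ) - α k) := by
    simp only [expWeight, hm]
    push_cast
    rw [← Finset.sum_sub_distrib]
    exact Finset.sum_congr rfl fun k _ => by ring
  rw [← Finset.sum_subset (Finset.subset_univ {i, j}) (fun k _ hk => by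
    simp only [Finset.mem_insert, Finset.mem_singleton, not_or] at hk
    rw [Equiv.swap_apply_of_ne_of_ne hk.1 hk.2, sub_self, mul_zero]),
    Finset.sum_pair hij'.ne, Equiv.swap_apply_left, Equiv.swap_apply_right] at e
  have hi : ((n - i.val : ℕ) : ℤ) = (n : ℤ) - i.val := by have := i.isLt; omega
  have hj : ((n - j.val : ℕ) : ℤ) = (n : ℤ) - j.val := by have := j.isLt; omega
  rw [hi, hj] at e
  have h1 : (0 : ℤ) < (j.val : ℤ) - i.val := by have : i.val < j.val := hij'; omega
  have h2 : (0 : ℤ) < (α j : ℤ) - α i := by omega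
  nlinarith [mul_pos h1 h2]

end Dominated

/-! ### Shapes of exponents -/

section Shape
variable {n : ℕ}

/-- The multiset of the nonzero entries of an exponent vector. -/
def shape (α : Fin n →₀ ℕ) : Multiset ℕ := (Finset.univ.val.map α).filter (· ≠ 0)

/-- The exponent vector with decreasing entries whose nonzero entries are those of `s`. -/
def sortedExp (n : ℕ) (s : Multiset ℕ) : Fin n →₀ ℕ :=
  Finsupp.equivFunOnFinite.symm fun i => (s.sort (· ≥ ·)).getD i 0

theorem sortedExp_apply (s : Multiset ℕ) (i : Fin n) :
    sortedExp n s i = (s.sort (· ≥ ·)).getD i 0 := rfl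

theorem zero_notMem_shape (α : Fin n →₀ ℕ) : 0 ∉ shape α := by simp [shape]

theorem card_shape_le (α : Fin n →₀ ℕ) : (shape α).card ≤ n :=
  (Multiset.card_le_card (Multiset.filter_le _ _)).trans (by simp)

theorem getD_sort_antitone (s : Multiset ℕ) {i j : ℕ} (h : i ≤ j) :
    (s.sort (· ≥ ·)).getD j 0 ≤ (s.sort (· ≥ ·)).getD i 0 := by
  rcases lt_or_ge j (s.sort (· ≥ ·)).length with hj | hj
  · rw [List.getD_eq_getElem _ _ hj, List.getD_eq_getElem _ _ (h.trans_lt hj)]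
    rcases h.eq_or_lt with rfl | h
    · exact le_rfl
    · exact List.pairwise_iff_getElem.mp (Multiset.pairwise_sort s (· ≥ ·)) i j _ hj h
  · rw [List.getD_eq_default _ _ hj]; exact Nat.zero_le _

theorem sortedExp_antitone (s : Multiset ℕ) : Antitone (sortedExp n s) :=
  fun _ _ h => getD_sort_antitone s h

theorem map_sortedExp {s : Multiset ℕ} (hs : s.card ≤ n) :
    Finset.univ.val.map (sortedExp n s) = s + Multiset.replicate (n - s.card) 0 := by
  have h : List.ofFn (sortedExp n s) = s.sort (· ≥ ·) ++ List.replicate (n - s.card) 0 := by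
    refine List.ext_getElem (by simp; omega) fun i h1 h2 => ?_
    rw [List.getElem_ofFn, sortedExp_apply]
    rcases lt_or_ge i (s.sort (· ≥ ·)).length with hj | hj
    · rw [List.getElem_append_left hj, List.getD_eq_getElem _ _ hj]
    · rw [List.getElem_append_right hj, List.getD_eq_default _ _ hj, List.getElem_replicate]
  rw [Fin.univ_val_map, h, ← Multiset.coe_add, Multiset.sort_eq, Multiset.coe_replicate]

theorem shape_sortedExp {s : Multiset ℕ} (hs : s.card ≤ n) (h0 : 0 ∉ s) :
    shape (sortedExp n s) = s := by
  rw [shape, map_sortedExp hs, Multiset.filter_add]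
  have h1 : s.filter (· ≠ 0) = s := Multiset.filter_eq_self.mpr fun a ha h => h0 (by rwa [← h])
  have h2 : (Multiset.replicate (n - s.card) 0).filter (· ≠ 0) = 0 :=
    Multiset.filter_eq_nil.mpr fun a ha h => h (Multiset.eq_of_mem_replicate ha)
  rw [h1, h2, add_zero]

theorem map_eq_shape_add (α : Fin n →₀ ℕ) :
    Finset.univ.val.map α = shape α + Multiset.replicate (n - (shape α).card) 0 := by
  have h := Multiset.filter_add_not (· ≠ 0) (Finset.univ.val.map α)
  have h2 : Multiset.filter (fun a => ¬ a ≠ 0) (Finset.univ.val.map α) =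
      Multiset.replicate (n - (shape α).card) 0 := by
    refine Multiset.eq_replicate.mpr ⟨?_, fun b hb => by simpa using (Multiset.mem_filter.mp hb).2⟩
    have := congrArg Multiset.card h
    rw [Multiset.card_add, Multiset.card_map, Finset.card_val, Finset.card_univ,
      Fintype.card_fin] at this
    rw [shape]; omega
  rw [← h2]; exact h.symm

theorem eq_of_antitone_of_shape {α γ : Fin n →₀ ℕ} (hα : Antitone α) (hγ : Antitone γ)
    (h : shape α = shape γ) : α = γ := by
  have h1 : Finset.univ.val.map α = Finset.univ.val.map γ := by
    rw [map_eq_shape_add, map_eq_shape_add γ, h]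
  rw [Fin.univ_val_map, Fin.univ_val_map, Multiset.coe_eq_coe] at h1
  have hs : ∀ α : Fin n →₀ ℕ, Antitone α → (List.ofFn α).Pairwise (· ≥ ·) := fun α hα =>
    List.pairwise_ofFn.mpr fun i j hij => hα hij.le
  have := h1.eq_of_pairwise (fun a b _ _ h1 h2 => le_antisymm h2 h1) (hs α hα) (hs γ hγ)
  exact DFunLike.coe_injective (List.ofFn_injective this)

theorem sum_take_eq (l : List ℕ) (r : ℕ) :
    (l.take r).sum = ∑ i ∈ Finset.range r, l.getD i 0 := by
  induction l generalizing r with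
  | nil => simp
  | cons a l ih =>
    rcases r with _ | r
    · simp
    · rw [List.take_succ_cons, List.sum_cons, ih, Finset.sum_range_succ', add_comm]
      simp

theorem headSum_sortedExp {s : Multiset ℕ} (hs : s.card ≤ n) (r : ℕ) :
    headSum r (sortedExp n s) = ((s.sort (· ≥ ·)).take r).sum := by
  rw [sum_take_eq, headSum]
  simp only [sortedExp_apply]
  rw [Fin.sum_univ_eq_sum_range (fun i => if i < r then (s.sort (· ≥ ·)).getD i 0 else 0),
    ← Finset.sum_filter]
  refine Finset.sum_subset (fun i hi => by simp at hi ⊢; omega) fun i hi hni => ?_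
  refine List.getD_eq_default _ _ ?_
  rw [Multiset.length_sort]
  simp at hi hni; omega

/-- The rearrangement inequality: a head sum pairs the exponent vector with a decreasing 0-1 vector,
and the pairing is largest when the entries are sorted. -/
theorem expLE_sortedExp (α : Fin n →₀ ℕ) : ExpLE α (sortedExp n (shape α)) := by
  classical
  let σ := Tuple.sort (fun i => OrderDual.toDual (α i))
  let γ : Fin n →₀ ℕ := Finsupp.equivFunOnFinite.symm fun i => α (σ i)
  have hγ : Antitone γ := fun i j h =>
    Tuple.monotone_sort (fun i => OrderDual.toDual (α i)) h
  have hsh : shape γ = shape α := by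
    have : (Finset.univ.val.map γ) = Finset.univ.val.map α := by
      have h : Finset.univ.val.map γ = (Finset.univ.val.map σ).map α := by
        rw [Multiset.map_map]; rfl
      rw [h]
      congr 1
      have := congrArg Finset.val (Finset.univ_map_equiv_to_embedding σ)
      exact this
    rw [shape, shape, this]
  have e : sortedExp n (shape α) = γ := by
    refine eq_of_antitone_of_shape (sortedExp_antitone _) hγ ?_
    rw [shape_sortedExp (card_shape_le α) (zero_notMem_shape α), hsh]
  rw [e]
  have hα : ∀ i, α i = γ (σ.symm i) := fun i => by
    change α i = α (σ (σ.symm i)); rw [Equiv.apply_symm_apply]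
  refine ⟨fun r => ?_, ?_⟩
  · have hm : Monovary (fun i : Fin n => if i.val < r then 1 else 0) γ := by
      refine Antitone.monovary (fun i j h => ?_) hγ
      have : i.val ≤ j.val := h
      split_ifs <;> omega
    have h := hm.sum_mul_comp_perm_le_sum_mul (σ := σ.symm)
    simp only [← hα, ite_mul, one_mul, zero_mul] at h
    exact h
  · have hall : ∀ α : Fin n →₀ ℕ, headSum n α = ∑ i, α i := fun α =>
      Finset.sum_congr rfl fun i _ => if_pos i.isLt
    rw [hall, hall]
    simp only [hα]
    exact Equiv.sum_comp σ.symm γ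

theorem headSum_eq_sum_shape (α : Fin n →₀ ℕ) : headSum n α = (shape α).sum := by
  have h := congrArg Multiset.sum (map_eq_shape_add α)
  simp only [Multiset.sum_add, Multiset.sum_replicate, smul_zero, add_zero] at h
  rw [← h, headSum]
  exact Finset.sum_congr rfl fun i _ => if_pos i.isLt

end Shape

/-! ### Monomial symmetric functions -/

section Monomial
variable {K : Type*} [Field K]

/-- The coefficient of `x^α` in `f(x_1, …, x_n)` is `c` of the shape of `α`. -/
def IsCoeffFun (f : SymFun K) (c : Multiset ℕ → K) : Prop :=
  ∀ (n : ℕ) (α : Fin n →₀ ℕ), (toVars n f).coeff α = c (shape α)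

/-- The multiset `s` with its element `a` lowered by `r + 1`. -/
def lowerPart (r : ℕ) (s : Multiset ℕ) (a : ℕ) : Multiset ℕ :=
  s.erase a + if a = r + 1 then 0 else {a - (r + 1)}

theorem shape_eq_ite {n : ℕ} (α : Fin n →₀ ℕ) (i : Fin n) :
    shape α = (if α i = 0 then 0 else {α i}) +
      ((Finset.univ.erase i).val.map α).filter (· ≠ 0) := by
  have e : (Finset.univ : Finset (Fin n)).val = i ::ₘ (Finset.univ.erase i).val := by
    rw [← Finset.insert_val_of_notMem (Finset.notMem_erase _ _),
      Finset.insert_erase (Finset.mem_univ i)]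
  rw [shape, e, Multiset.map_cons]
  by_cases h : α i = 0
  · rw [Multiset.filter_cons_of_neg _ (by simpa using h), if_pos h, zero_add]
  · rw [Multiset.filter_cons_of_pos (p := (· ≠ 0)) _ h, if_neg h, Multiset.singleton_add]

theorem shape_sub_single {n : ℕ} (α : Fin n →₀ ℕ) (i : Fin n) (r : ℕ) (h : r + 1 ≤ α i) :
    shape (α - Finsupp.single i (r + 1)) = lowerPart r (shape α) (α i) := by
  have e : (Finset.univ.erase i).val.map (α - Finsupp.single i (r + 1)) =
      (Finset.univ.erase i).val.map α :=
    Multiset.map_congr rfl fun j hj => by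
      have : j ≠ i := by
        rintro rfl
        exact (Finset.notMem_erase j Finset.univ) hj
      simp [this]
  have h0 : α i ≠ 0 := by omega
  rw [shape_eq_ite _ i, e, lowerPart, shape_eq_ite α i, if_neg h0,
    Multiset.singleton_add (α i), Multiset.erase_cons_head, add_comm]
  congr 1
  simp only [Finsupp.coe_tsub, Pi.sub_apply, Finsupp.single_eq_same]
  by_cases h' : α i = r + 1
  · simp [h']
  · rw [if_neg h', if_neg (by omega)]

/-- The coefficient at `α` of `f ∑ x_i^{r+1}` is the sum of the coefficients of `f` at `α` with one
entry lowered by `r + 1`. Zero entries cannot be lowered, so only the shape matters. -/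
theorem IsCoeffFun.mul_X {f : SymFun K} {c : Multiset ℕ → K} (h : IsCoeffFun f c) (r : ℕ) :
    IsCoeffFun (f * MvPolynomial.X r) fun s =>
      (s.map fun a => if r + 1 ≤ a then c (lowerPart r s a) else 0).sum := by
  classical
  intro n α
  have e : (Multiset.map (fun a => if r + 1 ≤ a then c (lowerPart r (shape α) a) else 0)
      (shape α)).sum = ∑ i, if r + 1 ≤ α i then c (lowerPart r (shape α) (α i)) else 0 := by
    have h := congrArg (fun s => (Multiset.map (fun a => if r + 1 ≤ a then
      c (lowerPart r (shape α) a) else 0) s).sum) (map_eq_shape_add α)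
    simp only [Multiset.map_map, Multiset.map_add, Multiset.sum_add, Multiset.map_replicate,
      Multiset.sum_replicate] at h
    rw [if_neg (by omega), smul_zero, add_zero] at h
    rw [← h]; rfl
  refine Eq.trans ?_ e.symm
  rw [map_mul, toVars_X, MvPolynomial.psum, Finset.mul_sum, MvPolynomial.coeff_sum]
  refine Finset.sum_congr rfl fun i _ => ?_
  rw [MvPolynomial.X_pow_eq_monomial, MvPolynomial.coeff_mul_monomial', mul_one]
  simp only [Finsupp.single_le_iff]
  split_ifs with h1
  · rw [h, shape_sub_single α i r h1]
  · rfl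

theorem IsCoeffFun.add {f g : SymFun K} {c d : Multiset ℕ → K} (hf : IsCoeffFun f c)
    (hg : IsCoeffFun g d) : IsCoeffFun (f + g) (c + d) := fun n α => by
  rw [map_add, MvPolynomial.coeff_add, hf, hg]; rfl

theorem IsCoeffFun.smul {f : SymFun K} {c : Multiset ℕ → K} (hf : IsCoeffFun f c) (a : K) :
    IsCoeffFun (a • f) (a • c) := fun n α => by
  rw [map_smul, MvPolynomial.coeff_smul, hf]; rfl

theorem IsCoeffFun.sum {ι : Type*} (s : Finset ι) {f : ι → SymFun K} {c : ι → Multiset ℕ → K}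
    (h : ∀ i ∈ s, IsCoeffFun (f i) (c i)) : IsCoeffFun (∑ i ∈ s, f i) (∑ i ∈ s, c i) := by
  intro n α
  rw [map_sum, MvPolynomial.coeff_sum, Finset.sum_apply]
  exact Finset.sum_congr rfl fun i hi => h i hi n α

theorem sum_map_ite_eq_count (s : Multiset ℕ) (b : ℕ) (x : K) :
    (s.map fun a => if a = b then x else 0).sum = (s.count b : K) * x := by
  induction s using Multiset.induction_on with
  | empty => simp
  | cons a s ih =>
    rw [Multiset.map_cons, Multiset.sum_cons, ih, Multiset.count_cons]
    by_cases h : a = b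
    · simp [h]; ring
    · simp [h, Ne.symm h]

theorem sum_map_ite_eq_countP (s : Multiset ℕ) (P : ℕ → Prop) [DecidablePred P] :
    (s.map fun a => if P a then (1 : K) else 0).sum = (s.countP P : K) := by
  induction s using Multiset.induction_on with
  | empty => simp
  | cons a s ih =>
    rw [Multiset.map_cons, Multiset.sum_cons, ih, Multiset.countP_cons]
    split_ifs <;> push_cast <;> ring

theorem exists_ne_zero_of_sum_map {s : Multiset ℕ} {f : ℕ → K} (h : (s.map f).sum ≠ 0) :
    ∃ a ∈ s, f a ≠ 0 := by
  by_contra! hc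
  refine h (Multiset.sum_eq_zero fun x hx => ?_)
  obtain ⟨a, ha, rfl⟩ := Multiset.mem_map.mp hx
  exact hc a ha

theorem shape_eq_zero_iff {n : ℕ} (α : Fin n →₀ ℕ) : shape α = 0 ↔ α = 0 := by
  constructor
  · intro h
    ext i
    by_contra hne
    have : α i ∈ shape α := Multiset.mem_filter.mpr
      ⟨Multiset.mem_map_of_mem _ (Finset.mem_univ i), hne⟩
    rw [h] at this
    exact Multiset.notMem_zero _ this
  · rintro rfl
    exact Multiset.filter_eq_nil.mpr fun a ha h => by
      obtain ⟨i, -, rfl⟩ := Multiset.mem_map.mp ha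
      exact h rfl

theorem isCoeffFun_one : IsCoeffFun (1 : SymFun K) fun s => if s = 0 then 1 else 0 := by
  classical
  intro n α
  rw [map_one, MvPolynomial.coeff_one]
  simp only [shape_eq_zero_iff, eq_comm]

variable [CharZero K]

/-- Products of power sums are triangular with respect to the number of parts. -/
theorem exists_isCoeffFun_prod (l : Multiset ℕ) : ∃ c : Multiset ℕ → K,
    IsCoeffFun (l.map MvPolynomial.X).prod c ∧ c (l.map Nat.succ) ≠ 0 ∧
      ∀ s, c s ≠ 0 → s = l.map Nat.succ ∨ s.card < l.card := by
  induction l using Multiset.induction_on with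
  | empty =>
    refine ⟨_, by simpa using isCoeffFun_one, by simp, fun s hs => Or.inl ?_⟩
    by_contra h
    exact hs (if_neg h)
  | cons r l ih =>
    obtain ⟨c, hc, h1, h2⟩ := ih
    refine ⟨_, by rw [Multiset.map_cons, Multiset.prod_cons, mul_comm]; exact hc.mul_X r, ?_, ?_⟩
    · have e : ∀ a ∈ (r ::ₘ l).map Nat.succ,
          (if r + 1 ≤ a then c (lowerPart r ((r ::ₘ l).map Nat.succ) a) else 0) =
          if a = r + 1 then c (l.map Nat.succ) else 0 := by
        intro a ha
        rw [Multiset.map_cons]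
        rw [Multiset.map_cons] at ha
        by_cases h : a = r + 1
        · subst h
          simp [lowerPart]
        · rw [if_neg h]
          split_ifs with h3
          · by_contra hne
            have hcard : (lowerPart r (r.succ ::ₘ l.map Nat.succ) a).card = l.card + 1 := by
              rw [lowerPart, if_neg h, Multiset.card_add, Multiset.card_erase_of_mem ha]
              simp
            rcases h2 _ hne with h4 | h4
            · rw [h4] at hcard; simp at hcard
            · omega
          · rfl
      -- The leading coefficient is multiplied by the multiplicity of `r + 1`, which is nonzero in
      -- characteristic zero.
      rw [Multiset.map_congr rfl e, sum_map_ite_eq_count]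
      refine mul_ne_zero (Nat.cast_ne_zero.mpr ?_) h1
      simp
    · intro s hs
      obtain ⟨a, ha, hne⟩ := exists_ne_zero_of_sum_map hs
      split_ifs at hne with h3
      · by_cases h : a = r + 1
        · rw [lowerPart, if_pos h, add_zero] at hne
          rcases h2 _ hne with h4 | h4
          · left
            rw [Multiset.map_cons, ← h4, Nat.succ_eq_add_one, ← h, Multiset.cons_erase ha]
          · right
            rw [Multiset.card_erase_of_mem ha] at h4
            rw [Multiset.card_cons]; simp at h4 ⊢; omega
        · right
          have hpos : 0 < s.card := Multiset.card_pos_iff_exists_mem.mpr ⟨a, ha⟩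
          have hcard : (lowerPart r s a).card = s.card := by
            rw [lowerPart, if_neg h, Multiset.card_add, Multiset.card_erase_of_mem ha,
              Multiset.card_singleton]
            simp; omega
          rw [Multiset.card_cons]
          rcases h2 _ hne with h4 | h4
          · rw [h4, Multiset.card_map] at hcard; omega
          · omega
      · exact absurd rfl hne

/-- Expand in products of power sums. The shape of a product with the most factors in the support is
reached by no other product there, so its coefficient survives; the largest number of factors bounds
the number of parts. -/
theorem exists_isCoeffFun (f : SymFun K) : ∃ (c : Multiset ℕ → K) (D : ℕ), IsCoeffFun f c ∧
    (∀ s, c s ≠ 0 → s.card ≤ D) ∧ (f ≠ 0 → ∃ s, 0 ∉ s ∧ c s ≠ 0) := by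
  classical
  choose c hc h1 h2 using exists_isCoeffFun_prod (K := K)
  have hm : ∀ e : ℕ →₀ ℕ, IsCoeffFun (MvPolynomial.monomial e 1)
      (c (Finsupp.toMultiset e)) := by
    intro e
    have : MvPolynomial.monomial e (1 : K) =
        ((Finsupp.toMultiset e).map MvPolynomial.X).prod := by
      rw [MvPolynomial.monomial_eq, map_one, one_mul, Finsupp.toMultiset_map,
        Finsupp.prod_toMultiset, Finsupp.prod_mapDomain_index (by simp) (by
          intros; rw [pow_add])]
    rw [this]
    exact hc _
  have hf : f = ∑ e ∈ f.support, f.coeff e • MvPolynomial.monomial e (1 : K) := by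
    conv_lhs => rw [MvPolynomial.as_sum f]
    exact Finset.sum_congr rfl fun e _ => by rw [MvPolynomial.smul_monomial, smul_eq_mul, mul_one]
  refine ⟨∑ e ∈ f.support, f.coeff e • c (Finsupp.toMultiset e),
    f.support.sup fun e => (Finsupp.toMultiset e).card, ?_, ?_, ?_⟩
  · conv => arg 1; rw [hf]
    exact IsCoeffFun.sum _ fun e _ => (hm e).smul _
  · intro s hs
    rw [Finset.sum_apply] at hs
    obtain ⟨e, he, hs⟩ := Finset.exists_ne_zero_of_sum_ne_zero hs
    have h3 : c (Finsupp.toMultiset e) s ≠ 0 := right_ne_zero_of_mul hs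
    have h4 := Finset.le_sup (f := fun e => (Finsupp.toMultiset e).card) he
    rcases h2 _ _ h3 with h5 | h5
    · rwa [h5, Multiset.card_map]
    · omega
  · intro hne
    obtain ⟨e, he, hmax⟩ := Finset.exists_max_image f.support
      (fun e => (Finsupp.toMultiset e).card) (by
        rw [Finset.nonempty_iff_ne_empty, Ne, MvPolynomial.support_eq_empty]; exact hne)
    refine ⟨(Finsupp.toMultiset e).map Nat.succ, by simp, ?_⟩
    rw [Finset.sum_apply, Finset.sum_eq_single_of_mem e he]
    · exact mul_ne_zero (MvPolynomial.mem_support_iff.mp he) (h1 _)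
    · intro e' he' hne'
      by_contra h3
      have h4 := hmax e' he'
      rcases h2 _ _ (right_ne_zero_of_mul h3) with h5 | h5
      · exact hne' (Multiset.toFinsupp.symm.injective
          (Multiset.map_injective Nat.succ_injective h5)).symm
      · rw [Multiset.card_map] at h5; omega

/-- A symmetric function is determined by its values in finitely many variables. -/
theorem eq_zero_of_toVars {f : SymFun K} (h : ∀ n, toVars n f = 0) : f = 0 := by
  by_contra hne
  obtain ⟨c, D, hc, -, h2⟩ := exists_isCoeffFun f
  obtain ⟨s, hs, hcs⟩ := h2 hne
  have := hc s.card (sortedExp s.card s)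
  rw [h, MvPolynomial.coeff_zero, shape_sortedExp le_rfl hs] at this
  exact hcs this.symm

theorem eq_of_toVars {f g : SymFun K} (h : ∀ n, toVars n f = toVars n g) : f = g :=
  sub_eq_zero.mp (eq_zero_of_toVars fun n => by rw [map_sub, h, sub_self])

/-- Multiplying `m_{s'}` by a power sum gives a nonzero multiple of the function with the new part
added, plus monomial functions with as many parts as `s'`. The latter are known by induction and can
be subtracted. -/
theorem exists_monomial (k : ℕ) : ∀ s : Multiset ℕ, s.card = k → 0 ∉ s →
    ∃ f : SymFun K, IsCoeffFun f fun s' => if s' = s then 1 else 0 := by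
  classical
  induction k with
  | zero =>
    intro s hs _
    rw [Multiset.card_eq_zero.mp hs]
    exact ⟨1, isCoeffFun_one⟩
  | succ k ih =>
    choose! g hg using ih
    intro s hs h0
    obtain ⟨a, ha⟩ := Multiset.card_pos_iff_exists_mem.mp (by omega : 0 < s.card)
    obtain ⟨s', rfl⟩ := Multiset.exists_cons_of_mem ha
    obtain ⟨r, rfl⟩ : ∃ r, a = r + 1 := ⟨a - 1, by
      have : a ≠ 0 := fun h => h0 (h ▸ ha)
      omega⟩
    have h0' : 0 ∉ s' := fun h => h0 (Multiset.mem_cons_of_mem h)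
    have hs' : s'.card = k := by simpa using hs
    have hp := (hg s' hs' h0').mul_X r
    set N : Multiset ℕ → K := fun s => (s.map fun a => if r + 1 ≤ a then
      (if lowerPart r s a = s' then (1 : K) else 0) else 0).sum with hN
    -- The shapes produced when `r + 1` is added to an existing part instead of becoming a part of
    -- its own.
    set T := s'.toFinset.image fun b => (b + (r + 1)) ::ₘ s'.erase b with hT
    have hTcard : ∀ u ∈ T, u.card = k ∧ 0 ∉ u := by
      intro u hu
      obtain ⟨b, hb, rfl⟩ := Finset.mem_image.mp hu
      have hb := Multiset.mem_toFinset.mp hb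
      have : 0 < s'.card := Multiset.card_pos_iff_exists_mem.mpr ⟨b, hb⟩
      refine ⟨?_, ?_⟩
      · rw [Multiset.card_cons, Multiset.card_erase_of_mem hb, hs']; simp; omega
      · rw [Multiset.mem_cons]
        rintro (h | h)
        · omega
        · exact h0' (Multiset.mem_of_mem_erase h)
    have hNs : N ((r + 1) ::ₘ s') ≠ 0 := by
      simp only [hN, ← ite_and]
      rw [sum_map_ite_eq_countP]
      refine Nat.cast_ne_zero.mpr (Multiset.countP_pos.mpr ⟨r + 1, by simp, le_rfl, ?_⟩).ne'
      rw [lowerPart, if_pos rfl, add_zero, Multiset.erase_cons_head]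
    have hNT : ∀ u, N u ≠ 0 → u = (r + 1) ::ₘ s' ∨ u ∈ T := by
      intro u hu
      obtain ⟨a, ha, hne⟩ := exists_ne_zero_of_sum_map hu
      split_ifs at hne with h1 h2
      · by_cases h : a = r + 1
        · left
          rw [lowerPart, if_pos h, add_zero] at h2
          rw [← h2, ← h, Multiset.cons_erase ha]
        · right
          rw [lowerPart, if_neg h] at h2
          refine Finset.mem_image.mpr ⟨a - (r + 1), ?_, ?_⟩
          · rw [Multiset.mem_toFinset, ← h2]; simp
          · rw [← h2, add_comm (u.erase a), Multiset.singleton_add, Multiset.erase_cons_head,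
              Nat.sub_add_cancel h1, Multiset.cons_erase ha]
      · exact absurd rfl hne
      · exact absurd rfl hne
    refine ⟨(N ((r + 1) ::ₘ s'))⁻¹ • (g s' * MvPolynomial.X r + (-1 : K) • ∑ u ∈ T, N u • g u), ?_⟩
    have := (hp.add ((IsCoeffFun.sum T fun u hu =>
      (hg u (hTcard u hu).1 (hTcard u hu).2).smul (N u)).smul (-1))).smul (N ((r + 1) ::ₘ s'))⁻¹
    intro n α
    rw [this n α]
    simp only [Pi.smul_apply, Pi.add_apply, Finset.sum_apply, smul_eq_mul, mul_ite, mul_one,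
      mul_zero]
    rw [Finset.sum_ite_eq]
    split_ifs with h1 h2 h2
    · have := (hTcard _ h1).1
      rw [h2, Multiset.card_cons] at this; omega
    · ring
    · rw [h2]; field_simp; ring
    · have : N (shape α) = 0 := by
        by_contra h
        rcases hNT _ h with h | h
        · exact h2 h
        · exact h1 h
      rw [this]; ring

end Monomial

/-! ### The basis of monomial symmetric functions -/

section Macdonald
variable {K : Type*} [Field K] [CharZero K]

theorem zero_notMem_parts {d : ℕ} (lam : d.Partition) : 0 ∉ lam.parts :=
  fun h => (lam.parts_pos h).ne rfl

variable (K) in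
/-- The monomial symmetric function `m_λ`. -/
def monSym {d : ℕ} (lam : d.Partition) : SymFun K :=
  Classical.choose (exists_monomial (K := K) _ lam.parts rfl (zero_notMem_parts lam))

theorem isCoeffFun_monSym {d : ℕ} (lam : d.Partition) :
    IsCoeffFun (monSym K lam) fun s => if s = lam.parts then 1 else 0 :=
  Classical.choose_spec (exists_monomial (K := K) _ lam.parts rfl (zero_notMem_parts lam))

omit [CharZero K] in
-- Exactly one multiset of variables produces the monomial `x^α`, and its multiplicities are the
-- nonzero entries of `α`.
theorem coeff_msymm {n d : ℕ} (lam : d.Partition) (α : Fin n →₀ ℕ) :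
    (MvPolynomial.msymm (Fin n) K lam).coeff α = if shape α = lam.parts then 1 else 0 := by
  classical
  have hshape : shape α = (Finsupp.toMultiset α).dedup.map (Finsupp.toMultiset α).count := by
    have h1 : (Finsupp.toMultiset α).dedup = α.support.val := by
      have := Finsupp.toFinset_toMultiset α
      rw [← this]; rfl
    have h2 : α.support = Finset.univ.filter fun i => α i ≠ 0 := by ext i; simp
    rw [h1, h2, Finset.filter_val, shape, Multiset.filter_map]
    exact Multiset.map_congr rfl fun i _ => (Finsupp.count_toMultiset α i).symm
  have hmon : ∀ s : Multiset (Fin n), (s.map (MvPolynomial.X (R := K))).prod =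
      MvPolynomial.monomial (Multiset.toFinsupp s) 1 := by
    intro s
    rw [MvPolynomial.monomial_eq, map_one, one_mul]
    obtain ⟨e, rfl⟩ := Multiset.toFinsupp.symm.surjective s
    rw [Multiset.toFinsupp_symm_apply]
    rw [Finsupp.toMultiset_map, Finsupp.prod_toMultiset, Finsupp.prod_mapDomain_index (by simp)
      (by intros; rw [pow_add])]
    simp
  rw [MvPolynomial.msymm, MvPolynomial.coeff_sum]
  simp only [hmon, MvPolynomial.coeff_monomial]
  have hiff : ∀ s : Multiset (Fin n), Multiset.toFinsupp s = α ↔ s = Finsupp.toMultiset α := by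
    intro s
    rw [← Multiset.toFinsupp.apply_eq_iff_eq]
    simp
  split_ifs with h
  · have hcard : (Finsupp.toMultiset α).card = d := by
      rw [← lam.parts_sum, ← h, ← headSum_eq_sum_shape, Finsupp.card_toMultiset, headSum,
        Finsupp.sum_fintype _ _ (fun _ => rfl)]
      exact Finset.sum_congr rfl fun i _ => (if_pos i.isLt).symm
    rw [Finset.sum_eq_single_of_mem (⟨⟨Finsupp.toMultiset α, hcard⟩, by
      ext1; exact hshape.symm.trans h⟩ : {a : Sym (Fin n) d // Nat.Partition.ofSym a = lam})
      (Finset.mem_univ _)]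
    · simp
    · intro b _ hb
      rw [if_neg]
      intro h'
      exact hb (Subtype.ext (Subtype.ext ((hiff _).mp h')))
  · refine Finset.sum_eq_zero fun b _ => if_neg fun h' => h ?_
    have e := (hiff _).mp h'
    have h2 := congrArg Nat.Partition.parts b.2
    rw [hshape, ← e]
    exact h2

theorem toVars_monSym {n d : ℕ} (lam : d.Partition) :
    toVars n (monSym K lam) = MvPolynomial.msymm (Fin n) K lam := by
  ext α; rw [isCoeffFun_monSym, coeff_msymm]

theorem eq_sum_monSym {f : SymFun K} {c : Multiset ℕ → K} (hf : IsCoeffFun f c) {d : ℕ}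
    (hd : ∀ s, 0 ∉ s → c s ≠ 0 → s.sum = d) :
    f = ∑ mu : d.Partition, c mu.parts • monSym K mu := by
  refine eq_of_toVars fun n => ?_
  ext α
  have h := IsCoeffFun.sum Finset.univ (fun (mu : d.Partition) _ =>
    (isCoeffFun_monSym (K := K) mu).smul (c mu.parts)) n α
  rw [h, hf, Finset.sum_apply]
  simp only [Pi.smul_apply, smul_eq_mul, mul_ite, mul_one, mul_zero]
  by_cases hc : c (shape α) = 0
  · rw [hc, eq_comm]
    exact Finset.sum_eq_zero fun mu _ => by
      split_ifs with h
      · rw [← h, hc]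
      · rfl
  · have hs := hd _ (zero_notMem_shape α) hc
    rw [Finset.sum_eq_single_of_mem (⟨shape α, fun {i} hi => Nat.pos_of_ne_zero fun h =>
      zero_notMem_shape α (h ▸ hi), hs⟩ : d.Partition) (Finset.mem_univ _)]
    · rw [if_pos rfl]
    · intro mu _ hmu
      rw [if_neg]
      intro h
      exact hmu (Nat.Partition.ext h.symm)

/-- If `D` bounds the number of parts, then `D` variables already show every monomial function in
`f`, so finitely many shapes suffice. -/
theorem span_monSym : Submodule.span K
    (Set.range fun x : Σ d : ℕ, d.Partition => monSym K x.2) = ⊤ := by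
  classical
  rw [eq_top_iff]
  intro f _
  obtain ⟨c, D, hc, hD, -⟩ := exists_isCoeffFun f
  have hmon : ∀ s : Multiset ℕ, 0 ∉ s → ∃ x : Σ d : ℕ, d.Partition, x.2.parts = s := fun s hs =>
    ⟨⟨s.sum, ⟨s, fun {i} hi => Nat.pos_of_ne_zero fun h => hs (h ▸ hi), rfl⟩⟩, rfl⟩
  choose! x hx using hmon
  set S := (toVars D f).support.image shape
  have hS : ∀ s ∈ S, 0 ∉ s := by
    intro s hs
    obtain ⟨α, -, rfl⟩ := Finset.mem_image.mp hs
    exact zero_notMem_shape α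
  have e : f = ∑ s ∈ S, c s • monSym K (x s).2 := by
    refine eq_of_toVars fun n => ?_
    ext α
    rw [IsCoeffFun.sum S (fun s _ => (isCoeffFun_monSym (K := K) (x s).2).smul (c s)) n α, hc,
      Finset.sum_apply]
    have : ∀ s ∈ S, (c s • fun s' => if s' = (x s).2.parts then (1 : K) else 0) (shape α) =
        if shape α = s then c s else 0 := by
      intro s hs
      simp only [Pi.smul_apply, smul_eq_mul, mul_ite, mul_one, mul_zero, hx s (hS s hs)]
    rw [Finset.sum_congr rfl this, Finset.sum_ite_eq]
    split_ifs with h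
    · rfl
    · by_contra hne
      refine h (Finset.mem_image.mpr ⟨sortedExp D (shape α), ?_, ?_⟩)
      · rw [MvPolynomial.mem_support_iff, hc, shape_sortedExp (hD _ hne) (zero_notMem_shape α)]
        exact hne
      · exact shape_sortedExp (hD _ hne) (zero_notMem_shape α)
  rw [e]
  exact Submodule.sum_mem _ fun s _ => Submodule.smul_mem _ _
    (Submodule.subset_span ⟨x s, rfl⟩)

/-! ### Dominance of partitions -/

omit [CharZero K] in
theorem card_parts_le {d : ℕ} (lam : d.Partition) : lam.parts.card ≤ d := by
  have h : lam.parts.card • 1 ≤ lam.parts.sum :=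
    Multiset.card_nsmul_le_sum fun x hx => lam.parts_pos hx
  rw [lam.parts_sum] at h
  simpa using h

/-- The exponent vector of a partition. -/
abbrev partExp (n : ℕ) {d : ℕ} (lam : d.Partition) : Fin n →₀ ℕ := sortedExp n lam.parts

theorem shape_partExp {n d : ℕ} {lam : d.Partition} (h : lam.parts.card ≤ n) :
    shape (partExp n lam) = lam.parts := shape_sortedExp h (zero_notMem_parts lam)

theorem expLE_partExp_iff {n d : ℕ} {mu lam : d.Partition} (hm : mu.parts.card ≤ n)
    (hl : lam.parts.card ≤ n) : ExpLE (partExp n mu) (partExp n lam) ↔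
      ∀ r, partialSum mu r ≤ partialSum lam r := by
  have h1 : ∀ r, headSum r (partExp n mu) = partialSum mu r := headSum_sortedExp hm
  have h2 : ∀ r, headSum r (partExp n lam) = partialSum lam r := headSum_sortedExp hl
  constructor
  · intro h r
    rw [← h1, ← h2]; exact h.1 r
  · intro h
    refine ⟨fun r => by rw [h1, h2]; exact h r, ?_⟩
    rw [headSum_eq_sum_shape, headSum_eq_sum_shape, shape_partExp hm, shape_partExp hl,
      mu.parts_sum, lam.parts_sum]

theorem domLT_iff {d : ℕ} {mu lam : d.Partition} :
    DomLT mu lam ↔ mu ≠ lam ∧ ExpLE (partExp d mu) (partExp d lam) := by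
  rw [DomLT, expLE_partExp_iff (card_parts_le mu) (card_parts_le lam)]

/-- Supplies the natural number on which the triangular inductions below are based. -/
theorem DomLT.expWeight_lt {d : ℕ} {mu lam : d.Partition} (h : DomLT mu lam) :
    expWeight (partExp d mu) < expWeight (partExp d lam) := by
  rw [domLT_iff] at h
  refine lt_of_le_of_ne h.2.expWeight_le fun e => h.1 ?_
  have := congrArg shape (h.2.eq_of_expWeight e)
  rw [shape_partExp (card_parts_le mu), shape_partExp (card_parts_le lam)] at this
  exact Nat.Partition.ext this

theorem DomLT.trans {d : ℕ} {nu mu lam : d.Partition} (h : DomLT nu mu) (h' : DomLT mu lam) :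
    DomLT nu lam := by
  refine ⟨?_, fun r => (h.2 r).trans (h'.2 r)⟩
  rintro rfl
  exact lt_irrefl _ (h.expWeight_lt.trans h'.expWeight_lt)

theorem dominatedBy_monSym (n : ℕ) {d : ℕ} (lam : d.Partition) :
    DominatedBy (toVars n (monSym K lam)) (partExp n lam) := by
  intro α h
  rw [isCoeffFun_monSym] at h
  have h : shape α = lam.parts := by
    by_contra hne; exact h (if_neg hne)
  rw [partExp, ← h]
  exact expLE_sortedExp α

variable (K) in
/-- The span of the monomial functions below `λ`. -/
def lowerSpan {d : ℕ} (lam : d.Partition) : Submodule K (SymFun K) :=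
  Submodule.span K (monSym K '' {mu | DomLT mu lam})

theorem lowerSpan_mono {d : ℕ} {mu lam : d.Partition} (h : DomLT mu lam) :
    lowerSpan K mu ≤ lowerSpan K lam :=
  Submodule.span_mono (Set.image_mono fun _ h' => h'.trans h)

theorem mem_lowerSpan_iff {d : ℕ} {lam : d.Partition} {f : SymFun K} : f ∈ lowerSpan K lam ↔
    ∃ u : d.Partition → K, (∀ mu, u mu ≠ 0 → DomLT mu lam) ∧ f = ∑ mu, u mu • monSym K mu := by
  constructor
  · intro h
    obtain ⟨l, hl, rfl⟩ := (Finsupp.mem_span_image_iff_linearCombination K).mp h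
    refine ⟨l, fun mu hmu => hl (Finsupp.mem_support_iff.mpr hmu), ?_⟩
    rw [Finsupp.linearCombination_apply, Finsupp.sum_fintype _ _ (by simp)]
  · rintro ⟨u, hu, rfl⟩
    refine Submodule.sum_mem _ fun mu _ => ?_
    by_cases h : u mu = 0
    · rw [h, zero_smul]; exact Submodule.zero_mem _
    · exact Submodule.smul_mem _ _ (Submodule.subset_span ⟨mu, hu mu h, rfl⟩)

/-- Condition (A), stated in every number of variables, becomes an intrinsic membership because
symmetric functions are determined by their values in finitely many variables. -/
theorem triangular_iff {d : ℕ} {lam : d.Partition} {P : SymFun K} :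
    (∃ u : d.Partition → K, (∀ mu, u mu ≠ 0 → DomLT mu lam) ∧
      ∀ n : ℕ, toVars n P = MvPolynomial.msymm (Fin n) K lam +
        ∑ mu : d.Partition, MvPolynomial.C (u mu) * MvPolynomial.msymm (Fin n) K mu) ↔
      P - monSym K lam ∈ lowerSpan K lam := by
  rw [mem_lowerSpan_iff]
  refine exists_congr fun u => and_congr_right fun _ => ?_
  have e : ∀ n, toVars n (∑ mu, u mu • monSym K mu) =
      ∑ mu, MvPolynomial.C (u mu) * MvPolynomial.msymm (Fin n) K mu := by
    intro n
    rw [map_sum]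
    exact Finset.sum_congr rfl fun mu _ => by
      rw [map_smul, toVars_monSym, MvPolynomial.C_mul']
  constructor
  · intro h
    refine eq_of_toVars fun n => ?_
    rw [map_sub, h, e, toVars_monSym, add_sub_cancel_left]
  · intro h n
    rw [← toVars_monSym, ← e, ← h, ← map_add, add_sub_cancel]

/-! ### Existence of the Macdonald functions -/

variable {q : K} {β : ℕ}

omit [CharZero K] in
theorem pow_ne_one_of_transcendental [CharZero K] (hq : Transcendental ℚ q) {k : ℕ} (hk : 0 < k) :
    q ^ k ≠ 1 := fun h => (hq.pow hk) (by rw [h]; exact isAlgebraic_one)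

theorem powerNorm_ne_zero (hq : Transcendental ℚ q) (hβ : 0 < β) (n : ℕ) :
    powerNorm q (q ^ β) n ≠ 0 := by
  refine mul_ne_zero (Nat.cast_ne_zero.mpr n.succ_ne_zero) (div_ne_zero ?_ ?_)
  · exact sub_ne_zero.mpr (pow_ne_one_of_transcendental hq n.succ_pos).symm
  · rw [← pow_mul]
    exact sub_ne_zero.mpr (pow_ne_one_of_transcendental hq (Nat.mul_pos hβ n.succ_pos)).symm

theorem ne_zero_of_transcendental (hq : Transcendental ℚ q) : q ≠ 0 := by
  rintro rfl
  exact hq isAlgebraic_zero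

variable (q β) in
/-- The eigenvalue of the operator `opE` at a partition. -/
def epsE {d : ℕ} (lam : d.Partition) : K :=
  (1 + (q ^ β - 1) * eigVal q (q ^ β) (partExp d lam)) / (q ^ β) ^ d

/-- The operator `opE` is triangular. -/
theorem opE_monSym (hq : Transcendental ℚ q) (hβ : 0 < β) {d : ℕ} (lam : d.Partition) :
    opE q (q ^ β) (monSym K lam) - epsE q β lam • monSym K lam ∈ lowerSpan K lam ∧
    ∀ n, lam.parts.card ≤ n →
      (q ^ β) ^ n * epsE q β lam = 1 + (q ^ β - 1) * eigVal q (q ^ β) (partExp n lam) := by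
  have ht : q ^ β ≠ 0 := pow_ne_zero _ (ne_zero_of_transcendental hq)
  have hz := powerNorm_ne_zero hq hβ
  obtain ⟨c, D, hc, -, -⟩ := exists_isCoeffFun (opE q (q ^ β) (monSym K lam))
  have hdom : ∀ n s, s.card ≤ n → 0 ∉ s → c s ≠ 0 → ExpLE (sortedExp n s) (partExp n lam) := by
    intro n s hs h0 hne
    refine (dominatedBy_opE ht hz (dominatedBy_monSym n lam)).1 _ ?_
    rwa [hc, shape_sortedExp hs h0]
  have hcoef : ∀ n, lam.parts.card ≤ n → (q ^ β) ^ n * c lam.parts =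
      1 + (q ^ β - 1) * eigVal q (q ^ β) (partExp n lam) := by
    intro n hn
    have := (dominatedBy_opE ht hz (dominatedBy_monSym n lam)).2
    rw [hc, isCoeffFun_monSym, shape_partExp hn] at this
    simpa only [if_true, mul_one] using this
  -- The coefficient of `m_λ` does not depend on the number of variables, so the value computed with
  -- `d` variables also serves every `n` not less than the length of `λ`.
  have heps : c lam.parts = epsE q β lam := by
    rw [epsE, ← hcoef d (card_parts_le lam), mul_div_cancel_left₀ _ (pow_ne_zero _ ht)]
  refine ⟨?_, by rwa [heps] at hcoef⟩
  have hsum : ∀ s, 0 ∉ s → c s ≠ 0 → s.sum = d := by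
    intro s h0 hs
    have := (hdom (max s.card d) s (le_max_left _ _) h0 hs).2
    rwa [headSum_eq_sum_shape, headSum_eq_sum_shape, shape_sortedExp (le_max_left _ _) h0,
      shape_partExp ((card_parts_le lam).trans (le_max_right _ _)), lam.parts_sum] at this
  have hE := eq_sum_monSym hc hsum
  rw [mem_lowerSpan_iff]
  classical
  refine ⟨fun mu => if mu = lam then 0 else c mu.parts, fun mu hmu => ?_, ?_⟩
  · dsimp only at hmu
    split_ifs at hmu with h
    · exact absurd rfl hmu
    · exact domLT_iff.mpr ⟨h, hdom d _ (card_parts_le mu) (zero_notMem_parts mu) hmu⟩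
  · rw [hE, ← heps, ← Finset.add_sum_erase _ _ (Finset.mem_univ lam), add_sub_cancel_left,
      ← Finset.add_sum_erase Finset.univ
        (fun mu => (if mu = lam then 0 else c mu.parts) • monSym K mu) (Finset.mem_univ lam),
      if_pos rfl, zero_smul, zero_add]
    exact Finset.sum_congr rfl fun mu hmu => by rw [if_neg (Finset.ne_of_mem_erase hmu)]

/-- The right side is `(q^β)^n` times the eigenvalue of the partition with shape `α`. The two
partitions are then compared in a common number `m` of variables, where the eigenvalues are
injective. -/
theorem parts_eq_of_epsE (hq : Transcendental ℚ q) (hβ : 0 < β) {d : ℕ} {lam : d.Partition} {n : ℕ}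
    {α : Fin n →₀ ℕ} (hα : Antitone α)
    (h : (q ^ β) ^ n * epsE q β lam = 1 + (q ^ β - 1) * eigVal q (q ^ β) α) :
    shape α = lam.parts := by
  have ht : q ^ β ≠ 0 := pow_ne_zero _ (ne_zero_of_transcendental hq)
  set mu : (shape α).sum.Partition := ⟨shape α, fun {i} hi => Nat.pos_of_ne_zero fun h =>
      zero_notMem_shape α (h ▸ hi), rfl⟩
  have h1 : ∀ m, (shape α).card ≤ m → (q ^ β) ^ m * epsE q β mu =
      1 + (q ^ β - 1) * eigVal q (q ^ β) (partExp m mu) := (opE_monSym hq hβ mu).2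
  have h2 : partExp n mu = α := eq_of_antitone_of_shape (sortedExp_antitone _) hα
    (shape_partExp (card_shape_le α))
  have h3 : epsE q β lam = epsE q β mu := by
    have := h1 n (card_shape_le α)
    rw [h2, ← h] at this
    exact (mul_left_cancel₀ (pow_ne_zero _ ht) this).symm
  set m := max (shape α).card lam.parts.card
  have h4 := h1 m (le_max_left _ _)
  rw [← h3, (opE_monSym hq hβ lam).2 m (le_max_right _ _), add_right_inj] at h4
  have h5 : q ^ β - 1 ≠ 0 := sub_ne_zero.mpr (pow_ne_one_of_transcendental hq hβ)
  have h6 := eigVal_injective hq hβ (sortedExp_antitone _) (sortedExp_antitone _)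
    (mul_left_cancel₀ h5 h4)
  have h7 : shape (partExp m mu) = shape α := shape_partExp (lam := mu) (le_max_left _ _)
  exact h7.symm.trans ((congrArg shape h6).symm.trans (shape_partExp (le_max_right _ _)))

theorem parts_eq_of_epsE_eq (hq : Transcendental ℚ q) (hβ : 0 < β) {d e : ℕ} {lam : d.Partition}
    {mu : e.Partition} (h : epsE q β lam = epsE q β mu) : lam.parts = mu.parts := by
  have := (opE_monSym hq hβ lam).2 d (card_parts_le lam)
  rw [h] at this
  rw [← parts_eq_of_epsE hq hβ (sortedExp_antitone _) this, shape_partExp (card_parts_le lam)]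

theorem sigma_eq_of_parts {d e : ℕ} {lam : d.Partition} {mu : e.Partition}
    (h : lam.parts = mu.parts) : (⟨d, lam⟩ : Σ k : ℕ, k.Partition) = ⟨e, mu⟩ := by
  have hd : d = e := by rw [← lam.parts_sum, ← mu.parts_sum, h]
  subst hd
  rw [Nat.Partition.ext h]

/-- On the span of the functions below `λ` the operator is triangular with diagonal entries `epsE`
of `mu` minus `epsE` of `λ`. These are nonzero, so the triangular system is solved by induction on
the weight. -/
theorem lowerSpan_le_map (hq : Transcendental ℚ q) (hβ : 0 < β) {d : ℕ} (lam : d.Partition) :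
    lowerSpan K lam ≤
      (lowerSpan K lam).map (opE q (q ^ β) - epsE q β lam • LinearMap.id) := by
  have key : ∀ N, ∀ mu : d.Partition, expWeight (partExp d mu) < N → DomLT mu lam →
      monSym K mu ∈ (lowerSpan K lam).map (opE q (q ^ β) - epsE q β lam • LinearMap.id) := by
    intro N
    induction N with
    | zero => intro mu h; exact absurd h (Nat.not_lt_zero _)
    | succ N ih =>
      intro mu hN hmu
      set U := (lowerSpan K lam).map (opE q (q ^ β) - epsE q β lam • LinearMap.id)
      have h1 : lowerSpan K mu ≤ U := by
        refine Submodule.span_le.mpr ?_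
        rintro _ ⟨nu, hnu, rfl⟩
        exact ih nu (lt_of_lt_of_le hnu.expWeight_lt (Nat.lt_succ_iff.mp hN)) (hnu.trans hmu)
      have h2 : opE q (q ^ β) (monSym K mu) - epsE q β lam • monSym K mu ∈ U :=
        ⟨monSym K mu, Submodule.subset_span ⟨mu, hmu, rfl⟩, rfl⟩
      have h3 := U.sub_mem h2 (h1 (opE_monSym hq hβ mu).1)
      rw [sub_sub_sub_cancel_left, ← sub_smul] at h3
      refine (U.smul_mem_iff (sub_ne_zero.mpr fun e => ?_)).mp h3
      exact hmu.1 (Nat.Partition.ext (parts_eq_of_epsE_eq hq hβ e))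
  refine Submodule.span_le.mpr ?_
  rintro _ ⟨mu, hmu, rfl⟩
  exact key _ mu (Nat.lt_succ_self _) hmu

/-- Correcting `m_λ` by a solution of the lower triangular system gives an eigenvector of `opE`.
Eigenvectors of a self-adjoint operator for different eigenvalues are orthogonal. -/
theorem exists_isMacdonaldFamily (hq : Transcendental ℚ q) (hβ : 0 < β) :
    ∃ P, IsMacdonaldFamily q (q ^ β) P := by
  have h : ∀ (d : ℕ) (lam : d.Partition), ∃ P : SymFun K, P - monSym K lam ∈ lowerSpan K lam ∧
      opE q (q ^ β) P = epsE q β lam • P := by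
    intro d lam
    obtain ⟨w, hw, e⟩ := lowerSpan_le_map hq hβ lam (opE_monSym hq hβ lam).1
    refine ⟨monSym K lam - w, ?_, ?_⟩
    · rw [sub_sub_cancel_left]; exact Submodule.neg_mem _ hw
    · rw [LinearMap.sub_apply, LinearMap.smul_apply, LinearMap.id_apply, sub_eq_sub_iff_add_eq_add]
        at e
      rw [map_sub, smul_sub, sub_eq_sub_iff_add_eq_add, ← e, add_comm]
  choose P hP1 hP2 using h
  refine ⟨P, ⟨fun d lam => triangular_iff.mpr (hP1 d lam), fun d e lam mu hne => ?_⟩⟩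
  have h := scalarForm_opE (powerNorm_ne_zero hq hβ) (P d lam) (P e mu)
  rw [hP2, hP2, map_smul, map_smul, LinearMap.smul_apply, smul_eq_mul, smul_eq_mul, ← sub_eq_zero,
    ← sub_mul] at h
  rcases mul_eq_zero.mp h with h | h
  · exact absurd (sigma_eq_of_parts (parts_eq_of_epsE_eq hq hβ (sub_eq_zero.mp h))) hne
  · exact h

/-! ### Properties of the Macdonald functions -/

variable (q β) in
/-- The Macdonald function at `t = q^β`. -/
abbrev macP {d : ℕ} (lam : d.Partition) : SymFun K := macdonaldP q (q ^ β) lam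

theorem isMacdonaldFamily_macP (hq : Transcendental ℚ q) (hβ : 0 < β) :
    IsMacdonaldFamily q (q ^ β) fun d lam => macP q β (d := d) lam :=
  Classical.epsilon_spec (exists_isMacdonaldFamily hq hβ)

theorem macP_sub_mem (hq : Transcendental ℚ q) (hβ : 0 < β) {d : ℕ} (lam : d.Partition) :
    macP q β lam - monSym K lam ∈ lowerSpan K lam :=
  triangular_iff.mp ((isMacdonaldFamily_macP hq hβ).triangular d lam)

theorem scalarForm_macP (hq : Transcendental ℚ q) (hβ : 0 < β) {d e : ℕ} {lam : d.Partition}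
    {mu : e.Partition} (h : lam.parts ≠ mu.parts) :
    scalarForm q (q ^ β) (macP q β lam) (macP q β mu) = 0 :=
  (isMacdonaldFamily_macP hq hβ).orthogonal d e lam mu fun e => h (by cases e; rfl)

/-- Inverts the unitriangular change of basis, by induction on the weight. -/
theorem monSym_mem_span (hq : Transcendental ℚ q) (hβ : 0 < β) {d : ℕ} (lam : d.Partition) :
    ∀ N, ∀ mu : d.Partition, expWeight (partExp d mu) < N → DomLT mu lam →
      monSym K mu ∈ Submodule.span K ((fun mu => macP q β mu) '' {mu | DomLT mu lam}) := by
  intro N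
  induction N with
  | zero => intro mu h; exact absurd h (Nat.not_lt_zero _)
  | succ N ih =>
    intro mu hN hmu
    have h1 : lowerSpan K mu ≤
        Submodule.span K ((fun mu => macP q β mu) '' {mu | DomLT mu lam}) := by
      refine Submodule.span_le.mpr ?_
      rintro _ ⟨nu, hnu, rfl⟩
      exact ih nu (lt_of_lt_of_le hnu.expWeight_lt (Nat.lt_succ_iff.mp hN)) (hnu.trans hmu)
    have h0 : macP q β mu ∈ Submodule.span K ((fun mu => macP q β mu) '' {mu | DomLT mu lam}) :=
      Submodule.subset_span ⟨mu, hmu, rfl⟩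
    have h2 := Submodule.sub_mem _ h0 (h1 (macP_sub_mem hq hβ mu))
    rwa [sub_sub_cancel] at h2

theorem lowerSpan_le_span (hq : Transcendental ℚ q) (hβ : 0 < β) {d : ℕ} (lam : d.Partition) :
    lowerSpan K lam ≤ Submodule.span K ((fun mu => macP q β mu) '' {mu | DomLT mu lam}) := by
  refine Submodule.span_le.mpr ?_
  rintro _ ⟨mu, hmu, rfl⟩
  exact monSym_mem_span hq hβ lam _ mu (Nat.lt_succ_self _) hmu

theorem span_macP (hq : Transcendental ℚ q) (hβ : 0 < β) : Submodule.span K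
    (Set.range fun x : Σ d : ℕ, d.Partition => macP q β x.2) = ⊤ := by
  rw [eq_top_iff, ← span_monSym]
  refine Submodule.span_le.mpr ?_
  rintro _ ⟨⟨d, lam⟩, rfl⟩
  have h1 := Submodule.span_mono (R := K) (show (fun mu => macP q β mu) '' {mu | DomLT mu lam} ⊆
    Set.range fun x : Σ d : ℕ, d.Partition => macP q β x.2 by
      rintro _ ⟨mu, -, rfl⟩; exact ⟨⟨d, mu⟩, rfl⟩) (lowerSpan_le_span hq hβ lam (macP_sub_mem hq hβ lam))
  have h2 := Submodule.sub_mem _ (Submodule.subset_span (R := K)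
    (Set.mem_range_self (f := fun x : Σ d : ℕ, d.Partition => macP q β x.2) ⟨d, lam⟩)) h1
  rw [sub_sub_cancel] at h2
  exact h2

theorem eq_zero_of_scalarForm_macP (hq : Transcendental ℚ q) (hβ : 0 < β) {f : SymFun K}
    (h : ∀ (d : ℕ) (lam : d.Partition), scalarForm q (q ^ β) f (macP q β lam) = 0) : f = 0 := by
  refine eq_zero_of_scalarForm (powerNorm_ne_zero hq hβ) fun g => ?_
  have h' : Submodule.span K (Set.range fun x : Σ d : ℕ, d.Partition => macP q β x.2) ≤
      LinearMap.ker (scalarForm q (q ^ β) f) := by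
    refine Submodule.span_le.mpr ?_
    rintro _ ⟨⟨d, lam⟩, rfl⟩
    exact h d lam
  rw [span_macP hq hβ] at h'
  exact h' Submodule.mem_top

/-- The Macdonald functions are eigenvectors. -/
theorem opE_macP (hq : Transcendental ℚ q) (hβ : 0 < β) {d : ℕ} (lam : d.Partition) :
    opE q (q ^ β) (macP q β lam) = epsE q β lam • macP q β lam := by
  set S := Submodule.span K ((fun mu : d.Partition => macP q β mu) '' {mu | DomLT mu lam})
  have hSperp : ∀ (e : ℕ) (nu : e.Partition), (∀ mu : d.Partition, DomLT mu lam →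
      mu.parts ≠ nu.parts) → ∀ x ∈ S, scalarForm q (q ^ β) x (macP q β nu) = 0 := by
    intro e nu hnu x hx
    have h' : S ≤ LinearMap.ker ((scalarForm q (q ^ β)).flip (macP q β nu)) := by
      refine Submodule.span_le.mpr ?_
      rintro _ ⟨mu, hmu, rfl⟩
      exact scalarForm_macP hq hβ (hnu mu hmu)
    exact h' hx
  have hopE : ∀ mu : d.Partition, opE q (q ^ β) (macP q β mu) - epsE q β mu • macP q β mu ∈
      lowerSpan K mu := by
    intro mu
    have h1 := macP_sub_mem hq hβ mu
    have h2 : opE q (q ^ β) (macP q β mu - monSym K mu) ∈ lowerSpan K mu := by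
      have : lowerSpan K mu ≤ (lowerSpan K mu).comap (opE q (q ^ β)) := by
        refine Submodule.span_le.mpr ?_
        rintro _ ⟨nu, hnu, rfl⟩
        have := Submodule.add_mem _ (lowerSpan_mono hnu (opE_monSym hq hβ nu).1)
          (Submodule.smul_mem _ (epsE q β nu) (Submodule.subset_span ⟨nu, hnu, rfl⟩))
        rwa [sub_add_cancel] at this
      exact this h1
    have h3 := Submodule.sub_mem _ (Submodule.add_mem _ h2 (opE_monSym hq hβ mu).1)
      (Submodule.smul_mem _ (epsE q β mu) h1)
    convert h3 using 1
    rw [map_sub, smul_sub]; abel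
  have hmem : ∀ mu : d.Partition, DomLT mu lam → opE q (q ^ β) (macP q β mu) ∈ S := by
    intro mu hmu
    have := Submodule.add_mem S (lowerSpan_le_span hq hβ lam (lowerSpan_mono hmu (hopE mu)))
      (Submodule.smul_mem S (epsE q β mu) (Submodule.subset_span ⟨mu, hmu, rfl⟩))
    rwa [sub_add_cancel] at this
  -- The difference lies in the span `S` of the lower Macdonald functions, so it is orthogonal to
  -- `P_ν` unless `ν < λ`. In that case self-adjointness moves the operator to `P_ν`, whose image
  -- stays in `S` and is orthogonal to `P_λ`.
  refine sub_eq_zero.mp (eq_zero_of_scalarForm_macP hq hβ fun e nu => ?_)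
  by_cases h : ∀ mu : d.Partition, DomLT mu lam → mu.parts ≠ nu.parts
  · exact hSperp e nu h _ (lowerSpan_le_span hq hβ lam (hopE lam))
  · push Not at h
    obtain ⟨mu, hmu, hparts⟩ := h
    have hs := sigma_eq_of_parts hparts
    cases hs
    have hl : ∀ x ∈ S, scalarForm q (q ^ β) x (macP q β lam) = 0 :=
      hSperp d lam fun mu hmu e => hmu.1 (Nat.Partition.ext e)
    have symm : ∀ f g : SymFun K, scalarForm q (q ^ β) f g = scalarForm q (q ^ β) g f :=
      fun f g => scalarQT_comm f g
    rw [map_sub, map_smul, LinearMap.sub_apply, LinearMap.smul_apply,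
      scalarForm_opE (powerNorm_ne_zero hq hβ), symm, hl _ (hmem mu hmu), symm,
      hl _ (Submodule.subset_span ⟨mu, hmu, rfl⟩), smul_zero, sub_zero]

theorem coeff_toVars_macP (hq : Transcendental ℚ q) (hβ : 0 < β) {d n : ℕ} {lam : d.Partition}
    (h : lam.parts.card ≤ n) : (toVars n (macP q β lam)).coeff (partExp n lam) = 1 := by
  obtain ⟨u, hu, e⟩ := mem_lowerSpan_iff.mp (macP_sub_mem hq hβ lam)
  rw [sub_eq_iff_eq_add] at e
  have hz : ∀ mu, (toVars n (u mu • monSym K mu)).coeff (partExp n lam) = 0 := by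
    intro mu
    rw [map_smul, MvPolynomial.coeff_smul, isCoeffFun_monSym, shape_partExp h]
    by_cases hmu : u mu = 0
    · rw [hmu, zero_smul]
    · dsimp only
      rw [if_neg fun h => (hu mu hmu).1 (Nat.Partition.ext h.symm), smul_zero]
  rw [e, map_add, MvPolynomial.coeff_add, map_sum, MvPolynomial.coeff_sum,
    Finset.sum_eq_zero fun mu _ => hz mu, zero_add, isCoeffFun_monSym, shape_partExp h]
  exact if_pos rfl

theorem macP_ne_zero (hq : Transcendental ℚ q) (hβ : 0 < β) {d : ℕ} (lam : d.Partition) :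
    macP q β lam ≠ 0 := by
  intro h
  have := coeff_toVars_macP hq hβ (card_parts_le lam)
  rw [h, map_zero, MvPolynomial.coeff_zero] at this
  exact zero_ne_one this

/-- Otherwise `P_λ` would be orthogonal to a spanning set, against nondegeneracy. -/
theorem scalarForm_macP_self_ne_zero (hq : Transcendental ℚ q) (hβ : 0 < β) {d : ℕ}
    (lam : d.Partition) : scalarForm q (q ^ β) (macP q β lam) (macP q β lam) ≠ 0 := by
  intro h
  refine macP_ne_zero hq hβ lam (eq_zero_of_scalarForm_macP hq hβ fun e mu => ?_)
  by_cases hp : lam.parts = mu.parts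
  · cases sigma_eq_of_parts hp
    exact h
  · exact scalarForm_macP hq hβ hp

/-- The reduced operator `∑_i ∏_{j ≠ i} (t x_i - x_j)/(x_i - x_j) T_{q,x_i}` acts by `e` on `G`,
with cleared denominators. -/
def IsEigen (q t e : K) {n : ℕ} (G : MvPolynomial (Fin n) K) : Prop :=
  MvPolynomial.C e * (diffProd K n * G) = ∑ i, diffNum t i * qScale q i G

/-- In `n` variables `t^n opE = 1 + (t - 1) D` with `D` the difference operator; the eigenvalue is
obtained by solving for that of `D`. -/
theorem isEigen_toVars (hq : Transcendental ℚ q) (hβ : 0 < β) (n : ℕ) {f : SymFun K} {e : K}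
    (hf : opE q (q ^ β) f = e • f) :
    IsEigen q (q ^ β) (((q ^ β) ^ n * e - 1) / (q ^ β - 1)) (toVars n f) := by
  have h := diffProd_mul_opE (n := n) (pow_ne_zero β (ne_zero_of_transcendental hq))
    (powerNorm_ne_zero hq hβ) f
  have h5 : q ^ β - 1 ≠ 0 := sub_ne_zero.mpr (pow_ne_one_of_transcendental hq hβ)
  rw [hf, map_smul, ← MvPolynomial.C_mul'] at h
  have h6 : (MvPolynomial.C (q ^ β - 1) : MvPolynomial (Fin n) K) ≠ 0 := by
    rwa [Ne, MvPolynomial.C_eq_zero]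
  refine mul_left_cancel₀ h6 ?_
  rw [← mul_assoc, ← map_mul, mul_div_cancel₀ _ h5, map_sub, map_one, map_mul]
  linear_combination h

omit [CharZero K] in
-- A symmetric eigenfunction has a decreasing exponent of maximal weight that fixes its eigenvalue.
-- This is the tool for proving that an eigenfunction vanishes.
theorem eigen_exponent {q t e : K} {n : ℕ} {G : MvPolynomial (Fin n) K} (hG : IsEigen q t e G)
    (hs : G.IsSymmetric) (h0 : G ≠ 0) :
    ∃ α : Fin n →₀ ℕ, Antitone α ∧ G.coeff α ≠ 0 ∧ e = eigVal q t α := by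
  obtain ⟨γ, hγ⟩ := MvPolynomial.ne_zero_iff.mp h0
  obtain ⟨α, hα, hmax⟩ := exists_max_exponent (fun _ => 0) hγ
  have hmax : ∀ γ, G.coeff γ ≠ 0 → expWeight γ ≤ expWeight α := fun γ hγ => by
    rcases hmax γ hγ with h | h
    · exact absurd h (lt_irrefl _)
    · exact h.2
  exact ⟨α, antitone_of_max hs hα hmax, hα, eigVal_of_max hG hα hmax⟩

theorem isEigen_macP (hq : Transcendental ℚ q) (hβ : 0 < β) {d n : ℕ} {lam : d.Partition}
    (h : lam.parts.card ≤ n) :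
    IsEigen q (q ^ β) (eigVal q (q ^ β) (partExp n lam)) (toVars n (macP q β lam)) := by
  have h1 := isEigen_toVars hq hβ n (opE_macP hq hβ lam)
  have h5 : q ^ β - 1 ≠ 0 := sub_ne_zero.mpr (pow_ne_one_of_transcendental hq hβ)
  rwa [(opE_monSym hq hβ lam).2 n h, add_sub_cancel_left, mul_div_cancel_left₀ _ h5] at h1

/-- A nonzero restriction would have a decreasing exponent with the eigenvalue of `λ`, hence of
shape `λ`, which is impossible with fewer variables than parts. -/
theorem toVars_macP_eq_zero (hq : Transcendental ℚ q) (hβ : 0 < β) {d n : ℕ} {lam : d.Partition}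
    (h : n < lam.parts.card) : toVars n (macP q β lam) = 0 := by
  by_contra h0
  obtain ⟨α, hα, -, he⟩ := eigen_exponent (isEigen_toVars hq hβ n (opE_macP hq hβ lam))
    (toVars_isSymmetric _) h0
  have h5 : q ^ β - 1 ≠ 0 := sub_ne_zero.mpr (pow_ne_one_of_transcendental hq hβ)
  rw [div_eq_iff h5] at he
  have := parts_eq_of_epsE hq hβ (lam := lam) hα (by rw [mul_comm (q ^ β - 1), ← he]; ring)
  have h2 := card_shape_le α
  rw [this] at h2
  omega

end Macdonald

/-! ### The constant term scalar product -/

section Laurent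
variable {K : Type*} [Field K] {n : ℕ}

theorem laurent_linear_ext {M : Type*} [AddCommMonoid M] [Module K M] {φ ψ : Laurent K n →ₗ[K] M}
    (h : ∀ u, φ (lmono K u) = ψ (lmono K u)) : φ = ψ := by
  refine LinearMap.ext fun f => ?_
  induction f using AddMonoidAlgebra.induction_linear with
  | zero => rw [map_zero, map_zero]
  | add f g hf hg => rw [map_add, map_add, hf, hg]
  | single u c =>
    have : AddMonoidAlgebra.single u c = c • lmono K u := by
      rw [lmono, AddMonoidAlgebra.smul_single, smul_eq_mul, mul_one]
    rw [this, map_smul, map_smul, h]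

theorem laurent_algHom_ext {S : Type*} [Semiring S] [Algebra K S] {φ ψ : Laurent K n →ₐ[K] S}
    (h : ∀ u, φ (lmono K u) = ψ (lmono K u)) : φ = ψ :=
  AlgHom.toLinearMap_injective (laurent_linear_ext h)

variable (K n) in
/-- The constant term of a Laurent polynomial. -/
def constTerm : Laurent K n →ₗ[K] K where
  toFun f := f.coeff 0
  map_add' _ _ := rfl
  map_smul' _ _ := rfl

theorem constTerm_apply (f : Laurent K n) : constTerm K n f = f.coeff 0 := rfl

theorem constTerm_lmono (u : Fin n → ℤ) : constTerm K n (lmono K u) = if u = 0 then 1 else 0 := by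
  classical
  rw [constTerm_apply, lmono, AddMonoidAlgebra.coeff_single, Finsupp.single_apply]

variable (K n) in
/-- The inclusion of polynomials in Laurent polynomials. -/
def toLaurent : MvPolynomial (Fin n) K →ₐ[K] Laurent K n :=
  MvPolynomial.aeval fun i => lmono K (Pi.single i 1)

theorem toLaurent_X (i : Fin n) : toLaurent K n (MvPolynomial.X i) = lmono K (Pi.single i 1) :=
  MvPolynomial.aeval_X _ _

theorem lmono_mul (u v : Fin n → ℤ) : lmono K u * lmono K v = lmono K (u + v) := by
  rw [lmono, lmono, AddMonoidAlgebra.single_mul_single, one_mul, lmono]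

theorem lmono_zero : lmono K (0 : Fin n → ℤ) = 1 := rfl

/-- The exponents of a monomial as integers. -/
def intExp (α : Fin n →₀ ℕ) : Fin n → ℤ := fun i => α i

theorem intExp_injective : Function.Injective (intExp (n := n)) := fun α γ h => by
  ext i
  exact Int.ofNat_injective (congrFun h i)

theorem toLaurent_monomial (α : Fin n →₀ ℕ) (c : K) :
    toLaurent K n (MvPolynomial.monomial α c) = AddMonoidAlgebra.single (intExp α) c := by
  have h : toLaurent K n (MvPolynomial.monomial α 1) = lmono K (intExp α) := by
    induction α using Finsupp.induction_linear with
    | zero => exact map_one _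
    | add α γ h1 h2 =>
      rw [← mul_one (1 : K), ← MvPolynomial.monomial_mul, map_mul, h1, h2, lmono_mul]
      congr 1
    | single i k =>
      rw [← MvPolynomial.X_pow_eq_monomial, map_pow, toLaurent_X, lmono,
        AddMonoidAlgebra.single_pow, one_pow, lmono]
      congr 1
      ext j
      simp [intExp, Finsupp.single_apply, Pi.single_apply, eq_comm]
  have hc : MvPolynomial.monomial α c = c • MvPolynomial.monomial α (1 : K) := by
    rw [MvPolynomial.smul_monomial, smul_eq_mul, mul_one]
  rw [hc, map_smul, h, lmono, AddMonoidAlgebra.smul_single, smul_eq_mul, mul_one]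

theorem coeff_toLaurent (F : MvPolynomial (Fin n) K) (α : Fin n →₀ ℕ) :
    (toLaurent K n F).coeff (intExp α) = F.coeff α := by
  classical
  induction F using MvPolynomial.induction_on' with
  | monomial γ c =>
    rw [toLaurent_monomial, AddMonoidAlgebra.coeff_single, Finsupp.single_apply,
      MvPolynomial.coeff_monomial]
    simp only [intExp_injective.eq_iff]
  | add f g hf hg =>
    rw [map_add, MvPolynomial.coeff_add, ← hf, ← hg, AddMonoidAlgebra.coeff_add, Finsupp.add_apply]

theorem toLaurent_injective : Function.Injective (toLaurent K n) := fun F G h => by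
  ext α
  rw [← coeff_toLaurent, h, coeff_toLaurent]

variable (K n) in
/-- The involution `x ↦ x⁻¹`. -/
def laurentInv : Laurent K n →ₐ[K] Laurent K n :=
  AddMonoidAlgebra.mapDomainAlgHom K K (-AddMonoidHom.id (Fin n → ℤ))

theorem laurentInv_single (u : Fin n → ℤ) (c : K) :
    laurentInv K n (AddMonoidAlgebra.single u c) = AddMonoidAlgebra.single (-u) c := by
  simp [laurentInv]

/-- The action of permutations of the variables. -/
def laurentPerm (σ : Equiv.Perm (Fin n)) : Laurent K n →ₐ[K] Laurent K n :=
  AddMonoidAlgebra.mapDomainAlgHom K K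
    (AddMonoidHom.mk' (fun (u : Fin n → ℤ) i => u (σ.symm i)) fun _ _ => rfl)

theorem laurentPerm_single (σ : Equiv.Perm (Fin n)) (u : Fin n → ℤ) (c : K) :
    laurentPerm σ (AddMonoidAlgebra.single u c) =
      AddMonoidAlgebra.single (fun i => u (σ.symm i)) c := by
  simp [laurentPerm]

/-- The substitution `x_i ↦ q x_i`. -/
def laurentScale {q : K} (hq : q ≠ 0) (i : Fin n) : Laurent K n →ₐ[K] Laurent K n :=
  AddMonoidAlgebra.lift K (Laurent K n) (Fin n → ℤ)
    { toFun := fun u => AddMonoidAlgebra.single u.toAdd (q ^ (u.toAdd i))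
      map_one' := by
        rw [toAdd_one, Pi.zero_apply, zpow_zero]; rfl
      map_mul' := fun u v => by
        rw [AddMonoidAlgebra.single_mul_single, toAdd_mul, Pi.add_apply, zpow_add₀ hq] }

theorem laurentScale_single {q : K} (hq : q ≠ 0) (i : Fin n) (u : Fin n → ℤ) (c : K) :
    laurentScale hq i (AddMonoidAlgebra.single u c) = AddMonoidAlgebra.single u (c * q ^ u i) := by
  rw [laurentScale, AddMonoidAlgebra.lift_single]
  simp [AddMonoidAlgebra.smul_single]

theorem laurentInv_laurentInv (f : Laurent K n) : laurentInv K n (laurentInv K n f) = f := by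
  have : (laurentInv K n).comp (laurentInv K n) = AlgHom.id K _ :=
    laurent_algHom_ext fun u => by
      rw [AlgHom.comp_apply, lmono, laurentInv_single, laurentInv_single, neg_neg]; rfl
  exact DFunLike.congr_fun this f

theorem laurentScale_inv_scale {q : K} (hq : q ≠ 0) (i : Fin n) (f : Laurent K n) :
    laurentScale hq i (laurentInv K n (laurentScale hq i f)) = laurentInv K n f := by
  have : ((laurentScale hq i).comp (laurentInv K n)).comp (laurentScale hq i) = laurentInv K n :=
    laurent_algHom_ext fun u => by
      rw [AlgHom.comp_apply, AlgHom.comp_apply, lmono, laurentScale_single, laurentInv_single,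
        laurentScale_single, laurentInv_single, Pi.neg_apply, one_mul, ← zpow_add₀ hq,
        add_neg_cancel, zpow_zero]
  exact DFunLike.congr_fun this f

theorem constTerm_laurentInv (f : Laurent K n) :
    constTerm K n (laurentInv K n f) = constTerm K n f := by
  have : constTerm K n ∘ₗ (laurentInv K n).toLinearMap = constTerm K n :=
    laurent_linear_ext fun u => by
      rw [LinearMap.comp_apply, AlgHom.toLinearMap_apply, constTerm_lmono, lmono,
        laurentInv_single]
      exact (constTerm_lmono _).trans (by simp only [neg_eq_zero])
  exact DFunLike.congr_fun this f

theorem constTerm_laurentScale {q : K} (hq : q ≠ 0) (i : Fin n) (f : Laurent K n) :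
    constTerm K n (laurentScale hq i f) = constTerm K n f := by
  classical
  have : constTerm K n ∘ₗ (laurentScale hq i).toLinearMap = constTerm K n :=
    laurent_linear_ext fun u => by
      rw [LinearMap.comp_apply, AlgHom.toLinearMap_apply, lmono, laurentScale_single,
        constTerm_apply, constTerm_apply, AddMonoidAlgebra.coeff_single,
        AddMonoidAlgebra.coeff_single, Finsupp.single_apply, Finsupp.single_apply]
      split_ifs with h
      · rw [h, Pi.zero_apply, zpow_zero, mul_one]
      · rfl
  exact DFunLike.congr_fun this f

theorem coeff_laurentPerm (σ : Equiv.Perm (Fin n)) (f : Laurent K n) (u : Fin n → ℤ) :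
    (laurentPerm σ f).coeff (fun i => u (σ.symm i)) = f.coeff u := by
  classical
  induction f using AddMonoidAlgebra.induction_linear with
  | zero => rw [map_zero]; rfl
  | add f g hf hg => rw [map_add, AddMonoidAlgebra.coeff_add, Finsupp.add_apply, hf, hg]; rfl
  | single v c =>
    rw [laurentPerm_single, AddMonoidAlgebra.coeff_single, AddMonoidAlgebra.coeff_single,
      Finsupp.single_apply, Finsupp.single_apply]
    have : (fun i => v (σ.symm i)) = (fun i => u (σ.symm i)) ↔ v = u :=
      ⟨fun h => funext fun i => by simpa using congrFun h (σ i), fun h => by rw [h]⟩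
    simp only [this]

theorem laurentPerm_toLaurent (σ : Equiv.Perm (Fin n)) (F : MvPolynomial (Fin n) K) :
    laurentPerm σ (toLaurent K n F) = toLaurent K n (MvPolynomial.rename σ F) := by
  have : (laurentPerm σ).comp (toLaurent K n) =
      (toLaurent K n).comp (MvPolynomial.rename σ) := MvPolynomial.algHom_ext fun i => by
    rw [AlgHom.comp_apply, AlgHom.comp_apply, MvPolynomial.rename_X, toLaurent_X, toLaurent_X,
      lmono, laurentPerm_single, lmono]
    congr 1
    ext j
    simp [Pi.single_apply, Equiv.symm_apply_eq]
  exact DFunLike.congr_fun this F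

theorem laurentScale_toLaurent {q : K} (hq : q ≠ 0) (i : Fin n) (F : MvPolynomial (Fin n) K) :
    laurentScale hq i (toLaurent K n F) = toLaurent K n (qScale q i F) := by
  have : (laurentScale hq i).comp (toLaurent K n) = (toLaurent K n).comp (qScale q i) :=
    MvPolynomial.algHom_ext fun j => by
      rw [AlgHom.comp_apply, AlgHom.comp_apply, qScale, MvPolynomial.aeval_X, map_mul, toLaurent_X,
        MvPolynomial.C_eq_algebraMap, AlgHom.commutes, ← Algebra.smul_def, lmono,
        laurentScale_single, AddMonoidAlgebra.smul_single, smul_eq_mul, one_mul, mul_one,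
        Pi.single_apply]
      simp only [eq_comm (a := i)]
      split_ifs <;> simp
  exact DFunLike.congr_fun this F

theorem scalarPrime_eq (q : K) (β : ℕ) (f g : MvPolynomial (Fin n) K) :
    scalarPrime q β n f g = (n.factorial : K)⁻¹ *
      constTerm K n (laurentInv K n (toLaurent K n f) * toLaurent K n g * macDelta q β n) := by
  have : MvPolynomial.aeval (fun i : Fin n => lmono K (-Pi.single i 1)) =
      (laurentInv K n).comp (toLaurent K n) := MvPolynomial.algHom_ext fun i => by
    rw [AlgHom.comp_apply, toLaurent_X, lmono, laurentInv_single, MvPolynomial.aeval_X]; rfl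
  rw [scalarPrime, this]
  rfl

/-- `∏_{k<β} (1 - c q^k x^u)`. -/
def laurentPoch (q : K) (β : ℕ) (c : K) (u : Fin n → ℤ) : Laurent K n :=
  ∏ k ∈ Finset.range β, (1 - AddMonoidAlgebra.single u (c * q ^ k))

/-- The exponents of `x_i / x_j`. -/
def ratioExp (i j : Fin n) : Fin n → ℤ := Pi.single i 1 - Pi.single j 1

theorem neg_ratioExp (i j : Fin n) : -ratioExp i j = ratioExp j i := neg_sub _ _

theorem macDelta_eq (q : K) (β : ℕ) : macDelta q β n =
    ∏ i, ∏ j ∈ Finset.univ.erase i, laurentPoch q β 1 (ratioExp i j) := by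
  rw [macDelta]
  refine Finset.prod_congr rfl fun i _ => ?_
  rw [Finset.filter_ne']
  exact Finset.prod_congr rfl fun j _ => Finset.prod_congr rfl fun k _ => by rw [one_mul]; rfl

theorem laurentInv_poch (q : K) (β : ℕ) (c : K) (u : Fin n → ℤ) :
    laurentInv K n (laurentPoch q β c u) = laurentPoch q β c (-u) := by
  simp only [laurentPoch, map_prod, map_sub, map_one, laurentInv_single]

theorem laurentPerm_poch (σ : Equiv.Perm (Fin n)) (q : K) (β : ℕ) (c : K) (i j : Fin n) :
    laurentPerm σ (laurentPoch q β c (ratioExp i j)) =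
      laurentPoch q β c (ratioExp (σ i) (σ j)) := by
  have : (fun k => ratioExp i j (σ.symm k)) = ratioExp (σ i) (σ j) := by
    ext k
    simp [ratioExp, Pi.single_apply, Equiv.symm_apply_eq]
  simp only [laurentPoch, map_prod, map_sub, map_one, laurentPerm_single, this]

theorem laurentScale_poch {q : K} (hq : q ≠ 0) (β : ℕ) (c : K) (i : Fin n) (u : Fin n → ℤ) :
    laurentScale hq i (laurentPoch q β c u) = laurentPoch q β (c * q ^ u i) u := by
  simp only [laurentPoch, map_prod, map_sub, map_one, laurentScale_single]
  exact Finset.prod_congr rfl fun k _ => by congr 2; ring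

/-- With `y = x^u`, both sides are `(y;q)_{β+1}`, with the last or the first factor split off. -/
theorem laurentPoch_telescope (q : K) (β : ℕ) (u : Fin n → ℤ) :
    laurentPoch q β 1 u * (1 - AddMonoidAlgebra.single u (q ^ β)) =
      laurentPoch q β q u * (1 - AddMonoidAlgebra.single u 1) := by
  have h1 := Finset.prod_range_succ
    (fun k => (1 - AddMonoidAlgebra.single u (q ^ k) : Laurent K n)) β
  have h2 := Finset.prod_range_succ'
    (fun k => (1 - AddMonoidAlgebra.single u (q ^ k) : Laurent K n)) β
  rw [h1] at h2
  simp only [laurentPoch, one_mul, ← pow_succ']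
  simpa only [pow_zero] using h2

/-- The factor `(t x_i - x_j)/(x_i - x_j)` of the difference operator turns `(x_i/x_j;q)_β` into `(q
x_i/x_j;q)_β`. -/
theorem laurentPoch_mul (q : K) (β : ℕ) (i j : Fin n) :
    laurentPoch q β 1 (ratioExp i j) * toLaurent K n (MvPolynomial.C (q ^ β) * MvPolynomial.X i -
      MvPolynomial.X j) = laurentPoch q β q (ratioExp i j) *
        toLaurent K n (MvPolynomial.X i - MvPolynomial.X j) := by
  have h : ∀ c : K, toLaurent K n (MvPolynomial.C c * MvPolynomial.X i - MvPolynomial.X j) =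
      -lmono K (Pi.single j 1) * (1 - AddMonoidAlgebra.single (ratioExp i j) c) := by
    intro c
    rw [map_sub, map_mul, toLaurent_X, toLaurent_X, MvPolynomial.C_eq_algebraMap, AlgHom.commutes,
      ← Algebra.smul_def, mul_sub, mul_one, neg_mul, sub_neg_eq_add, lmono, lmono,
      AddMonoidAlgebra.single_mul_single, AddMonoidAlgebra.smul_single, ratioExp,
      add_sub_cancel, smul_eq_mul, mul_one, one_mul]
    abel
  have h1 := h 1
  rw [map_one, one_mul] at h1
  rw [h, h1]
  linear_combination (-lmono K (Pi.single j 1)) * laurentPoch_telescope q β (ratioExp i j)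

theorem prod_erase_comm {ι M : Type*} [DecidableEq ι] [CommMonoid M] (s : Finset ι)
    (f : ι → ι → M) : ∏ k ∈ s, ∏ l ∈ s.erase k, f k l = ∏ k ∈ s, ∏ l ∈ s.erase k, f l k :=
  Finset.prod_comm' fun k l => by
    simp only [Finset.mem_erase]
    tauto

/-- The part of the weight function that does not involve `x_i`. -/
def macRest (q : K) (β : ℕ) (i : Fin n) : Laurent K n :=
  ∏ k ∈ Finset.univ.erase i, ∏ l ∈ (Finset.univ.erase i).erase k, laurentPoch q β 1 (ratioExp k l)

theorem macDelta_split (q : K) (β : ℕ) (i : Fin n) : macDelta q β n =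
    (∏ j ∈ Finset.univ.erase i,
      (laurentPoch q β 1 (ratioExp i j) * laurentPoch q β 1 (ratioExp j i))) * macRest q β i := by
  rw [macDelta_eq, ← Finset.mul_prod_erase _ _ (Finset.mem_univ i), macRest,
    Finset.prod_mul_distrib, mul_assoc]
  refine congrArg _ ?_
  rw [← Finset.prod_mul_distrib]
  refine Finset.prod_congr rfl fun k hk => ?_
  rw [Finset.erase_right_comm]
  exact (Finset.mul_prod_erase _ (fun l => laurentPoch q β 1 (ratioExp k l))
    (Finset.mem_erase.mpr ⟨(Finset.ne_of_mem_erase hk).symm, Finset.mem_univ i⟩)).symm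

/-- The weight of the `i`-th term of the `q`-difference operator. -/
def macWeight (q : K) (β : ℕ) (i : Fin n) : Laurent K n :=
  (∏ j ∈ Finset.univ.erase i,
      (laurentPoch q β q (ratioExp i j) * laurentPoch q β 1 (ratioExp j i))) * macRest q β i

/-- The denominators of the difference operator are absorbed by the weight `Δ`, so each term
acquires a Laurent polynomial weight. -/
theorem toLaurent_diffNum_mul (q : K) (β : ℕ) (i : Fin n) :
    toLaurent K n (diffNum (q ^ β) i) * macDelta q β n =
      toLaurent K n (diffProd K n) * macWeight q β i := by
  rw [macDelta_split q β i, macWeight, ← mul_assoc, ← mul_assoc]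
  congr 1
  have hne : toLaurent K n (∏ j ∈ Finset.univ.erase i,
      (MvPolynomial.X i - MvPolynomial.X j)) ≠ 0 := by
    rw [Ne, map_eq_zero_iff _ toLaurent_injective, Finset.prod_eq_zero_iff]
    rintro ⟨j, hj, h⟩
    exact (Finset.ne_of_mem_erase hj) (MvPolynomial.X_injective (sub_eq_zero.mp h)).symm
  refine mul_right_cancel₀ hne ?_
  have h1 := congrArg (toLaurent K n) (diffNum_mul (q ^ β) i)
  rw [map_mul, map_mul (toLaurent K n) (diffNum _ _)] at h1
  have h2 : (∏ j ∈ Finset.univ.erase i,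
      (laurentPoch q β 1 (ratioExp i j) * laurentPoch q β 1 (ratioExp j i))) *
        toLaurent K n (∏ j ∈ Finset.univ.erase i,
          (MvPolynomial.C (q ^ β) * MvPolynomial.X i - MvPolynomial.X j)) =
      (∏ j ∈ Finset.univ.erase i,
      (laurentPoch q β q (ratioExp i j) * laurentPoch q β 1 (ratioExp j i))) *
        toLaurent K n (∏ j ∈ Finset.univ.erase i, (MvPolynomial.X i - MvPolynomial.X j)) := by
    rw [map_prod, map_prod, ← Finset.prod_mul_distrib, ← Finset.prod_mul_distrib]
    refine Finset.prod_congr rfl fun j _ => ?_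
    linear_combination laurentPoch q β 1 (ratioExp j i) * laurentPoch_mul q β i j
  linear_combination (-∏ j ∈ Finset.univ.erase i,
      (laurentPoch q β 1 (ratioExp i j) * laurentPoch q β 1 (ratioExp j i))) * h1 +
    toLaurent K n (diffProd K n) * h2

theorem laurentInv_macRest (q : K) (β : ℕ) (i : Fin n) :
    laurentInv K n (macRest q β i) = macRest q β i := by
  simp only [macRest, map_prod, laurentInv_poch, neg_ratioExp]
  exact (prod_erase_comm _ fun k l => laurentPoch q β 1 (ratioExp k l)).symm

theorem laurentInv_macDelta (q : K) (β : ℕ) :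
    laurentInv K n (macDelta q β n) = macDelta q β n := by
  simp only [macDelta_eq, map_prod, laurentInv_poch, neg_ratioExp]
  exact (prod_erase_comm _ fun k l => laurentPoch q β 1 (ratioExp k l)).symm

theorem laurentPerm_macDelta (σ : Equiv.Perm (Fin n)) (q : K) (β : ℕ) :
    laurentPerm σ (macDelta q β n) = macDelta q β n := by
  simp only [macDelta_eq, map_prod, laurentPerm_poch]
  rw [← Equiv.prod_comp σ fun i => ∏ j ∈ Finset.univ.erase i, laurentPoch q β 1 (ratioExp i j)]
  refine Finset.prod_congr rfl fun i _ => ?_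
  exact Finset.prod_equiv σ (by simp) fun _ _ => rfl

/-- Inversion followed by `x_i ↦ q x_i` exchanges `(q x_i/x_j;q)_β` with `(x_j/x_i;q)_β` and fixes
what does not involve `x_i`. This invariance makes each term of the operator self-adjoint. -/
theorem laurentScale_inv_macWeight {q : K} (hq : q ≠ 0) (β : ℕ) (i : Fin n) :
    laurentScale hq i (laurentInv K n (macWeight q β i)) = macWeight q β i := by
  have hr : laurentScale hq i (macRest q β i) = macRest q β i := by
    simp only [macRest, map_prod, laurentScale_poch]
    refine Finset.prod_congr rfl fun k hk => Finset.prod_congr rfl fun l hl => ?_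
    have h1 := Finset.ne_of_mem_erase hk
    have h2 := Finset.ne_of_mem_erase (Finset.mem_of_mem_erase hl)
    have : ratioExp k l i = 0 := by
      simp [ratioExp, h1.symm, h2.symm]
    rw [this, zpow_zero, mul_one]
  rw [macWeight, map_mul, map_mul, laurentInv_macRest, hr]
  congr 1
  simp only [map_prod, map_mul, laurentInv_poch, laurentScale_poch, neg_ratioExp]
  refine Finset.prod_congr rfl fun j hj => ?_
  have h1 := Finset.ne_of_mem_erase hj
  have e1 : ratioExp j i i = -1 := by simp [ratioExp, h1.symm]
  have e2 : ratioExp i j i = 1 := by simp [ratioExp, h1.symm]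
  rw [e1, e2, zpow_neg_one, mul_inv_cancel₀ hq, zpow_one, one_mul, mul_comm]

theorem IsEigen.toLaurent {q e : K} (hq : q ≠ 0) {β : ℕ} {G : MvPolynomial (Fin n) K}
    (h : IsEigen q (q ^ β) e G) : e • (MacBoson.toLaurent K n G * macDelta q β n) =
      ∑ i, macWeight q β i * laurentScale hq i (MacBoson.toLaurent K n G) := by
  have hne : MacBoson.toLaurent K n (diffProd K n) ≠ 0 := by
    rw [Ne, map_eq_zero_iff _ toLaurent_injective, diffProd, Finset.prod_eq_zero_iff]
    rintro ⟨i, -, h⟩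
    obtain ⟨j, hj, h⟩ := Finset.prod_eq_zero_iff.mp h
    exact (Finset.ne_of_mem_erase hj) (MvPolynomial.X_injective (sub_eq_zero.mp h)).symm
  refine mul_left_cancel₀ hne ?_
  have h1 := congrArg (MacBoson.toLaurent K n) h
  rw [map_mul, map_mul, map_sum, MvPolynomial.C_eq_algebraMap, AlgHom.commutes,
    ← Algebra.smul_def] at h1
  rw [mul_smul_comm, ← mul_assoc, ← smul_mul_assoc, h1, Finset.sum_mul, Finset.mul_sum]
  refine Finset.sum_congr rfl fun i _ => ?_
  rw [map_mul, laurentScale_toLaurent]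
  linear_combination MacBoson.toLaurent K n (qScale q i G) * toLaurent_diffNum_mul q β i

/-- Eigenvectors with different eigenvalues are orthogonal. -/
theorem scalarPrime_eq_zero {q e e' : K} (hq : q ≠ 0) {β : ℕ} {F G : MvPolynomial (Fin n) K}
    (hF : IsEigen q (q ^ β) e F) (hG : IsEigen q (q ^ β) e' G) (hne : e ≠ e') :
    scalarPrime q β n F G = 0 := by
  rw [scalarPrime_eq]
  set f := toLaurent K n F
  set g := toLaurent K n G
  -- The constant term is invariant under inversion and under `x_i ↦ q x_i`. Applying both to the
  -- `i`-th term keeps its weight and moves the scaling from `g` to `f`.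
  have h1 : constTerm K n (laurentInv K n f * (e' • (g * macDelta q β n))) =
      constTerm K n (laurentInv K n (laurentInv K n g * (e • (f * macDelta q β n)))) := by
    rw [constTerm_laurentInv, hF.toLaurent hq, hG.toLaurent hq, Finset.mul_sum, Finset.mul_sum,
      map_sum, map_sum]
    refine Finset.sum_congr rfl fun i _ => ?_
    rw [← constTerm_laurentInv, ← constTerm_laurentScale hq i]
    simp only [map_mul, laurentInv_laurentInv, laurentScale_inv_macWeight, laurentScale_inv_scale]
    congr 1
    ring
  simp only [map_mul, map_smul, laurentInv_laurentInv, laurentInv_macDelta, mul_smul_comm,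
    smul_eq_mul] at h1
  have h2 : (e' - e) * constTerm K n (laurentInv K n f * g * macDelta q β n) = 0 := by
    rw [sub_mul, mul_assoc, h1, mul_left_comm, sub_self]
  rw [(mul_eq_zero.mp h2).resolve_left (sub_ne_zero.mpr hne.symm), mul_zero]

/-- Laurent polynomials form a domain, and each factor has constant coefficient 1 because `x_i/x_j`
is not constant. -/
theorem macDelta_ne_zero {q : K} (β : ℕ) : macDelta q β n ≠ 0 := by
  classical
  rw [macDelta_eq, Finset.prod_ne_zero_iff]
  intro i _
  rw [Finset.prod_ne_zero_iff]
  intro j hj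
  rw [laurentPoch, Finset.prod_ne_zero_iff]
  intro k _ h
  have h1 := congrArg (fun f => f.coeff 0) h
  have hu : ratioExp i j ≠ 0 := fun h => by
    have := congrFun h i
    simp [ratioExp, (Finset.ne_of_mem_erase hj).symm] at this
  simp only [AddMonoidAlgebra.coeff_sub, Finsupp.sub_apply, AddMonoidAlgebra.one_def,
    AddMonoidAlgebra.coeff_single, Finsupp.single_apply, if_true, hu, if_false, sub_zero] at h1
  exact one_ne_zero h1

end Laurent

/-! ### Macdonald polynomials in finitely many variables and their constant term norms -/

section MacdonaldNorm
variable {K : Type*} [Field K] [CharZero K] {q : K} {β : ℕ} {n : ℕ}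

omit [CharZero K] in
theorem eigVal_add_const {t : K} {α γ : Fin n →₀ ℕ} {s : ℕ} (h : ∀ i, α i = γ i + s) :
    eigVal q t α = q ^ s * eigVal q t γ := by
  rw [eigVal, eigVal, Finset.mul_sum]
  exact Finset.sum_congr rfl fun i _ => by rw [h]; ring

/-- The product of all variables. -/
abbrev varProd (K : Type*) [Field K] (n : ℕ) : MvPolynomial (Fin n) K := ∏ i, MvPolynomial.X i

omit [CharZero K] in
theorem qScale_varProd (q : K) (i : Fin n) :
    qScale q i (varProd K n) = MvPolynomial.C q * varProd K n := by
  simp only [varProd, map_prod, qScale, MvPolynomial.aeval_X, Finset.prod_mul_distrib]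
  congr 1
  rw [← map_prod, Finset.prod_ite_eq' Finset.univ i]
  simp

omit [CharZero K] in
theorem IsEigen.varProd_mul {t e : K} {G : MvPolynomial (Fin n) K} (h : IsEigen q t e G) (s : ℕ) :
    IsEigen q t (q ^ s * e) (varProd K n ^ s * G) := by
  unfold IsEigen at h ⊢
  simp only [map_mul, map_pow, qScale_varProd, mul_pow]
  have e1 : ∀ i, diffNum t i * (MvPolynomial.C q ^ s * varProd K n ^ s * qScale q i G) =
      MvPolynomial.C q ^ s * varProd K n ^ s * (diffNum t i * qScale q i G) := fun i => by ring
  rw [Finset.sum_congr rfl fun i _ => e1 i, ← Finset.mul_sum, ← h]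
  ring

omit [CharZero K] in
theorem IsEigen.sub {t e : K} {F G : MvPolynomial (Fin n) K} (hF : IsEigen q t e F)
    (hG : IsEigen q t e G) : IsEigen q t e (F - G) := by
  unfold IsEigen at hF hG ⊢
  simp only [map_sub, mul_sub, Finset.sum_sub_distrib]
  rw [hF, hG]

omit [CharZero K] in
theorem varProd_pow (s : ℕ) : varProd K n ^ s =
    MvPolynomial.monomial (Finsupp.equivFunOnFinite.symm fun _ => s) 1 := by
  rw [MvPolynomial.monomial_eq, map_one, one_mul, Finsupp.prod_fintype _ _ (by simp),
    ← Finset.prod_pow]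
  rfl

/-- Adding columns of length `n` to a diagram multiplies the Macdonald polynomial in `n` variables
by a power of the product of the variables. -/
theorem toVars_macP_add_const (hq : Transcendental ℚ q) (hβ : 0 < β) {d e s : ℕ}
    {lam : d.Partition} {mu : e.Partition} (hl : lam.parts.card ≤ n) (hm : mu.parts.card ≤ n)
    (h : ∀ i, partExp n lam i = partExp n mu i + s) :
    toVars n (macP q β lam) = varProd K n ^ s * toVars n (macP q β mu) := by
  refine sub_eq_zero.mp ?_
  by_contra hne
  have h1 := (isEigen_macP hq hβ hm).varProd_mul s
  rw [← eigVal_add_const h] at h1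
  have hsym : (toVars n (macP q β lam) - varProd K n ^ s * toVars n (macP q β mu)).IsSymmetric := by
    refine (toVars_isSymmetric _).sub (MvPolynomial.IsSymmetric.mul ?_ (toVars_isSymmetric _))
    intro σ
    rw [map_pow, varProd, map_prod]
    simp only [MvPolynomial.rename_X]
    rw [Equiv.prod_comp σ fun i => (MvPolynomial.X i : MvPolynomial (Fin n) K)]
  -- The difference is a symmetric eigenfunction for the eigenvalue of `λ`. If nonzero, its maximal
  -- exponent would be that of `λ`, where both terms have coefficient 1.
  obtain ⟨α, hα, hc, he⟩ := eigen_exponent ((isEigen_macP hq hβ hl).sub h1) hsym hne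
  have := eigVal_injective hq hβ (sortedExp_antitone _) hα he
  rw [← this, MvPolynomial.coeff_sub, coeff_toVars_macP hq hβ hl, varProd_pow] at hc
  have e1 : sortedExp n lam.parts = (Finsupp.equivFunOnFinite.symm fun _ => s) + partExp n mu := by
    ext i
    rw [h, add_comm]; rfl
  rw [e1, MvPolynomial.coeff_monomial_mul, coeff_toVars_macP hq hβ hm, one_mul, sub_self] at hc
  exact hc rfl

theorem scalarPrime_macP (hq : Transcendental ℚ q) (hβ : 0 < β) {d e : ℕ} {lam : d.Partition}
    {mu : e.Partition} (h : lam.parts ≠ mu.parts) :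
    scalarPrime q β n (toVars n (macP q β lam)) (toVars n (macP q β mu)) = 0 := by
  rcases lt_or_ge n lam.parts.card with hl | hl
  · rw [toVars_macP_eq_zero hq hβ hl, scalarPrime_eq, map_zero, map_zero, zero_mul, zero_mul,
      map_zero, mul_zero]
  rcases lt_or_ge n mu.parts.card with hm | hm
  · rw [toVars_macP_eq_zero hq hβ hm, scalarPrime_eq, map_zero, mul_zero, zero_mul,
      map_zero, mul_zero]
  refine scalarPrime_eq_zero (ne_zero_of_transcendental hq) (isEigen_macP hq hβ hl)
    (isEigen_macP hq hβ hm) fun he => h ?_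
  exact (shape_partExp hl).symm.trans ((congrArg shape (eigVal_injective hq hβ
    (sortedExp_antitone _) (sortedExp_antitone _) he)).trans (shape_partExp hm))

variable (q β n) in
/-- The functional `f ↦ n! ⟨f, g⟩'_n`. -/
def primeForm (g : MvPolynomial (Fin n) K) : SymFun K →ₗ[K] K :=
  constTerm K n ∘ₗ (LinearMap.mulRight K (toLaurent K n g * macDelta q β n)) ∘ₗ
    ((laurentInv K n).comp ((toLaurent K n).comp (toVars n))).toLinearMap

omit [CharZero K] in
theorem primeForm_apply (g : MvPolynomial (Fin n) K) (f : SymFun K) : primeForm q β n g f =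
    constTerm K n (laurentInv K n (toLaurent K n (toVars n f)) *
      (toLaurent K n g * macDelta q β n)) := rfl

theorem primeForm_eq (g : MvPolynomial (Fin n) K) (f : SymFun K) :
    primeForm q β n g f = (n.factorial : K) * scalarPrime q β n (toVars n f) g := by
  rw [scalarPrime_eq, mul_inv_cancel_left₀ (Nat.cast_ne_zero.mpr n.factorial_ne_zero), mul_assoc,
    primeForm_apply]

/-- Two functionals that vanish on all Macdonald functions except `P_λ` are proportional, with the
ratio read off at `P_λ`. Here the two orthogonalities meet and the factors of `C⁺` appear. -/
theorem scalarForm_smul_primeForm (hq : Transcendental ℚ q) (hβ : 0 < β) {d : ℕ}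
    (lam : d.Partition) (f : SymFun K) :
    scalarForm q (q ^ β) (macP q β lam) (macP q β lam) *
        primeForm q β n (toVars n (macP q β lam)) f =
      (n.factorial : K) * scalarPrime q β n (toVars n (macP q β lam)) (toVars n (macP q β lam)) *
        scalarForm q (q ^ β) f (macP q β lam) := by
  set P := macP q β lam
  have h : (scalarForm q (q ^ β) P P • primeForm q β n (toVars n P) : SymFun K →ₗ[K] K) =
      ((n.factorial : K) * scalarPrime q β n (toVars n P) (toVars n P)) •
        (scalarForm q (q ^ β)).flip P := by
    refine LinearMap.ext_on (span_macP hq hβ) ?_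
    rintro _ ⟨⟨e, mu⟩, rfl⟩
    simp only [LinearMap.smul_apply, LinearMap.flip_apply, smul_eq_mul, primeForm_eq]
    by_cases hp : mu.parts = lam.parts
    · cases sigma_eq_of_parts hp
      ring
    · rw [scalarPrime_macP hq hβ hp, scalarForm_macP hq hβ hp, mul_zero, mul_zero, mul_zero]
  exact DFunLike.congr_fun h f

omit [CharZero K] in
theorem exists_perm_of_shape {α γ : Fin n →₀ ℕ} (h : shape α = shape γ) :
    ∃ σ : Equiv.Perm (Fin n), ∀ i, γ i = α (σ i) := by
  have key : ∀ α : Fin n →₀ ℕ, ∃ σ : Equiv.Perm (Fin n),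
      ∀ i, sortedExp n (shape α) i = α (σ i) := by
    intro α
    let σ := Tuple.sort (fun i => OrderDual.toDual (α i))
    let γ : Fin n →₀ ℕ := Finsupp.equivFunOnFinite.symm fun i => α (σ i)
    have hγ : Antitone γ := fun i j h =>
      Tuple.monotone_sort (fun i => OrderDual.toDual (α i)) h
    have hsh : shape γ = shape α := by
      have h : Finset.univ.val.map γ = (Finset.univ.val.map σ).map α := by
        rw [Multiset.map_map]; rfl
      have h2 := congrArg Finset.val (Finset.univ_map_equiv_to_embedding σ)
      have h2 : Finset.univ.val.map σ = Finset.univ.val := h2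
      rw [shape, h, h2, shape]
    have e : sortedExp n (shape α) = γ := by
      refine eq_of_antitone_of_shape (sortedExp_antitone _) hγ ?_
      rw [shape_sortedExp (card_shape_le α) (zero_notMem_shape α), hsh]
    exact ⟨σ, fun i => by rw [e]; rfl⟩
  obtain ⟨σ, hσ⟩ := key α
  obtain ⟨τ, hτ⟩ := key γ
  rw [← h] at hτ
  refine ⟨τ.symm.trans σ, fun i => ?_⟩
  rw [Equiv.trans_apply, ← hσ, hτ, Equiv.apply_symm_apply]

omit [CharZero K] in
theorem constTerm_inv_mul (F : MvPolynomial (Fin n) K) (g : Laurent K n) :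
    constTerm K n (laurentInv K n (toLaurent K n F) * g) =
      ∑ α ∈ F.support, F.coeff α * g.coeff (intExp α) := by
  conv_lhs => rw [F.as_sum]
  simp only [map_sum, Finset.sum_mul]
  refine Finset.sum_congr rfl fun α _ => ?_
  rw [toLaurent_monomial, laurentInv_single, constTerm_apply,
    AddMonoidAlgebra.coeff_single_mul_apply]
  simp

/-- If the norm vanished, `P_λ` and all its multiples by powers of `∏ x_i` would be orthogonal to
every symmetric polynomial. But `P_λ Δ` is a nonzero symmetric Laurent polynomial, and one of its
coefficients is detected by a monomial function. -/
theorem scalarPrime_macP_self_ne_zero (hq : Transcendental ℚ q) (hβ : 0 < β) {d : ℕ}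
    {lam : d.Partition} (hl : lam.parts.card ≤ n) :
    scalarPrime q β n (toVars n (macP q β lam)) (toVars n (macP q β lam)) ≠ 0 := by
  classical
  intro h0
  set g := toLaurent K n (toVars n (macP q β lam)) * macDelta q β n
  have hP : toVars n (macP q β lam) ≠ 0 := fun h => by
    have := coeff_toVars_macP hq hβ hl
    rw [h, MvPolynomial.coeff_zero] at this
    exact zero_ne_one this
  have hg : g ≠ 0 := mul_ne_zero
    (by rwa [Ne, map_eq_zero_iff _ toLaurent_injective]) (macDelta_ne_zero β)
  have hgperm : ∀ (σ : Equiv.Perm (Fin n)) u, g.coeff (fun i => u (σ i)) = g.coeff u := by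
    intro σ u
    have h := coeff_laurentPerm σ.symm g u
    rw [map_mul, laurentPerm_toLaurent, laurentPerm_macDelta, toVars_isSymmetric] at h
    simpa using h
  obtain ⟨u, hu⟩ : ∃ u, g.coeff u ≠ 0 := by
    by_contra! h
    exact hg (by ext u; exact h u)
  obtain ⟨s, hs⟩ : ∃ s : ℕ, ∀ i, 0 ≤ u i + s := by
    refine ⟨∑ i, (u i).natAbs, fun i => ?_⟩
    have := Finset.single_le_sum (f := fun i => (u i).natAbs) (fun _ _ => Nat.zero_le _)
      (Finset.mem_univ i)
    omega
  -- Multiplication by the `s`-th power of all variables adds `s` to every row. It preserves the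
  -- norm and makes the chosen exponent `u` nonnegative.
  let ε : Fin n →₀ ℕ := Finsupp.equivFunOnFinite.symm fun i => partExp n lam i + s
  have hε : Antitone ε := fun i j h =>
    Nat.add_le_add_right (sortedExp_antitone lam.parts h) s
  let mu : (shape ε).sum.Partition := ⟨shape ε, fun {i} hi => Nat.pos_of_ne_zero fun h =>
      zero_notMem_shape ε (h ▸ hi), rfl⟩
  have hmu : mu.parts.card ≤ n := card_shape_le ε
  have hpm : partExp n mu = ε := eq_of_antitone_of_shape (sortedExp_antitone _) hε
    (shape_partExp hmu)
  have hmul : toVars n (macP q β mu) = varProd K n ^ s * toVars n (macP q β lam) :=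
    toVars_macP_add_const hq hβ hmu hl fun i => by rw [hpm]; rfl
  have hmono : toLaurent K n (varProd K n ^ s) = lmono K fun _ => (s : ℤ) := by
    rw [varProd_pow, toLaurent_monomial]; rfl
  have hinv : laurentInv K n (lmono K fun _ : Fin n => (s : ℤ)) *
      lmono K (fun _ => (s : ℤ)) = 1 := by
    rw [lmono, laurentInv_single]
    exact (lmono_mul _ _).trans (by rw [neg_add_cancel, lmono_zero])
  have hz : scalarPrime q β n (toVars n (macP q β mu)) (toVars n (macP q β mu)) = 0 := by
    rw [← h0, scalarPrime_eq, scalarPrime_eq, hmul]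
    congr 2
    rw [map_mul, map_mul, hmono]
    linear_combination laurentInv K n (toLaurent K n (toVars n (macP q β lam))) *
      toLaurent K n (toVars n (macP q β lam)) * macDelta q β n * hinv
  have hvan : ∀ f : SymFun K, primeForm q β n (toVars n (macP q β mu)) f = 0 := by
    intro f
    have h := scalarForm_smul_primeForm (n := n) hq hβ mu f
    rw [hz, mul_zero, zero_mul] at h
    exact (mul_eq_zero.mp h).resolve_left (scalarForm_macP_self_ne_zero hq hβ mu)
  let α : Fin n →₀ ℕ := Finsupp.equivFunOnFinite.symm fun i => (u i + s).toNat
  have hα : ∀ i, (α i : ℤ) = u i + s := fun i => Int.toNat_of_nonneg (hs i)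
  let nu : (shape α).sum.Partition := ⟨shape α, fun {i} hi => Nat.pos_of_ne_zero fun h =>
      zero_notMem_shape α (h ▸ hi), rfl⟩
  have h := hvan (monSym K nu)
  rw [primeForm_apply, hmul, map_mul (toLaurent K n), hmono, constTerm_inv_mul] at h
  -- All monomials of `m_ν` contribute the same coefficient by symmetry, so the pairing is the orbit
  -- size times `g.coeff u`.
  have hco : ∀ γ ∈ (toVars n (monSym K nu)).support, (toVars n (monSym K nu)).coeff γ *
      (lmono K (fun _ => (s : ℤ)) * toLaurent K n (toVars n (macP q β lam)) *
        macDelta q β n).coeff (intExp γ) = g.coeff u := by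
    intro γ hγ
    rw [MvPolynomial.mem_support_iff, isCoeffFun_monSym] at hγ
    have hsh : shape γ = shape α := by
      by_contra hne
      exact hγ (if_neg hne)
    rw [isCoeffFun_monSym]
    simp only [hsh]
    rw [if_pos rfl, one_mul, mul_assoc, lmono, AddMonoidAlgebra.coeff_single_mul_apply, one_mul]
    obtain ⟨σ, hσ⟩ := exists_perm_of_shape hsh.symm
    rw [← hgperm σ u]
    congr 1
    ext i
    have := hα (σ i)
    simp only [Pi.add_apply, Pi.neg_apply, intExp, hσ]
    omega
  rw [Finset.sum_congr rfl hco, Finset.sum_const, nsmul_eq_mul] at h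
  rcases mul_eq_zero.mp h with h | h
  · rw [Nat.cast_eq_zero, Finset.card_eq_zero, MvPolynomial.support_eq_empty] at h
    have h1 := isCoeffFun_monSym (K := K) nu n α
    rw [h, MvPolynomial.coeff_zero] at h1
    exact zero_ne_one (h1.trans (if_pos rfl))
  · exact hu h

end MacdonaldNorm

/-! ### Laurent polynomials with coefficients in a polynomial ring -/

section LaurentOver
variable {R : Type*} [CommRing R] {r : ℕ}

/-- Laurent polynomials in `z_1, …, z_r` over a commutative ring. -/
abbrev LaurentOver (R : Type*) [CommRing R] (r : ℕ) : Type _ := AddMonoidAlgebra R (Fin r → ℤ)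

/-- Prefixing an exponent vector by zero. -/
def consZero (r : ℕ) : (Fin r → ℤ) →+ (Fin (r + 1) → ℤ) where
  toFun u := Fin.cons (α := fun _ => ℤ) 0 u
  map_zero' := by ext i; refine Fin.cases rfl (fun _ => rfl) i
  map_add' u v := by ext i; refine Fin.cases rfl (fun _ => rfl) i

theorem consZero_zero (u : Fin r → ℤ) : consZero r u 0 = 0 := rfl

theorem consZero_succ (u : Fin r → ℤ) (j : Fin r) : consZero r u j.succ = u j := rfl

theorem consZero_single (j : Fin r) (k : ℤ) :
    consZero r (Pi.single j k) = Pi.single j.succ k := by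
  ext i
  refine Fin.cases ?_ (fun i => ?_) i
  · simp [consZero_zero]
  · simp [consZero_succ, Pi.single_apply]

variable (R r) in
/-- Adding a new first variable. -/
def addVar : LaurentOver R r →+* LaurentOver R (r + 1) :=
  AddMonoidAlgebra.mapDomainRingHom R (consZero r)

theorem addVar_single (u : Fin r → ℤ) (c : R) :
    addVar R r (AddMonoidAlgebra.single u c) = AddMonoidAlgebra.single (consZero r u) c := by
  simp [addVar]

variable (R r) in
/-- The powers of the new variable. -/
def newVar (k : ℤ) : LaurentOver R (r + 1) := AddMonoidAlgebra.single (Pi.single 0 k) 1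

theorem newVar_mul (k l : ℤ) : newVar R r k * newVar R r l = newVar R r (k + l) := by
  rw [newVar, newVar, newVar, AddMonoidAlgebra.single_mul_single, one_mul, ← Pi.single_add]

theorem newVar_pow (k : ℤ) (l : ℕ) : newVar R r k ^ l = newVar R r (l * k) := by
  rw [newVar, newVar, AddMonoidAlgebra.single_pow, one_pow, ← Pi.single_smul, nsmul_eq_mul]

/-- The functional `z^u ↦ ∏_j h_{-u_j}`. -/
def evalModes (h : ℤ → R) (r : ℕ) : LaurentOver R r →ₗ[R] R where
  toFun f := Finsupp.linearCombination R (fun u : Fin r → ℤ => ∏ j, h (-u j)) f.coeff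
  map_add' f g := by rw [AddMonoidAlgebra.coeff_add, map_add]
  map_smul' c f := by rw [AddMonoidAlgebra.coeff_smul, map_smul, RingHom.id_apply]

theorem evalModes_single (h : ℤ → R) (u : Fin r → ℤ) (c : R) :
    evalModes h r (AddMonoidAlgebra.single u c) = c * ∏ j, h (-u j) := by
  change Finsupp.linearCombination R _ (Finsupp.single u c) = _
  rw [Finsupp.linearCombination_single, smul_eq_mul]

/-- With `H(z) = ∑ h_k z^k`, `evalModes` is the constant term of `F ∏ H(z_j)`; here the constant
term in the new variable is taken separately. -/
theorem evalModes_addVar_mul (h : ℤ → R) (F : LaurentOver R r) (k : ℤ) :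
    evalModes h (r + 1) (addVar R r F * newVar R r k) = evalModes h r F * h (-k) := by
  induction F using AddMonoidAlgebra.induction_linear with
  | zero => simp
  | add F G hF hG => rw [map_add, add_mul, map_add, hF, hG, map_add, add_mul]
  | single u c =>
    rw [addVar_single, newVar, AddMonoidAlgebra.single_mul_single, mul_one, evalModes_single,
      evalModes_single, Fin.prod_univ_succ]
    simp only [Pi.add_apply, consZero_zero, consZero_succ, Pi.single_eq_same, zero_add,
      Pi.single_eq_of_ne (Fin.succ_ne_zero _), add_zero]
    ring

theorem evalModes_map {S : Type*} [CommRing S] (φ : R →+* S) (h : ℤ → R) (F : LaurentOver R r) :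
    φ (evalModes h r F) = evalModes (fun k => φ (h k)) r
      (AddMonoidAlgebra.mapRingHom (Fin r → ℤ) φ F) := by
  induction F using AddMonoidAlgebra.induction_linear with
  | zero => simp
  | add F G hF hG => rw [map_add, map_add, hF, hG, map_add, map_add]
  | single u c =>
    rw [AddMonoidAlgebra.mapRingHom_single, evalModes_single, evalModes_single, map_mul, map_prod]

/-- The coefficients of a power series, extended by zero to negative indices. -/
def intCoeff (H : PowerSeries R) (k : ℤ) : R :=
  if 0 ≤ k then PowerSeries.coeff k.toNat H else 0

theorem intCoeff_natCast (H : PowerSeries R) (k : ℕ) :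
    intCoeff H (k : ℤ) = PowerSeries.coeff k H := by
  rw [intCoeff, if_pos (Int.natCast_nonneg k), Int.toNat_natCast]

theorem intCoeff_of_neg (H : PowerSeries R) {k : ℤ} (hk : k < 0) : intCoeff H k = 0 :=
  if_neg (not_le.mpr hk)

theorem map_intCoeff {S : Type*} [CommRing S] (φ : R →+* S) (H : PowerSeries R) (k : ℤ) :
    φ (intCoeff H k) = intCoeff (PowerSeries.map φ H) k := by
  rw [intCoeff, intCoeff]
  split_ifs
  · rw [PowerSeries.coeff_map]
  · exact map_zero φ

/-- The coefficients of the product of a polynomial and a power series. -/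
theorem intCoeff_polynomial_mul (P : Polynomial R) (H : PowerSeries R) (k : ℤ) :
    intCoeff ((P : PowerSeries R) * H) k =
      ∑ i ∈ Finset.range (P.natDegree + 1), P.coeff i * intCoeff H (k - i) := by
  rcases lt_or_ge k 0 with hk | hk
  · rw [intCoeff_of_neg _ hk, eq_comm]
    exact Finset.sum_eq_zero fun i _ => by rw [intCoeff_of_neg _ (by omega), mul_zero]
  · obtain ⟨m, rfl⟩ := Int.eq_ofNat_of_zero_le hk
    rw [intCoeff_natCast, PowerSeries.coeff_mul,
      Finset.Nat.sum_antidiagonal_eq_sum_range_succ (fun i j =>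
        PowerSeries.coeff i (P : PowerSeries R) * PowerSeries.coeff j H)]
    set N := max m P.natDegree + 1
    have h1 : ∑ i ∈ Finset.range m.succ, PowerSeries.coeff i (P : PowerSeries R) *
        PowerSeries.coeff (m - i) H = ∑ i ∈ Finset.range N, P.coeff i * intCoeff H ((m : ℤ) - i) := by
      rw [← Finset.sum_subset (Finset.range_mono (show m.succ ≤ N by omega)) fun i _ hi => by
        rw [intCoeff_of_neg _ (by simp at hi; omega), mul_zero]]
      refine Finset.sum_congr rfl fun i hi => ?_
      have hi : i ≤ m := by simp at hi; omega
      rw [Polynomial.coeff_coe, ← Nat.cast_sub hi, intCoeff_natCast]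
    rw [h1]
    refine (Finset.sum_subset (Finset.range_mono (show P.natDegree + 1 ≤ N by omega))
      fun i _ hi => ?_).symm
    rw [Polynomial.coeff_eq_zero_of_natDegree_lt (by simp at hi; omega), zero_mul]

end LaurentOver

/-! ### Moving vertex operators through creation operators -/

section Move
variable {K σ : Type*} [Field K] (w : σ → ℕ) (s : σ → K)

/-- The homomorphism `x_i ↦ x_i + s_i ∑_j z_j^{-w_i}`. -/
def moveHom (r : ℕ) : MvPolynomial σ K →ₐ[K] LaurentOver (MvPolynomial σ K) r :=
  MvPolynomial.aeval fun i => AddMonoidAlgebra.single 0 (MvPolynomial.X i) +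
    ∑ j : Fin r, AddMonoidAlgebra.single (Pi.single j (-(w i : ℤ))) (MvPolynomial.C (s i))

theorem moveHom_X (r : ℕ) (i : σ) : moveHom w s r (MvPolynomial.X i) =
    AddMonoidAlgebra.single 0 (MvPolynomial.X i) +
    ∑ j : Fin r, AddMonoidAlgebra.single (Pi.single j (-(w i : ℤ))) (MvPolynomial.C (s i)) :=
  MvPolynomial.aeval_X _ _

theorem moveHom_C (r : ℕ) (c : K) : moveHom w s r (MvPolynomial.C c) =
    AddMonoidAlgebra.single 0 (MvPolynomial.C c) := by
  rw [← MvPolynomial.algebraMap_eq, AlgHom.commutes]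
  rfl

/-- The shifts by different variables commute, so the one belonging to the new variable can be
applied first. -/
theorem moveHom_succ (r : ℕ) (p : MvPolynomial σ K) : moveHom w s (r + 1) p =
    ∑ l ∈ Finset.range ((shiftHom w s p).natDegree + 1),
      addVar _ r (moveHom w s r ((shiftHom w s p).coeff l)) * newVar _ r (-(l : ℤ)) := by
  have h : (moveHom w s (r + 1)).toRingHom = (Polynomial.eval₂RingHom
      ((addVar (MvPolynomial σ K) r).comp (moveHom w s r).toRingHom) (newVar _ r (-1))).comp
        (shiftHom w s).toRingHom := by
    refine MvPolynomial.ringHom_ext (fun c => ?_) fun i => ?_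
    · have : shiftHom w s (MvPolynomial.C c) = Polynomial.C (MvPolynomial.C c) := by
        rw [← MvPolynomial.algebraMap_eq, AlgHom.commutes]; rfl
      simp only [AlgHom.toRingHom_eq_coe, RingHom.coe_coe, RingHom.comp_apply, this,
        Polynomial.coe_eval₂RingHom, Polynomial.eval₂_C, moveHom_C, addVar_single, map_zero]
    · simp only [AlgHom.toRingHom_eq_coe, RingHom.coe_coe, RingHom.comp_apply, shiftHom_X,
        Polynomial.coe_eval₂RingHom, Polynomial.eval₂_mul,
        Polynomial.eval₂_C, Polynomial.eval₂_X_pow, moveHom_C, moveHom_X, map_add, map_sum,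
        addVar_single, map_zero, newVar_pow, consZero_single]
      rw [Fin.sum_univ_succ, newVar, AddMonoidAlgebra.single_mul_single]
      simp only [zero_add, mul_one, mul_neg]
      abel
  have h2 := DFunLike.congr_fun h p
  simp only [AlgHom.toRingHom_eq_coe, RingHom.coe_coe, RingHom.comp_apply,
    Polynomial.coe_eval₂RingHom] at h2
  rw [h2, Polynomial.eval₂_eq_sum_range]
  refine Finset.sum_congr rfl fun l _ => ?_
  rw [newVar_pow, mul_neg, mul_one]
  rfl

variable (σ) in
/-- Scalar Laurent polynomials. -/
def scalarLaurent (r : ℕ) : Laurent K r →+* LaurentOver (MvPolynomial σ K) r :=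
  AddMonoidAlgebra.mapRingHom (Fin r → ℤ) MvPolynomial.C

theorem scalarLaurent_single {r : ℕ} (u : Fin r → ℤ) (c : K) :
    scalarLaurent σ r (AddMonoidAlgebra.single u c) =
      AddMonoidAlgebra.single u (MvPolynomial.C c) :=
  AddMonoidAlgebra.mapRingHom_single _ _ _

theorem addVar_scalarLaurent {r : ℕ} (F : Laurent K r) :
    addVar _ r (scalarLaurent σ r F) = scalarLaurent σ (r + 1) (addVar K r F) := by
  induction F using AddMonoidAlgebra.induction_linear with
  | zero => simp
  | add F G hF hG => simp only [map_add, hF, hG]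
  | single u c => simp only [scalarLaurent_single, addVar_single]

/-- `∏_j ∏_{k<β} (1 - q^k Y/z_j) (1 - q^{-k} Y/z_j)` as a polynomial in `Y`. -/
def pairPoly (σ : Type*) (q : K) (β r : ℕ) : Polynomial (LaurentOver (MvPolynomial σ K) r) :=
  ∏ j : Fin r, ∏ k ∈ Finset.range β,
    ((1 - Polynomial.C (AddMonoidAlgebra.single (Pi.single j (-1)) (MvPolynomial.C (q ^ k))) *
        Polynomial.X) *
      (1 - Polynomial.C (AddMonoidAlgebra.single (Pi.single j (-1)) (MvPolynomial.C (q ^ k)⁻¹)) *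
        Polynomial.X))

/-- `∏_j ∏_{k<β} (1 - q^k y/z_j) (1 - q^{-k} y/z_j)`, where `y` is the first variable. -/
def pairFactor (q : K) (β r : ℕ) : Laurent K (r + 1) :=
  ∏ j : Fin r, ∏ k ∈ Finset.range β,
    ((1 - AddMonoidAlgebra.single (ratioExp 0 j.succ) (q ^ k)) *
      (1 - AddMonoidAlgebra.single (ratioExp 0 j.succ) (q ^ k)⁻¹))

/-- The auxiliary `Y` of the exchange relation becomes the integration variable of the operator that
acted earlier. -/
theorem eval_pairPoly (q : K) (β r : ℕ) :
    ∑ i ∈ Finset.range ((pairPoly σ q β r).natDegree + 1),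
      addVar _ r ((pairPoly σ q β r).coeff i) * newVar _ r i =
        scalarLaurent σ (r + 1) (pairFactor q β r) := by
  have h : (pairPoly σ q β r).eval₂ (addVar (MvPolynomial σ K) r) (newVar _ r 1) =
      scalarLaurent σ (r + 1) (pairFactor q β r) := by
    rw [← Polynomial.coe_eval₂RingHom, pairPoly, pairFactor, map_prod, map_prod]
    refine Finset.prod_congr rfl fun j _ => ?_
    rw [map_prod, map_prod]
    refine Finset.prod_congr rfl fun k _ => ?_
    have hr : (Pi.single j.succ (-1) + Pi.single 0 1 : Fin (r + 1) → ℤ) = ratioExp 0 j.succ := by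
      rw [ratioExp, Pi.single_neg]; abel
    simp only [map_mul, map_sub, map_one, Polynomial.coe_eval₂RingHom, Polynomial.eval₂_C,
      Polynomial.eval₂_X, addVar_single, consZero_single, newVar,
      AddMonoidAlgebra.single_mul_single, mul_one, hr, scalarLaurent_single]
  rw [← h, Polynomial.eval₂_eq_sum_range]
  refine Finset.sum_congr rfl fun l _ => ?_
  rw [newVar_pow, mul_one]

end Move

/-! ### The prefactor of a product of vertex operators -/

section Prefactor
variable {K : Type*} [Field K] (q : K) (β : ℕ) {r : ℕ}

theorem consZero_ratioExp (i j : Fin r) : consZero r (ratioExp i j) = ratioExp i.succ j.succ := by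
  rw [ratioExp, map_sub, consZero_single, consZero_single, ratioExp]

theorem addVar_laurentPoch (i j : Fin r) : addVar K r (laurentPoch q β 1 (ratioExp i j)) =
    laurentPoch q β 1 (ratioExp i.succ j.succ) := by
  simp only [laurentPoch, map_prod, map_sub, map_one, addVar_single, consZero_ratioExp]

theorem prod_erase_eq_ite {n : ℕ} {M : Type*} [CommMonoid M] (f : Fin n → Fin n → M) :
    ∏ i, ∏ j ∈ Finset.univ.erase i, f i j = ∏ i, ∏ j, if j = i then 1 else f i j := by
  refine Finset.prod_congr rfl fun i _ => ?_
  rw [← Finset.mul_prod_erase Finset.univ _ (Finset.mem_univ i), if_pos rfl, one_mul]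
  exact Finset.prod_congr rfl fun j hj => (if_neg (Finset.ne_of_mem_erase hj)).symm

theorem macDelta_succ (r : ℕ) : macDelta q β (r + 1) =
    (∏ j : Fin r, (laurentPoch q β 1 (ratioExp 0 j.succ) *
      laurentPoch q β 1 (ratioExp j.succ 0))) * addVar K r (macDelta q β r) := by
  rw [macDelta_eq, macDelta_eq, prod_erase_eq_ite, prod_erase_eq_ite, Fin.prod_univ_succ,
    Finset.prod_mul_distrib, mul_assoc]
  simp only [Fin.prod_univ_succ (n := r), if_true, one_mul, Fin.succ_ne_zero, if_false,
    (Fin.succ_ne_zero _).symm, Fin.succ_inj, Finset.prod_mul_distrib, map_prod]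
  congr 2
  refine Finset.prod_congr rfl fun i _ => Finset.prod_congr rfl fun j _ => ?_
  split_ifs
  · rw [map_one]
  · rw [addVar_laurentPoch]

/-- The sign factor produced by exchanging two vertex operators. -/
def exchangeSign : K := ((-1) ^ β * q ^ (β.choose 2))⁻¹

variable {q} in
-- Each `1 - q^{-k} y/z` equals `-q^{-k} (y/z)(1 - q^k z/y)`. This gives the missing half of the
-- weight `Δ`, a monomial, and a sign factor for each exchanged pair.
theorem pairFactor_eq (hq : q ≠ 0) (r : ℕ) : pairFactor q β r = exchangeSign q β ^ r •
    (lmono K (fun i : Fin (r + 1) => if i = 0 then (β * r : ℤ) else -β) *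
      ∏ j : Fin r, (laurentPoch q β 1 (ratioExp 0 j.succ) *
        laurentPoch q β 1 (ratioExp j.succ 0))) := by
  have h1 : ∀ u : Fin (r + 1) → ℤ, ∏ k ∈ Finset.range β, ((1 - AddMonoidAlgebra.single u (q ^ k)) *
      (1 - AddMonoidAlgebra.single u (q ^ k)⁻¹)) = exchangeSign q β • (lmono K (β • u) *
        (laurentPoch q β 1 u * laurentPoch q β 1 (-u))) := by
    intro u
    have h2 : ∀ k, (1 - AddMonoidAlgebra.single u (q ^ k)⁻¹ : Laurent K (r + 1)) =
        AddMonoidAlgebra.single u (-(q ^ k)⁻¹) *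
          (1 - AddMonoidAlgebra.single (-u) (1 * q ^ k)) := by
      intro k
      rw [mul_sub, mul_one, AddMonoidAlgebra.single_mul_single, add_neg_cancel, one_mul, neg_mul,
        inv_mul_cancel₀ (pow_ne_zero k hq), AddMonoidAlgebra.single_neg,
        AddMonoidAlgebra.single_neg, AddMonoidAlgebra.one_def]
      abel
    have h3 : exchangeSign q β = ∏ k ∈ Finset.range β, (-(q ^ k)⁻¹) := by
      have : ∀ k ∈ Finset.range β, -(q ^ k)⁻¹ = ((-1) * q ^ k)⁻¹ := fun k _ => by
        rw [neg_one_mul, inv_neg]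
      rw [Finset.prod_congr rfl this, Finset.prod_inv_distrib, Finset.prod_mul_distrib,
        Finset.prod_const, Finset.card_range, Finset.prod_pow_eq_pow_sum, Finset.sum_range_id,
        exchangeSign, Nat.choose_two_right]
    simp only [h2, laurentPoch, Finset.prod_mul_distrib, one_mul]
    have h4 : AddMonoidAlgebra.single (β • u) (exchangeSign q β) =
        exchangeSign q β • lmono K (β • u) := by
      rw [lmono, AddMonoidAlgebra.smul_single, smul_eq_mul, mul_one]
    rw [AddMonoidAlgebra.prod_single, Finset.sum_const, Finset.card_range, ← h3, h4,
      smul_mul_assoc, mul_smul_comm]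
    congr 1
    ring
  rw [pairFactor]
  simp only [h1, neg_ratioExp]
  rw [Finset.prod_smul, Finset.prod_const, Finset.card_univ, Fintype.card_fin,
    Finset.prod_mul_distrib]
  congr 2
  simp only [lmono]
  rw [AddMonoidAlgebra.prod_single, Finset.prod_const_one]
  congr 1
  ext i
  rw [Finset.sum_apply]
  refine Fin.cases ?_ (fun i => ?_) i
  · simp [ratioExp, mul_comm]
  · simp [ratioExp, Pi.single_apply, Fin.succ_ne_zero]

/-- The prefactor `∏_i z_i^{g+β(r-1)} Δ(z)` with its sign. -/
def prefactor (g : ℤ) (r : ℕ) : Laurent K r := exchangeSign q β ^ (r.choose 2) •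
  (lmono K (fun _ => g + β * ((r : ℤ) - 1)) * macDelta q β r)

theorem prefactor_zero (g : ℤ) : prefactor q β g 0 = 1 := by
  rw [prefactor, Nat.choose_zero_succ, pow_zero, one_smul, macDelta, Finset.univ_eq_empty,
    Finset.prod_empty, mul_one]
  exact (congrArg (lmono K) (Subsingleton.elim _ _)).trans lmono_zero

variable {q} in
-- The first acting operator contributes `y^g` and leaves charge `g + 2β` to the others. The
-- monomial in the pair factor then equalizes all exponents to `g + β r`.
theorem prefactor_succ (hq : q ≠ 0) (g : ℤ) (r : ℕ) : prefactor q β g (r + 1) =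
    addVar K r (prefactor q β (g + 2 * β) r) * pairFactor q β r * newVar K r g := by
  have hs : ∀ (c : K) (F : Laurent K r), addVar K r (c • F) = c • addVar K r F := by
    intro c F
    induction F using AddMonoidAlgebra.induction_linear with
    | zero => simp
    | add F G hF hG => rw [smul_add, map_add, hF, hG, map_add, smul_add]
    | single u d =>
      rw [AddMonoidAlgebra.smul_single, addVar_single, addVar_single, AddMonoidAlgebra.smul_single]
  rw [prefactor, prefactor, pairFactor_eq β hq, macDelta_succ, hs, map_mul, Nat.choose_succ_succ' r 1,
    Nat.choose_one_right, lmono, lmono, addVar_single, smul_mul_smul_comm, smul_mul_assoc,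
    ← pow_add, add_comm (r.choose 2)]
  congr 1
  have : lmono K (fun _ : Fin (r + 1) => g + β * (((r + 1 : ℕ) : ℤ) - 1)) =
      AddMonoidAlgebra.single (consZero r fun _ => g + 2 * β + β * ((r : ℤ) - 1)) 1 *
        lmono K (fun i : Fin (r + 1) => if i = 0 then (β * r : ℤ) else -β) * newVar K r g := by
    rw [newVar, lmono, lmono, AddMonoidAlgebra.single_mul_single,
      AddMonoidAlgebra.single_mul_single, one_mul, one_mul]
    congr 1
    ext i
    refine Fin.cases ?_ (fun i => ?_) i
    · simp [consZero_zero]; ring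
    · simp [consZero_succ, Fin.succ_ne_zero]; ring
  rw [lmono] at this
  rw [this]
  ring

end Prefactor

/-! ### Powers of vertex modes -/

section Vertex
variable {K : Type*} [Field K] [CharZero K] {M : ℕ}

/-- `∑_{n>0} (X_{a,n} / n) z^n`. -/
def creationLog (K : Type*) [Field K] {M : ℕ} (a : Fin M) : PowerSeries (Creation K M) :=
  PowerSeries.mk fun n => if n = 0 then 0 else ((n : K)⁻¹) • MvPolynomial.X (a, n - 1)

/-- `exp(∑_{n>0} (X_{a,n} / n) z^n)`. -/
def creationExp (K : Type*) [Field K] {M : ℕ} (a : Fin M) : PowerSeries (Creation K M) :=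
  expSeries K (creationLog K a)

theorem eulerD_creationExp (a : Fin M) : eulerD (creationExp K a) =
    eulerD (creationLog K a) * creationExp K a :=
  eulerD_expSeries (by simp [creationLog]) fun _ _ => Commute.all _ _

omit [CharZero K] in
theorem coeff_zero_creationExp (a : Fin M) : PowerSeries.coeff 0 (creationExp K a) = 1 :=
  coeff_zero_expSeries _

theorem coeff_eulerD_creationLog (a : Fin M) (n : ℕ) :
    PowerSeries.coeff n (eulerD (creationLog K a)) =
      if n = 0 then 0 else MvPolynomial.X (a, n - 1) := by
  rw [coeff_eulerD, creationLog, PowerSeries.coeff_mk]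
  split_ifs with h
  · rw [smul_zero]
  · rw [← Nat.cast_smul_eq_nsmul K, smul_smul, mul_inv_cancel₀ (Nat.cast_ne_zero.mpr h), one_smul]

/-- The degrees of the creation operators. -/
abbrev modeDeg {M : ℕ} : Fin M × ℕ → ℕ := fun i => i.2 + 1

/-- The exchange relation of two vertex operators. The shift contributes `exp(∑ s_n (y/z_j)^n / n)`,
and for the given `s` this is a finite product of linear factors; the logarithmic derivatives agree.
-/
theorem map_moveHom_creationExp {q : K} {β : ℕ} (a : Fin M) {s : Fin M × ℕ → K}
    (hs : ∀ n, s (a, n) = -∑ k ∈ Finset.range β, ((q ^ k) ^ (n + 1) + ((q ^ k)⁻¹) ^ (n + 1)))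
    (r : ℕ) : PowerSeries.map (moveHom modeDeg s r).toRingHom (creationExp K a) =
      (pairPoly (Fin M × ℕ) q β r : PowerSeries (LaurentOver (Creation K M) r)) *
        PowerSeries.map (AddMonoidAlgebra.singleZeroRingHom (M := Fin r → ℤ))
          (creationExp K a) := by
  set S := LaurentOver (Creation K M) r
  set φ := (moveHom modeDeg s r).toRingHom
  set c0 := AddMonoidAlgebra.singleZeroRingHom (R := Creation K M) (M := Fin r → ℤ)
  let y : Fin r → ℕ → S := fun j k =>
    AddMonoidAlgebra.single (Pi.single j (-1)) (MvPolynomial.C (q ^ k))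
  let y' : Fin r → ℕ → S := fun j k =>
    AddMonoidAlgebra.single (Pi.single j (-1)) (MvPolynomial.C (q ^ k)⁻¹)
  have hP : (pairPoly (Fin M × ℕ) q β r : PowerSeries S) = ∏ j : Fin r, ∏ k ∈ Finset.range β,
      ((1 - PowerSeries.C (y j k) * PowerSeries.X) * (1 - PowerSeries.C (y' j k) * PowerSeries.X)) := by
    rw [pairPoly, ← Polynomial.coeToPowerSeries.ringHom_apply, map_prod]
    simp only [map_prod, map_mul, map_sub, map_one, Polynomial.coeToPowerSeries.ringHom_apply,
      Polynomial.coe_C, Polynomial.coe_X, y, y']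
  have hPd : eulerD (pairPoly (Fin M × ℕ) q β r : PowerSeries S) =
      (∑ j : Fin r, ∑ k ∈ Finset.range β, ((1 - geomSeries (y j k)) + (1 - geomSeries (y' j k)))) *
        (pairPoly (Fin M × ℕ) q β r : PowerSeries S) := by
    rw [hP]
    refine eulerD_prod _ _ _ fun j _ => eulerD_prod _ _ _ fun k _ => ?_
    rw [eulerD_mul, eulerD_one_sub, eulerD_one_sub]
    ring
  have hl : PowerSeries.map φ (eulerD (creationLog K a)) =
      (∑ j : Fin r, ∑ k ∈ Finset.range β, ((1 - geomSeries (y j k)) + (1 - geomSeries (y' j k)))) +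
        PowerSeries.map c0 (eulerD (creationLog K a)) := by
    ext1 n
    simp only [map_add, map_sum, PowerSeries.coeff_map, coeff_eulerD_creationLog,
      coeff_one_sub_geomSeries]
    rcases n with _ | n
    · simp
    · simp only [Nat.succ_ne_zero, if_false, Nat.add_sub_cancel]
      rw [add_comm]
      change moveHom modeDeg s r _ = _
      rw [moveHom_X]
      congr 1
      refine Finset.sum_congr rfl fun j _ => ?_
      simp only [y, y', AddMonoidAlgebra.single_pow, ← map_pow, ← AddMonoidAlgebra.single_neg,
        ← AddMonoidAlgebra.single_add]
      have e : ((n + 1 : ℕ) • Pi.single j (-1) : Fin r → ℤ) = Pi.single j (-((n + 1 : ℕ) : ℤ)) := by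
        rw [← Pi.single_smul, nsmul_eq_mul, mul_neg, mul_one]
      rw [e, hs, map_neg, map_sum, ← Finset.sum_neg_distrib]
      simp only [map_add, neg_add]
      exact map_sum (AddMonoidAlgebra.singleAddHom (R := Creation K M)
        (Pi.single j (-((n + 1 : ℕ) : ℤ)) : Fin r → ℤ)) _ _
  refine eq_of_eulerD_eq (K := K) (l := PowerSeries.map φ (eulerD (creationLog K a))) ?_ ?_ ?_ ?_
  · rw [PowerSeries.coeff_map, coeff_eulerD_creationLog, if_pos rfl, map_zero]
  · rw [eulerD_map, eulerD_creationExp, map_mul]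
  · rw [eulerD_mul, hPd, eulerD_map, eulerD_creationExp, map_mul, hl]
    ring
  · rw [PowerSeries.coeff_map, coeff_zero_creationExp, map_one, PowerSeries.coeff_mul]
    rw [Finset.Nat.antidiagonal_zero, Finset.sum_singleton, PowerSeries.coeff_map,
      coeff_zero_creationExp, map_one, mul_one, hP, PowerSeries.coeff_zero_eq_constantCoeff,
      map_prod]
    simp

end Vertex

/-! ### The action of the vertex operators -/

section Action
variable {K : Type*} [Field K] [CharZero K] {M : ℕ}

omit [CharZero K] in
theorem commute_coeff_expSeries {R : Type*} [Ring R] [Algebra K R] {x : R} {f : PowerSeries R}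
    (h : ∀ i, Commute x (PowerSeries.coeff i f)) (k : ℕ) :
    Commute x (PowerSeries.coeff k (expSeries K f)) := by
  have hc : Commute (PowerSeries.C x) f := commute_of_coeff fun i j => by
    rw [PowerSeries.coeff_C]
    split_ifs
    · exact h j
    · exact Commute.zero_left _
  rw [expSeries, PowerSeries.coeff_mk]
  refine Commute.sum_right _ _ _ fun j _ => Commute.smul_right ?_ _
  have := congrArg (PowerSeries.coeff k) (hc.pow_right j).eq
  rwa [PowerSeries.coeff_C_mul, PowerSeries.coeff_mul_C] at this

omit [CharZero K] in
theorem commute_osc_pos (q t : K) (a b : Fin M) (n m : ℕ) :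
    Commute (osc q t a ((n + 1 : ℕ) : ℤ)) (osc q t b ((m + 1 : ℕ) : ℤ)) := by
  have h := osc_commutator q t a b ((n + 1 : ℕ) : ℤ) ((m + 1 : ℕ) : ℤ)
  rwa [if_neg (by omega), zero_smul, add_zero] at h

/-- The shifts of the creation operators by `exp(-∑_{n>0} (a^a_n / n) z^{-n})`. -/
def modeShift (q t : K) (a : Fin M) (i : Fin M × ℕ) : K :=
  -(((i.2 + 1 : ℕ) : K)⁻¹ * oscComm q t a i.1 ((i.2 : ℤ) + 1))

/-- The recursion with the new operator on the right, so that it acts first on a vector. This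
matches the recursion of `shiftHom`, where the derivative is taken first. -/
theorem smul_coeff_expSeries {R : Type*} [Ring R] [Algebra K R] (x : ℕ → R)
    (hx : ∀ n m, Commute (x (n + 1)) (x (m + 1))) (k : ℕ) :
    (k : K) • PowerSeries.coeff k (expSeries K
        (PowerSeries.mk fun n => if n = 0 then 0 else -((n : K)⁻¹) • x n)) =
      -∑ n ∈ Finset.range k, PowerSeries.coeff (k - (n + 1)) (expSeries K
        (PowerSeries.mk fun n => if n = 0 then 0 else -((n : K)⁻¹) • x n)) * x (n + 1) := by
  set f : PowerSeries R := PowerSeries.mk fun n => if n = 0 then 0 else -((n : K)⁻¹) • x n with hf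
  have h0 : PowerSeries.coeff 0 f = 0 := by rw [hf, PowerSeries.coeff_mk, if_pos rfl]
  have h1 : ∀ n, PowerSeries.coeff (n + 1) f = -(((n + 1 : ℕ) : K)⁻¹) • x (n + 1) := fun n => by
    rw [hf, PowerSeries.coeff_mk, if_neg n.succ_ne_zero]
  have hcomm : ∀ n i, Commute (x (n + 1)) (PowerSeries.coeff i f) := by
    intro n i
    rcases i with _ | i
    · rw [h0]; exact Commute.zero_right _
    · rw [h1]; exact (hx n i).smul_right _
  have hcomm' : ∀ i j, Commute (PowerSeries.coeff i f) (PowerSeries.coeff j f) := by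
    intro i j
    rcases i with _ | i
    · rw [h0]; exact Commute.zero_left _
    · rw [h1]; exact (hcomm i j).smul_left _
  rw [Nat.cast_smul_eq_nsmul, nsmul_coeff_eq_sum_range (eulerD_expSeries (K := K) h0 hcomm') k,
    ← Finset.sum_neg_distrib]
  refine Finset.sum_congr rfl fun n _ => ?_
  rw [h1, ← Nat.cast_smul_eq_nsmul K, smul_mul_assoc, smul_smul, mul_neg,
    mul_inv_cancel₀ (Nat.cast_ne_zero.mpr n.succ_ne_zero), neg_smul, one_smul,
    (commute_coeff_expSeries (hcomm n) _).eq]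

theorem smul_expAnnihilation (q t : K) (a : Fin M) (k : ℕ) : (k : K) • expAnnihilation q t a k =
    -∑ n ∈ Finset.range k,
      expAnnihilation q t a (k - (n + 1)) * osc q t a ((n + 1 : ℕ) : ℤ) :=
  smul_coeff_expSeries (fun n => osc q t a (n : ℤ)) (fun n m => commute_osc_pos q t a a n m) k

omit [CharZero K] in
theorem expAnnihilation_zero (q t : K) (a : Fin M) : expAnnihilation q t a 0 = 1 :=
  coeff_zero_expSeries (K := K) (annihilationField q t a)

theorem smul_coeff_modeShift (q t : K) (a : Fin M) (k : ℕ) (p : Creation K M) :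
    (k : K) • (shiftHom modeDeg (modeShift q t a) p).coeff k =
      -∑ n ∈ Finset.range k, (shiftHom modeDeg (modeShift q t a)
        (∑ b : Fin M, oscComm q t a b ((n : ℤ) + 1) • MvPolynomial.pderiv (b, n) p)).coeff
          (k - (n + 1)) := by
  have h3 := nsmul_coeff_shiftHom modeDeg (modeShift q t a) (fun i => i.2.succ_pos) p k
    (Finset.univ ×ˢ Finset.range k) fun i => by simp
  rw [Nat.cast_smul_eq_nsmul, h3, Finset.sum_product_right, ← Finset.sum_neg_distrib]
  refine Finset.sum_congr rfl fun n hn => ?_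
  rw [map_sum, Polynomial.finsetSum_coeff, ← Finset.sum_neg_distrib]
  refine Finset.sum_congr rfl fun b _ => ?_
  rw [map_smul, Polynomial.coeff_smul, modeShift, mul_neg, ← mul_assoc,
    mul_inv_cancel₀ (Nat.cast_ne_zero.mpr n.succ_ne_zero), one_mul, neg_smul]

/-- The exponential of a derivation with constant coefficients is a shift of the variables. Both
sides obey the same recursion in `k`. -/
theorem expAnnihilation_single (q t : K) (a : Fin M) (γ : Fin M → ℤ) (k : ℕ) :
    ∀ p : Creation K M, expAnnihilation q t a k (Finsupp.single γ p) =
      Finsupp.single γ ((shiftHom modeDeg (modeShift q t a) p).coeff k) := by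
  induction k using Nat.strong_induction_on with
  | _ k ih =>
    intro p
    rcases Nat.eq_zero_or_pos k with rfl | hk
    · rw [expAnnihilation_zero, coeff_zero_shiftHom _ _ fun i => i.2.succ_pos,
        Module.End.one_apply]
    have hk0 : (k : K) ≠ 0 := Nat.cast_ne_zero.mpr hk.ne'
    have h1 : (k : K) • expAnnihilation q t a k (Finsupp.single γ p) = (k : K) • Finsupp.single γ
        ((shiftHom modeDeg (modeShift q t a) p).coeff k) := by
      rw [Finsupp.smul_single, smul_coeff_modeShift, ← LinearMap.smul_apply,
        smul_expAnnihilation, LinearMap.neg_apply, LinearMap.sum_apply, Finsupp.single_neg,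
        Finsupp.single_finsetSum]
      congr 1
      refine Finset.sum_congr rfl fun n hn => ?_
      have hn := Finset.mem_range.mp hn
      rw [Module.End.mul_apply, osc_pos_single, ih _ (by omega)]
    exact smul_right_injective _ hk0 h1

omit [CharZero K] in
theorem expPhiNonpos_single (q t : K) (β : ℕ) (a : Fin M) (k : ℤ) (γ : Fin M → ℤ)
    (p : Creation K M) : expPhiNonpos q t β a k (Finsupp.single γ p) =
      Finsupp.single (fun b => γ b + β * cartanA b a) (intCoeff (creationExp K a) k * p) := by
  rw [expPhiNonpos, intCoeff]
  split_ifs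
  · have h := map_coeff_expSeries (K := K) (R := Creation K M)
      (S := Module.End K (Fock K M)) (Algebra.lsmul K K (Fock K M) (A := Creation K M))
      (creationLog K a) k.toNat
    have e : PowerSeries.map ((Algebra.lsmul K K (Fock K M) (A := Creation K M)) :
        Creation K M →+* Module.End K (Fock K M)) (creationLog K a) = creationField q t a := by
      ext1 n
      rw [PowerSeries.coeff_map, creationLog, creationField, PowerSeries.coeff_mk,
        PowerSeries.coeff_mk]
      rcases n with _ | n
      · simp
      · rw [if_neg n.succ_ne_zero, if_neg n.succ_ne_zero]
        refine Finsupp.lhom_ext fun γ p => ?_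
        have : -((n + 1 : ℕ) : ℤ) = Int.negSucc n := rfl
        rw [RingHom.coe_coe, map_smul, LinearMap.smul_apply, LinearMap.smul_apply, this,
          osc_neg_single]
        change _ • ((MvPolynomial.X (a, n) : Creation K M) • Finsupp.single γ p) = _
        rw [Finsupp.smul_single, smul_eq_mul]
    rw [e] at h
    rw [← h, Module.End.mul_apply, expQ_single]
    change (PowerSeries.coeff k.toNat (creationExp K a)) • Finsupp.single _ p = _
    rw [Finsupp.smul_single, smul_eq_mul]
  · rw [zero_mul, Finsupp.single_zero, LinearMap.zero_apply]

/-- The shift of a polynomial is a polynomial in `z⁻¹`, so the sum over annihilation modes is finite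
with an explicit bound. -/
theorem vertexMode_single (q t : K) (β : ℕ) (a : Fin M) (m : ℤ) (γ : Fin M → ℤ)
    (p : Creation K M) : vertexMode q t β a m (Finsupp.single γ p) =
      Finsupp.single (fun b => γ b + β * cartanA b a)
        (∑ l ∈ Finset.range ((shiftHom modeDeg (modeShift q t a) p).natDegree + 1),
          intCoeff (creationExp K a) (m + l - γ a) *
            (shiftHom modeDeg (modeShift q t a) p).coeff l) := by
  have h : vertexMode q t β a m (Finsupp.single γ p) =
      ∑ᶠ l : ℕ, (expPhiNonpos q t β a (m + l - γ a) * expAnnihilation q t a l)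
        (Finsupp.single γ p) := by
    rw [vertexMode, Finsupp.lsum_single]
    rfl
  rw [h, Finsupp.single_finsetSum, finsum_eq_sum_of_support_subset (s := Finset.range
    ((shiftHom modeDeg (modeShift q t a) p).natDegree + 1))]
  · refine Finset.sum_congr rfl fun l _ => ?_
    rw [Module.End.mul_apply, expAnnihilation_single, expPhiNonpos_single]
  · intro l hl
    by_contra hl'
    refine hl ?_
    beta_reduce
    rw [Module.End.mul_apply, expAnnihilation_single, expPhiNonpos_single,
      Polynomial.coeff_eq_zero_of_natDegree_lt (by simpa [Nat.succ_le_iff] using hl'), mul_zero,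
      Finsupp.single_zero]

omit [CharZero K] in
-- For `t = q^β` both quotients are geometric sums with `β` terms, of ratios `q^{n+1}` and
-- `q^{-(n+1)}`. Hence the exchange factor is a polynomial.
theorem oscComm_self {q : K} (hq1 : ∀ k, 0 < k → q ^ k ≠ 1) (β : ℕ) (a : Fin M) (n : ℕ) :
    oscComm q (q ^ β) a a ((n : ℤ) + 1) = ((n + 1 : ℕ) : K) *
      ∑ k ∈ Finset.range β, ((q ^ k) ^ (n + 1) + ((q ^ k)⁻¹) ^ (n + 1)) := by
  have hA : cartanA a a = 2 := by simp [cartanA]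
  rw [oscComm, hA, if_neg (by norm_num), if_neg (by norm_num)]
  have e : ((n : ℤ) + 1) = ((n + 1 : ℕ) : ℤ) := by push_cast; ring
  rw [e, zpow_natCast, zpow_natCast, zpow_neg, zpow_neg, zpow_natCast, zpow_natCast, Int.cast_natCast,
    Finset.sum_add_distrib]
  have hg : ∀ y : K, y ≠ 1 → ∑ k ∈ Finset.range β, y ^ k = (1 - y ^ β) / (1 - y) := by
    intro y hy
    rw [geom_sum_eq hy, ← neg_div_neg_eq, neg_sub, neg_sub]
  have h1 := hg (q ^ (n + 1)) (hq1 _ n.succ_pos)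
  have h2 := hg ((q ^ (n + 1))⁻¹) (fun h => hq1 _ n.succ_pos (inv_eq_one.mp h))
  have c1 : ∀ k, (q ^ k) ^ (n + 1) = (q ^ (n + 1)) ^ k := fun k => by
    rw [← pow_mul, ← pow_mul, mul_comm]
  have c2 : ∀ k, ((q ^ k)⁻¹) ^ (n + 1) = ((q ^ (n + 1))⁻¹) ^ k := fun k => by
    rw [inv_pow, inv_pow, c1]
  simp only [c1, c2]
  rw [h1, h2, inv_pow]

theorem modeShift_self {q : K} (hq1 : ∀ k, 0 < k → q ^ k ≠ 1) (β : ℕ) (a : Fin M) (n : ℕ) :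
    modeShift q (q ^ β) a (a, n) =
      -∑ k ∈ Finset.range β, ((q ^ k) ^ (n + 1) + ((q ^ k)⁻¹) ^ (n + 1)) := by
  rw [modeShift, oscComm_self hq1, inv_mul_cancel_left₀ (Nat.cast_ne_zero.mpr n.succ_ne_zero)]

/-- A creation coefficient left by an earlier operator is pulled through the later shifts. The
exchange factor comes out, and extracting the coefficient of `y^m` becomes a factor `y^{-m}` under
the constant term. -/
theorem evalModes_mul_moveHom {q : K} {β : ℕ} (a : Fin M) {s : Fin M × ℕ → K}
    (hs : ∀ n, s (a, n) = -∑ k ∈ Finset.range β, ((q ^ k) ^ (n + 1) + ((q ^ k)⁻¹) ^ (n + 1)))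
    (r : ℕ) (F : LaurentOver (Creation K M) r) (m : ℤ) :
    evalModes (intCoeff (creationExp K a)) r
        (F * moveHom modeDeg s r (intCoeff (creationExp K a) m)) =
      evalModes (intCoeff (creationExp K a)) (r + 1)
        (addVar _ r F * scalarLaurent _ (r + 1) (pairFactor q β r) * newVar _ r (-m)) := by
  have h1 : moveHom modeDeg s r (intCoeff (creationExp K a) m) =
      ∑ i ∈ Finset.range ((pairPoly (Fin M × ℕ) q β r).natDegree + 1),
        (pairPoly (Fin M × ℕ) q β r).coeff i *
          AddMonoidAlgebra.single 0 (intCoeff (creationExp K a) (m - i)) := by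
    have := map_intCoeff (moveHom modeDeg s r).toRingHom (creationExp K a) m
    rw [map_moveHom_creationExp a hs, intCoeff_polynomial_mul] at this
    simp only [← map_intCoeff] at this
    exact this
  have h2 : ∀ (G : LaurentOver (Creation K M) r) (c : Creation K M),
      evalModes (intCoeff (creationExp K a)) r (G * AddMonoidAlgebra.single 0 c) =
        evalModes (intCoeff (creationExp K a)) r G * c := by
    intro G c
    have : G * AddMonoidAlgebra.single 0 c = c • G := by
      rw [mul_comm]
      exact (Algebra.smul_def c G).symm
    rw [this, map_smul, smul_eq_mul, mul_comm]
  rw [h1, Finset.mul_sum, map_sum, ← eval_pairPoly, Finset.mul_sum, Finset.sum_mul, map_sum]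
  refine Finset.sum_congr rfl fun i _ => ?_
  rw [← mul_assoc, h2, ← mul_assoc, ← map_mul, mul_assoc (addVar _ _ _), newVar_mul,
    evalModes_addVar_mul]
  congr 2
  ring

/-- A product of equal vertex operators. -/
theorem vertexMode_pow_single {q : K} (hq : q ≠ 0) (hq1 : ∀ k, 0 < k → q ^ k ≠ 1) (β : ℕ)
    (a : Fin M) (r : ℕ) : ∀ (γ : Fin M → ℤ) (p : Creation K M),
    (vertexMode q (q ^ β) β a 0 ^ r) (Finsupp.single γ p) =
      Finsupp.single (fun b => γ b + r * (β * cartanA b a))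
        (evalModes (intCoeff (creationExp K a)) r (scalarLaurent _ r (prefactor q β (γ a) r) *
          moveHom modeDeg (modeShift q (q ^ β) a) r p)) := by
  induction r with
  | zero =>
    intro γ p
    have : moveHom modeDeg (modeShift q (q ^ β) a) 0 p = AddMonoidAlgebra.single 0 p := by
      induction p using MvPolynomial.induction_on with
      | C c => exact moveHom_C _ _ _ _
      | add p p' h h' => rw [map_add, h, h', AddMonoidAlgebra.single_add]
      | mul_X p i h =>
        rw [map_mul, h, moveHom_X, Finset.univ_eq_empty, Finset.sum_empty, add_zero,
          AddMonoidAlgebra.single_mul_single, zero_add]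
    rw [pow_zero, Module.End.one_apply, prefactor_zero, map_one, one_mul, this, evalModes_single,
      Finset.univ_eq_empty, Finset.prod_empty, mul_one]
    simp
  | succ r ih =>
    intro γ p
    have hs := modeShift_self hq1 β a
    have hA : cartanA a a = 2 := by simp [cartanA]
    -- The rightmost operator acts first and receives the new variable; the other `r` act at the
    -- charge raised by `2β`.
    rw [pow_succ, Module.End.mul_apply, vertexMode_single, ih]
    congr 1
    · ext b; push_cast; ring
    rw [hA, mul_comm (β : ℤ) 2, prefactor_succ β hq, moveHom_succ, map_sum, Finset.mul_sum,
      Finset.mul_sum, map_sum, map_sum]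
    refine Finset.sum_congr rfl fun l _ => ?_
    rw [map_mul (moveHom _ _ _), mul_left_comm, mul_comm (moveHom _ _ _ _), evalModes_mul_moveHom a hs]
    refine congrArg _ ?_
    have e1 : newVar (Creation K M) r (-(0 + (l : ℤ) - γ a)) =
        newVar _ r (γ a) * newVar _ r (-(l : ℤ)) := by
      rw [newVar_mul]; congr 1; ring
    have e2 : scalarLaurent (Fin M × ℕ) (r + 1) (newVar K r (γ a)) = newVar _ r (γ a) := by
      rw [newVar, newVar, scalarLaurent_single, map_one]
    rw [e1, map_mul (addVar _ _), map_mul (scalarLaurent _ _) _ (newVar K r (γ a)),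
      map_mul (scalarLaurent _ _), e2, addVar_scalarLaurent]
    ring

end Action

/-! ### Sums of rectangles -/

section Rectangles
variable {N : ℕ} (r s : Fin N → ℕ) (S : Finset (Fin N))

/-- The row lengths of `∑_{a ∈ S} (s_a^{r_a})`. -/
def rectRow (i : ℕ) : ℕ := ∑ a ∈ S, if i < r a then s a else 0

theorem rectRow_antitone : Antitone (rectRow r s S) := fun i j h =>
  Finset.sum_le_sum fun a _ => by split_ifs <;> omega

theorem filter_map_range {f : ℕ → ℕ} {n m : ℕ} (h : n ≤ m) (hf : ∀ i, n ≤ i → f i = 0) :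
    ((Multiset.range m).map f).filter (· ≠ 0) = ((Multiset.range n).map f).filter (· ≠ 0) := by
  induction m, h using Nat.le_induction with
  | base => rfl
  | succ m hm ih =>
    rw [Multiset.range_succ, Multiset.map_cons, Multiset.filter_cons_of_neg _ (by simp [hf m hm]), ih]

variable {r S} in
theorem rectRow_eq_zero {n : ℕ} (h : ∀ a ∈ S, r a ≤ n) {i : ℕ} (hi : n ≤ i) :
    rectRow r s S i = 0 :=
  Finset.sum_eq_zero fun a ha => if_neg (by have := h a ha; omega)

variable {r S} in
theorem shape_rectRow {n : ℕ} (h : ∀ a ∈ S, r a ≤ n) :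
    shape (Finsupp.equivFunOnFinite.symm fun i : Fin n => rectRow r s S i) =
      (rectPartition r s S).parts := by
  have h1 : Finset.univ.val.map (fun i : Fin n => rectRow r s S i) =
      (Multiset.range n).map (rectRow r s S) := by
    rw [Fin.univ_val_map, ← Multiset.coe_range, Multiset.map_coe]
    congr 1
    exact List.ext_getElem (by simp) (by simp)
  have h2 : (rectPartition r s S).parts =
      ((Multiset.range (∑ a, r a)).map (rectRow r s S)).filter (· ≠ 0) := rfl
  have h3 : shape (Finsupp.equivFunOnFinite.symm fun i : Fin n => rectRow r s S i) =
      ((Multiset.range n).map (rectRow r s S)).filter (· ≠ 0) := by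
    rw [← h1]; rfl
  rw [h2, h3]
  rcases le_total n (∑ a, r a) with hn | hn
  · exact (filter_map_range hn fun i hi => rectRow_eq_zero s h hi).symm
  · exact filter_map_range hn fun i hi => rectRow_eq_zero s
      (fun a _ => Finset.single_le_sum (fun _ _ => Nat.zero_le _) (Finset.mem_univ a)) hi

variable {r S} in
theorem card_rectPartition_le {n : ℕ} (h : ∀ a ∈ S, r a ≤ n) :
    (rectPartition r s S).parts.card ≤ n := by
  rw [← shape_rectRow s h]
  exact card_shape_le _

variable {r S} in
theorem partExp_rectPartition {n : ℕ} (h : ∀ a ∈ S, r a ≤ n) (i : Fin n) :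
    partExp n (rectPartition r s S) i = rectRow r s S i := by
  have : partExp n (rectPartition r s S) =
      Finsupp.equivFunOnFinite.symm fun i : Fin n => rectRow r s S i :=
    eq_of_antitone_of_shape (sortedExp_antitone _) (fun i j hij => rectRow_antitone r s S hij)
      ((shape_partExp (card_rectPartition_le s h)).trans (shape_rectRow s h).symm)
  rw [this]; rfl

end Rectangles

/-! ### Reduction of the matrix element -/

section Reduction
variable {K : Type*} [Field K] {M : ℕ}

/-- The specialization of the creation operators of type `k` to power sums; the others vanish. -/
def thetaHom (q t : K) (M k : ℕ) : Creation K M →ₐ[K] SymFun K :=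
  MvPolynomial.aeval fun i => if i.1.val = k then
    MvPolynomial.C ((1 - t ^ (i.2 + 1)) / (1 - q ^ (i.2 + 1))) * MvPolynomial.X i.2 else 0

variable (K M) in
/-- The homomorphism that kills the creation operators of type less than `k`. -/
def keepHom (k : ℕ) : Creation K M →ₐ[K] Creation K M :=
  MvPolynomial.aeval fun i => if k ≤ i.1.val then MvPolynomial.X i else 0

/-- The scaling in `thetaHom` is chosen so that `a_{-n}/n` becomes `p_n/⟨p_n,p_n⟩`; the creation
exponential becomes the reproducing kernel. -/
theorem map_thetaHom_creationExp (q t : K) (a : Fin M) :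
    PowerSeries.map (thetaHom q t M a).toRingHom (creationExp K a) =
      adjointSeries q t fun _ => 1 := by
  ext1 k
  rw [PowerSeries.coeff_map]
  refine (map_coeff_expSeries (thetaHom q t M a) (creationLog K a) k).trans ?_
  rw [adjointSeries]
  congr 2
  ext1 n
  rw [PowerSeries.coeff_map, creationLog, PowerSeries.coeff_mk, PowerSeries.coeff_mk]
  rcases n with _ | n
  · simp
  · rw [if_neg n.succ_ne_zero, if_neg n.succ_ne_zero, RingHom.coe_coe, map_smul, thetaHom,
      MvPolynomial.aeval_X, Nat.add_sub_cancel, if_pos rfl, MvPolynomial.smul_eq_C_mul, ← mul_assoc,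
      ← map_mul, powerNorm, one_div, mul_inv, inv_div]

theorem map_keepHom_creationExp {a : Fin M} {k : ℕ} (h : k ≤ a.val) :
    PowerSeries.map (keepHom K M k).toRingHom (creationExp K a) = creationExp K a := by
  ext1 l
  rw [PowerSeries.coeff_map]
  refine (map_coeff_expSeries (keepHom K M k) (creationLog K a) l).trans ?_
  rw [creationExp]
  congr 2
  ext1 n
  rw [PowerSeries.coeff_map, creationLog, PowerSeries.coeff_mk]
  split_ifs
  · exact map_zero _
  · rw [RingHom.coe_coe, map_smul, keepHom, MvPolynomial.aeval_X, if_pos h]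

theorem coeff_toLaurent_eq_zero {n : ℕ} (F : MvPolynomial (Fin n) K) {u : Fin n → ℤ} {j : Fin n}
    (hj : u j < 0) : (toLaurent K n F).coeff u = 0 := by
  classical
  induction F using MvPolynomial.induction_on' with
  | monomial γ c =>
    rw [toLaurent_monomial, AddMonoidAlgebra.coeff_single, Finsupp.single_apply, if_neg]
    rintro rfl
    exact absurd hj (not_lt.mpr (Int.natCast_nonneg _))
  | add f g hf hg => rw [map_add, AddMonoidAlgebra.coeff_add, Finsupp.add_apply, hf, hg, add_zero]

/-- The reproducing property for Laurent polynomials. -/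
theorem scalarForm_evalModes [CharZero K] {q t : K} (hz : ∀ n, powerNorm q t n ≠ 0) {r : ℕ}
    (G : Laurent K r) (f : SymFun K) :
    scalarForm q t (evalModes (intCoeff (adjointSeries q t fun _ => 1)) r
      (scalarLaurent ℕ r G)) f = constTerm K r (G * toLaurent K r (toVars r f)) := by
  induction G using AddMonoidAlgebra.induction_linear with
  | zero => simp
  | add F G hF hG => simp only [map_add, add_mul, LinearMap.add_apply, hF, hG]
  | single u c =>
    rw [scalarLaurent_single, evalModes_single, constTerm_apply,
      AddMonoidAlgebra.coeff_single_mul_apply, add_zero, MvPolynomial.C_mul', map_smul,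
      LinearMap.smul_apply, smul_eq_mul]
    congr 1
    -- A positive `u j` kills both sides: the kernel has no negative modes and a polynomial has no
    -- negative exponents.
    by_cases h : ∀ j, 0 ≤ -u j
    · let v : Fin r →₀ ℕ := Finsupp.equivFunOnFinite.symm fun j => (-u j).toNat
      have hv : -u = intExp v := funext fun j => (Int.toNat_of_nonneg (h j)).symm
      have hv' : ∀ j, -u j = ((v j : ℕ) : ℤ) := fun j => congrFun hv j
      rw [hv, coeff_toLaurent, ← scalarForm_prod_adjointSeries hz]
      simp only [hv', intCoeff_natCast]
    · push Not at h
      obtain ⟨j, hj⟩ := h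
      rw [coeff_toLaurent_eq_zero (j := j) _ hj,
        Finset.prod_eq_zero (Finset.mem_univ j) (intCoeff_of_neg _ hj), map_zero,
        LinearMap.zero_apply]

theorem modeShift_of_succ [CharZero K] (q t : K) {a b : Fin M} (h : b.val = a.val + 1) (n : ℕ) :
    modeShift q t a (b, n) = (1 - t ^ (n + 1)) / (1 - q ^ (n + 1)) := by
  have hA : cartanA a b = -1 := by
    have h1 : a ≠ b := fun e => by rw [e] at h; omega
    rw [cartanA, if_neg h1, if_neg (by omega), if_pos h.symm]; norm_num
  have e : ((n : ℤ) + 1).natAbs = n + 1 := by omega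
  rw [modeShift, oscComm, hA, if_neg (by norm_num), if_pos rfl, e]
  have : (((n : ℤ) + 1 : ℤ) : K) = ((n + 1 : ℕ) : K) := by push_cast; ring
  rw [this, neg_mul, mul_neg, neg_neg,
    inv_mul_cancel_left₀ (Nat.cast_ne_zero.mpr n.succ_ne_zero)]

theorem modeShift_of_far (q t : K) {a b : Fin M} (h : a.val + 1 < b.val) (n : ℕ) :
    modeShift q t a (b, n) = 0 := by
  have hA : cartanA a b = 0 := by
    have h1 : a ≠ b := fun e => by rw [e] at h; omega
    rw [cartanA, if_neg h1, if_neg (by omega), if_neg (by omega)]; norm_num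
  rw [modeShift, oscComm, if_pos hA, mul_zero, neg_zero]

theorem map_scalarLaurent {σ τ : Type*} (φ : MvPolynomial σ K →ₐ[K] MvPolynomial τ K) {r : ℕ}
    (F : Laurent K r) : AddMonoidAlgebra.mapRingHom (Fin r → ℤ) (φ : _ →+* _)
      (scalarLaurent σ r F) = scalarLaurent τ r F := by
  have h : ∀ c, φ (MvPolynomial.C c) = MvPolynomial.C c := fun c => by
    rw [← MvPolynomial.algebraMap_eq, AlgHom.commutes, MvPolynomial.algebraMap_eq]
  induction F using AddMonoidAlgebra.induction_linear with
  | zero => simp only [map_zero]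
  | add F G hF hG => simp only [map_add, hF, hG]
  | single u c =>
    rw [scalarLaurent_single, AddMonoidAlgebra.mapRingHom_single, RingHom.coe_coe, h,
      scalarLaurent_single]

/-- The shift only adds scalars, so it introduces no creation operators of lower type. -/
theorem map_keepHom_moveHom (q t : K) (a : Fin M) (r : ℕ) (p : Creation K M) :
    AddMonoidAlgebra.mapRingHom (Fin r → ℤ) (keepHom K M a : _ →+* _)
      (moveHom modeDeg (modeShift q t a) r (keepHom K M (a + 1) p)) =
        moveHom modeDeg (modeShift q t a) r (keepHom K M (a + 1) p) := by
  induction p using MvPolynomial.induction_on with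
  | C c =>
    have h : ∀ k, keepHom K M k (MvPolynomial.C c) = MvPolynomial.C c := fun k => by
      rw [← MvPolynomial.algebraMap_eq, AlgHom.commutes]
    rw [h, moveHom_C, AddMonoidAlgebra.mapRingHom_single, RingHom.coe_coe, h]
  | add p p' h h' => simp only [map_add, h, h']
  | mul_X p i h =>
    rw [map_mul (keepHom _ _ _), map_mul (moveHom _ _ _), map_mul (AddMonoidAlgebra.mapRingHom _ _), h]
    refine congrArg (fun y => _ * y) ?_
    have e : keepHom K M (a + 1) (MvPolynomial.X i) =
        if a + 1 ≤ i.1.val then MvPolynomial.X i else 0 := MvPolynomial.aeval_X _ _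
    have h : ∀ c : K, keepHom K M a (MvPolynomial.C c) = MvPolynomial.C c := fun c => by
      rw [← MvPolynomial.algebraMap_eq, AlgHom.commutes]
    rw [e]
    split_ifs with hi
    · rw [moveHom_X, map_add, map_sum]
      simp only [AddMonoidAlgebra.mapRingHom_single, RingHom.coe_coe, h]
      rw [keepHom, MvPolynomial.aeval_X, if_pos (by omega)]
    · rw [map_zero, map_zero]

/-- Operators of type `a` shift type `a + 1` by multiples of `∑ z_j^{-n}` and leave higher types
alone. Discarding what is not of type `a` therefore evaluates the type `a + 1` function at `z⁻¹`. -/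
theorem map_thetaHom_moveHom [CharZero K] (q t : K) (a : Fin M) (r : ℕ) (p : Creation K M) :
    AddMonoidAlgebra.mapRingHom (Fin r → ℤ) (thetaHom q t M a : _ →+* _)
      (moveHom modeDeg (modeShift q t a) r (keepHom K M (a + 1) p)) =
        scalarLaurent ℕ r (laurentInv K r (toLaurent K r (toVars r
          (thetaHom q t M (a + 1) (keepHom K M (a + 1) p))))) := by
  induction p using MvPolynomial.induction_on with
  | C c =>
    have h : ∀ k, keepHom K M k (MvPolynomial.C c) = MvPolynomial.C c := fun k => by
      rw [← MvPolynomial.algebraMap_eq, AlgHom.commutes]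
    have h' : ∀ k, thetaHom q t M k (MvPolynomial.C c) = MvPolynomial.C c := fun k => by
      rw [← MvPolynomial.algebraMap_eq, AlgHom.commutes, MvPolynomial.algebraMap_eq]
    have h2 : toLaurent K r (MvPolynomial.C c) = AddMonoidAlgebra.single 0 c :=
      toLaurent_monomial 0 c
    rw [h, moveHom_C, AddMonoidAlgebra.mapRingHom_single, RingHom.coe_coe, h', h', toVars_C, h2,
      laurentInv_single, neg_zero, scalarLaurent_single]
  | add p p' h h' => simp only [map_add, h, h']
  | mul_X p i h =>
    rw [map_mul (keepHom _ _ _), map_mul (moveHom _ _ _), map_mul (AddMonoidAlgebra.mapRingHom _ _), h,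
      map_mul (thetaHom _ _ _ _), map_mul (toVars r), map_mul (toLaurent _ _),
      map_mul (laurentInv _ _), map_mul (scalarLaurent _ _)]
    refine congrArg (fun y => _ * y) ?_
    have e : keepHom K M (a + 1) (MvPolynomial.X i) =
        if a + 1 ≤ i.1.val then MvPolynomial.X i else 0 := MvPolynomial.aeval_X _ _
    have e2 : ∀ k, thetaHom q t M k (MvPolynomial.X i) = if i.1.val = k then
        MvPolynomial.C ((1 - t ^ (i.2 + 1)) / (1 - q ^ (i.2 + 1))) * MvPolynomial.X i.2 else 0 :=
      fun k => MvPolynomial.aeval_X _ _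
    have h : ∀ c : K, thetaHom q t M a (MvPolynomial.C c) = MvPolynomial.C c := fun c => by
      rw [← MvPolynomial.algebraMap_eq, AlgHom.commutes, MvPolynomial.algebraMap_eq]
    rw [e]
    split_ifs with hi
    · rw [moveHom_X, map_add, map_sum]
      simp only [AddMonoidAlgebra.mapRingHom_single, RingHom.coe_coe, h]
      rw [e2, e2, if_neg (by omega), AddMonoidAlgebra.single_zero, zero_add]
      split_ifs with hi'
      · obtain ⟨b, n⟩ := i
        rw [modeShift_of_succ q t hi', map_mul, toVars_C, toVars_X, MvPolynomial.psum,
          MvPolynomial.C_mul', map_smul, map_smul, map_sum, map_sum, Finset.smul_sum, map_sum]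
        refine Finset.sum_congr rfl fun j _ => ?_
        rw [map_pow, toLaurent_X, lmono, AddMonoidAlgebra.single_pow, one_pow, laurentInv_single,
          AddMonoidAlgebra.smul_single, smul_eq_mul, mul_one, scalarLaurent_single,
          ← Pi.single_smul, ← Pi.single_neg, nsmul_eq_mul, mul_one]
      · obtain ⟨b, n⟩ := i
        simp only [map_zero]
        exact Finset.sum_eq_zero fun j _ => by
          rw [modeShift_of_far q t (by simp only at hi hi'; omega), map_zero,
            AddMonoidAlgebra.single_zero]
    · simp only [map_zero]

theorem macP_of_parts_eq_zero [CharZero K] {q : K} {β : ℕ} (hq : Transcendental ℚ q) (hβ : 0 < β)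
    {d : ℕ} {lam : d.Partition} (h : lam.parts = 0) : macP q β lam = 1 := by
  obtain rfl : d = 0 := by rw [← lam.parts_sum, h, Multiset.sum_zero]
  have h1 : lowerSpan K lam = ⊥ := by
    rw [lowerSpan, Submodule.span_eq_bot]
    rintro _ ⟨mu, hmu, -⟩
    exact absurd (Subsingleton.elim mu lam) hmu.1
  have h2 := macP_sub_mem hq hβ lam
  rw [h1, Submodule.mem_bot, sub_eq_zero] at h2
  rw [h2]
  refine eq_of_toVars fun n => ?_
  ext α
  rw [isCoeffFun_monSym, isCoeffFun_one, h]

end Reduction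

/-! ### The iterated constant term -/

section Charges
variable (β : ℕ) {N : ℕ} (r s : Fin N → ℕ) (n : ℕ) (s' : ℤ)

/-- The charge after the action of the operators of type at least `k`. -/
def charge (k : ℕ) : Fin (N + 1) → ℤ := fun a => chargeIn β r s n s' a +
  β * ∑ b : Fin (N + 1), if k ≤ b.val then cartanA a b * (rExt r n b : ℤ) else 0

theorem charge_zero : charge β r s n s' 0 = chargeOut β r s n s' := by
  ext a
  simp [charge, chargeOut]

theorem charge_last : charge β r s n s' N =
    fun a => chargeIn β r s n s' a + n * (β * cartanA a (Fin.last N)) := by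
  ext a
  rw [charge, Finset.sum_eq_single (Fin.last N), if_pos (by simp), rExt, Fin.snoc_last]
  · ring
  · intro b _ hb
    rw [if_neg]
    intro h
    exact hb (Fin.ext (le_antisymm (Nat.lt_succ_iff.mp b.isLt) h))
  · intro h; exact absurd (Finset.mem_univ _) h

theorem charge_castSucc (a : Fin N) : charge β r s n s' a =
    fun b => charge β r s n s' (a + 1) b + r a * (β * cartanA b a.castSucc) := by
  ext b
  have h : ∀ c : Fin (N + 1), (if a.val ≤ c.val then cartanA b c * (rExt r n c : ℤ) else 0) =
      (if a.val + 1 ≤ c.val then cartanA b c * (rExt r n c : ℤ) else 0) +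
        if c = a.castSucc then cartanA b c * (rExt r n c : ℤ) else 0 := by
    intro c
    have h1 : c = a.castSucc ↔ c.val = a.val := by rw [Fin.ext_iff]; rfl
    simp only [h1]
    split_ifs <;> omega
  rw [charge, charge]
  simp only [h, Finset.sum_add_distrib, Finset.sum_ite_eq', Finset.mem_univ, if_true]
  rw [rExt, Fin.snoc_castSucc]
  ring

/-- Among the types above `a` only the neighbour interacts with it, lowering the charge by `β
r_{a+1}`. The definition of `α^a` is tuned so that the exponent of the prefactor reduces to `s_a`.
-/
theorem charge_succ_castSucc (a : Fin N) :
    charge β r s n s' (a + 1) a.castSucc + β * ((r a : ℤ) - 1) = s a := by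
  have h : (∑ b : Fin (N + 1), if a.val + 1 ≤ b.val then
      cartanA a.castSucc b * (rExt r n b : ℤ) else 0) = -(rExt r n a.succ : ℤ) := by
    rw [Finset.sum_eq_single a.succ]
    · have : cartanA a.castSucc a.succ = -1 := by
        have h1 : a.castSucc ≠ a.succ := fun e => by
          have := congrArg Fin.val e
          simp at this
        rw [cartanA, if_neg h1, if_neg (by simp; omega), if_pos (by simp)]; norm_num
      rw [if_pos (by simp), this]; ring
    · intro b _ hb
      split_ifs with hle
      · have hb' : b.val ≠ a.val + 1 := fun e => hb (Fin.ext e)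
        have : cartanA a.castSucc b = 0 := by
          have h1 : a.castSucc ≠ b := fun e => by
            rw [← e] at hle
            simp at hle
          rw [cartanA, if_neg h1, if_neg (by simp; omega), if_neg (by simp; omega)]; norm_num
        rw [this, zero_mul]
      · rfl
    · intro h; exact absurd (Finset.mem_univ _) h
  rw [charge, h, chargeIn]
  have e1 : (Fin.snoc (rExt r n) 0 : Fin (N + 2) → ℕ) a.castSucc.succ = rExt r n a.succ := by
    rw [Fin.succ_castSucc, Fin.snoc_castSucc]
  have e2 : (Fin.snoc (rExt r n) 0 : Fin (N + 2) → ℕ) a.castSucc.castSucc = r a := by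
    rw [Fin.snoc_castSucc, rExt, Fin.snoc_castSucc]
  have e3 : (Fin.snoc (fun b => (s b : ℤ)) s' : Fin (N + 1) → ℤ) a.castSucc = s a :=
    Fin.snoc_castSucc _ _ _
  simp only [e1, e2, e3]
  ring

end Charges

/-! ### The effect of one block of vertex operators on the state -/

section Step
variable {K : Type*} [Field K] [CharZero K] {q : K} {β M : ℕ}

omit [CharZero K] in
theorem keepHom_evalModes (t : K) (a : Fin M) (R : ℕ) (F : Laurent K R) {p : Creation K M}
    (hp : keepHom K M (a + 1) p = p) :
    keepHom K M a (evalModes (intCoeff (creationExp K a)) R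
      (scalarLaurent _ R F * moveHom modeDeg (modeShift q t a) R p)) =
      evalModes (intCoeff (creationExp K a)) R
        (scalarLaurent _ R F * moveHom modeDeg (modeShift q t a) R p) := by
  have h1 := evalModes_map (keepHom K M a).toRingHom (intCoeff (creationExp K a))
    (scalarLaurent _ R F * moveHom modeDeg (modeShift q t a) R p)
  simp only [map_intCoeff, map_keepHom_creationExp le_rfl] at h1
  refine h1.trans (congrArg _ ?_)
  have e1 := map_scalarLaurent (keepHom K M a) F
  have e2 := map_keepHom_moveHom q t a R p
  rw [hp] at e2
  exact (map_mul (AddMonoidAlgebra.mapRingHom (Fin R → ℤ) (keepHom K M a).toRingHom) _ _).trans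
    (congrArg₂ (fun x y => x * y) e1 e2)

/-- Transports the constant term formula for a block from Fock space to symmetric functions, so that
the reproducing property applies. -/
theorem thetaHom_evalModes (t : K) (a : Fin M) (R : ℕ) (F : Laurent K R) {p : Creation K M}
    (hp : keepHom K M (a + 1) p = p) :
    thetaHom q t M a (evalModes (intCoeff (creationExp K a)) R
      (scalarLaurent _ R F * moveHom modeDeg (modeShift q t a) R p)) =
      evalModes (intCoeff (adjointSeries q t fun _ => 1)) R (scalarLaurent ℕ R
        (F * laurentInv K R (toLaurent K R (toVars R (thetaHom q t M (a + 1) p))))) := by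
  have h1 := evalModes_map (thetaHom q t M a).toRingHom (intCoeff (creationExp K a))
    (scalarLaurent _ R F * moveHom modeDeg (modeShift q t a) R p)
  simp only [map_intCoeff, map_thetaHom_creationExp] at h1
  refine h1.trans (congrArg _ ?_)
  have e1 := map_scalarLaurent (thetaHom q t M a) F
  have e2 := map_thetaHom_moveHom q t a R p
  rw [hp] at e2
  rw [map_mul (scalarLaurent _ _)]
  exact (map_mul (AddMonoidAlgebra.mapRingHom (Fin R → ℤ) (thetaHom q t M a).toRingHom) _ _).trans
    (congrArg₂ (fun x y => x * y) e1 e2)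

omit [CharZero K] in
-- Each variable goes to an element without constant term, so the vacuum component is unchanged.
theorem thetaHom_of_constantCoeff (t : K) (k : ℕ) (p : Creation K M) :
    (thetaHom q t M k p).coeff 0 = p.coeff 0 := by
  have h : (MvPolynomial.aeval (R := K) (fun _ : ℕ => (0 : K))).comp (thetaHom q t M k) =
      MvPolynomial.aeval fun _ => (0 : K) := by
    refine MvPolynomial.algHom_ext fun i => ?_
    rw [AlgHom.comp_apply, thetaHom, MvPolynomial.aeval_X, MvPolynomial.aeval_X]
    split_ifs <;> simp
  have h' : ∀ (σ : Type) (f : MvPolynomial σ K),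
      MvPolynomial.aeval (fun _ => (0 : K)) f = f.coeff 0 := by
    intro σ f
    rw [← MvPolynomial.constantCoeff_eq]
    exact MvPolynomial.aeval_zero' f
  have := DFunLike.congr_fun h p
  rwa [AlgHom.comp_apply, h', h'] at this

end Step

/-! ### The induction over the rectangles -/

section Induction
variable {K : Type*} [Field K] [CharZero K] {q : K} {β N : ℕ} (r s : Fin N → ℕ)

/-- The rectangles with index less than `k`. -/
abbrev below (N k : ℕ) : Finset (Fin N) := Finset.univ.filter fun a => a.val < k

variable (q β) in
/-- The Macdonald function of the sum of the first `k` rectangles. -/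
abbrev rectP (k : ℕ) : SymFun K := macP q β (rectPartition r s (below N k))

variable (q β) in
/-- The constant produced by the operators of type `a`. -/
def stepConst (a : Fin N) : K := exchangeSign q β ^ (r a).choose 2 *
  (((r a).factorial : K) *
    scalarPrime q β (r a) (toVars (r a) (rectP q β r s (a + 1)))
      (toVars (r a) (rectP q β r s (a + 1))) /
    scalarForm q (q ^ β) (rectP q β r s (a + 1)) (rectP q β r s (a + 1)))

theorem below_succ (a : Fin N) : below N (a + 1) = insert a (below N a) := by
  ext b
  simp only [below, Finset.mem_filter, Finset.mem_univ, true_and, Finset.mem_insert, Fin.ext_iff]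
  omega

theorem le_of_mem_below {r : Fin N → ℕ} (hr : StrictMono r) {a b : Fin N}
    (h : b ∈ below N (a + 1)) : r b ≤ r a := by
  have : b.val < a.val + 1 := (Finset.mem_filter.mp h).2
  exact hr.monotone (Nat.lt_succ_iff.mp this)

/-- As the `r_b` increase with `b`, the diagram of the first rectangles has at most `r a` rows, and
the new rectangle adds `s a` to each of these rows. -/
theorem toVars_rectP (hq : Transcendental ℚ q) (hβ : 0 < β) {r : Fin N → ℕ} (hr : StrictMono r)
    (a : Fin N) : toVars (r a) (rectP q β r s (a + 1)) =
      varProd K (r a) ^ (s a) * toVars (r a) (rectP q β r s a) := by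
  have h1 : ∀ b ∈ below N (a + 1), r b ≤ r a := fun b hb => le_of_mem_below hr hb
  have h2 : ∀ b ∈ below N a, r b ≤ r a := fun b hb =>
    h1 b (by rw [below_succ]; exact Finset.mem_insert_of_mem hb)
  refine toVars_macP_add_const hq hβ (card_rectPartition_le s h1) (card_rectPartition_le s h2)
    fun i => ?_
  rw [partExp_rectPartition s h1, partExp_rectPartition s h2, rectRow, below_succ,
    Finset.sum_insert (by simp [below]), if_pos i.isLt, add_comm, rectRow]

/-- The kernel converts the pairing with the previous `P` into a constant term. The monomial `∏
z_j^{s a}` promotes this `P` to the next one, and proportionality of the two products returns to the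
form `⟨ , ⟩_{q,t}`. -/
theorem step_scalarForm (hq : Transcendental ℚ q) (hβ : 0 < β) {r : Fin N → ℕ} (hr : StrictMono r)
    (n : ℕ) (s' : ℤ) (a : Fin N) {p : Creation K (N + 1)}
    (hp : keepHom K (N + 1) (a + 1) p = p) :
    scalarForm q (q ^ β) (thetaHom q (q ^ β) (N + 1) a
      (evalModes (intCoeff (creationExp K a.castSucc)) (r a)
        (scalarLaurent _ (r a)
          (prefactor q β (charge β r s n s' (a + 1) a.castSucc) (r a)) *
          moveHom modeDeg (modeShift q (q ^ β) a.castSucc) (r a) p))) (rectP q β r s a) =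
      stepConst q β r s a * scalarForm q (q ^ β) (thetaHom q (q ^ β) (N + 1) (a + 1) p)
        (rectP q β r s (a + 1)) := by
  have h1 := thetaHom_evalModes (q := q) (q ^ β) a.castSucc (r a)
    (prefactor q β (charge β r s n s' (a + 1) a.castSucc) (r a)) hp
  have h2 := scalarForm_evalModes (powerNorm_ne_zero hq hβ)
    (prefactor q β (charge β r s n s' (a + 1) a.castSucc) (r a) * laurentInv K (r a)
      (toLaurent K (r a) (toVars (r a) (thetaHom q (q ^ β) (N + 1) (a + 1) p))))
    (rectP q β r s a)
  have h3 := scalarForm_smul_primeForm (n := r a) hq hβ (rectPartition r s (below N (a + 1)))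
    (thetaHom q (q ^ β) (N + 1) (a + 1) p)
  have hne := scalarForm_macP_self_ne_zero hq hβ (rectPartition r s (below N (a + 1)))
  have h4 : toLaurent K (r a) (toVars (r a) (rectP q β r s (a + 1))) =
      lmono K (fun _ => (s a : ℤ)) * toLaurent K (r a) (toVars (r a) (rectP q β r s a)) := by
    rw [toVars_rectP s hq hβ hr, map_mul, varProd_pow, toLaurent_monomial]
    rfl
  -- By the charge identity the monomial in the prefactor is `∏ z_j^{s a}`, exactly the ratio of the
  -- two Macdonald polynomials.
  have h5 : constTerm K (r a) (prefactor q β (charge β r s n s' (a + 1) a.castSucc) (r a) *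
      laurentInv K (r a) (toLaurent K (r a) (toVars (r a) (thetaHom q (q ^ β) (N + 1) (a + 1) p))) *
      toLaurent K (r a) (toVars (r a) (rectP q β r s a))) =
      exchangeSign q β ^ (r a).choose 2 * primeForm q β (r a)
        (toVars (r a) (rectP q β r s (a + 1))) (thetaHom q (q ^ β) (N + 1) (a + 1) p) := by
    rw [primeForm_apply, h4, prefactor, charge_succ_castSucc, smul_mul_assoc, smul_mul_assoc,
      map_smul, smul_eq_mul]
    congr 2
    ring
  refine (congrArg (fun x => scalarForm q (q ^ β) x (rectP q β r s a)) h1).trans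
    (h2.trans (h5.trans ?_))
  have h6 : primeForm q β (r a) (toVars (r a) (rectP q β r s (a + 1)))
      (thetaHom q (q ^ β) (N + 1) (a + 1) p) =
      ((r a).factorial : K) * scalarPrime q β (r a) (toVars (r a) (rectP q β r s (a + 1)))
        (toVars (r a) (rectP q β r s (a + 1))) /
        scalarForm q (q ^ β) (rectP q β r s (a + 1)) (rectP q β r s (a + 1)) *
      scalarForm q (q ^ β) (thetaHom q (q ^ β) (N + 1) (a + 1) p) (rectP q β r s (a + 1)) := by
    rw [div_mul_eq_mul_div, eq_div_iff hne, ← h3, mul_comm]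
  rw [h6, stepConst, mul_assoc]

/-- The invariant of the iteration: the first `k` blocks with the dual vacuum act as pairing with
the Macdonald function of the first `k` rectangles. At `k = 0` this function is 1. -/
theorem bra_take_prod (hq : Transcendental ℚ q) (hβ : 0 < β) {r : Fin N → ℕ} (hr : StrictMono r)
    (n : ℕ) (s' : ℤ) (k : ℕ) : k ≤ N → ∀ p : Creation K (N + 1), keepHom K (N + 1) k p = p →
    bra K (chargeOut β r s n s') (((List.ofFn fun a : Fin N =>
        vertexMode q (q ^ β) β a.castSucc 0 ^ (r a)).take k).prod
          (Finsupp.single (charge β r s n s' k) p)) =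
      (∏ a ∈ below N k, stepConst q β r s a) *
        scalarForm q (q ^ β) (thetaHom q (q ^ β) (N + 1) k p) (rectP q β r s k) := by
  induction k with
  | zero =>
    intro _ p _
    have hb : below N 0 = ∅ := by simp [below]
    have hP : rectP q β r s 0 = 1 := macP_of_parts_eq_zero hq hβ (by
      have h := card_rectPartition_le s (r := r) (S := below N 0) (n := 0) (by simp [hb])
      exact Multiset.card_eq_zero.mp (Nat.le_zero.mp h))
    have hsymm : scalarForm q (q ^ β) (thetaHom q (q ^ β) (N + 1) 0 p) 1 =
        scalarForm q (q ^ β) 1 (thetaHom q (q ^ β) (N + 1) 0 p) := scalarQT_comm _ _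
    rw [List.take_zero, List.prod_nil, Module.End.one_apply, hP, hb, Finset.prod_empty, one_mul,
      hsymm, scalarForm_one, thetaHom_of_constantCoeff, charge_zero, bra, LinearMap.comp_apply,
      Finsupp.lapply_apply, Finsupp.single_eq_same]
    rfl
  | succ k ih =>
    intro hk p hp
    obtain ⟨a, rfl⟩ : ∃ a : Fin N, a.val = k := ⟨⟨k, hk⟩, rfl⟩
    have hlen : a.val < (List.ofFn fun a : Fin N =>
        vertexMode q (q ^ β) β a.castSucc 0 ^ (r a)).length := by simp
    rw [List.prod_take_succ _ _ hlen, List.getElem_ofFn, Module.End.mul_apply,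
      vertexMode_pow_single (ne_zero_of_transcendental hq)
        (fun k hk => pow_ne_one_of_transcendental hq hk)]
    have hc := charge_castSucc β r s n s' a
    simp only [Fin.eta]
    rw [← hc, ih a.isLt.le _ (keepHom_evalModes (q := q) (q ^ β) a.castSucc (r a) _ hp),
      step_scalarForm s hq hβ hr n s' a hp, below_succ, Finset.prod_insert (by simp [below])]
    ring

omit [CharZero K] in
theorem prod_expPhiNonpos (t : K) {M : ℕ} (a : Fin M) (n : ℕ) : ∀ (μ : Fin n → ℤ)
    (γ : Fin M → ℤ), (List.ofFn fun i => expPhiNonpos q t β a (μ i)).prod (ket K γ) =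
      Finsupp.single (fun b => γ b + n * (β * cartanA b a))
        (∏ i, intCoeff (creationExp K a) (μ i)) := by
  induction n with
  | zero => intro μ γ; simp [ket]
  | succ n ih =>
    intro μ γ
    rw [List.ofFn_succ, List.prod_cons, Module.End.mul_apply, ih, expPhiNonpos_single,
      Fin.prod_univ_succ]
    congr 1
    ext b
    push_cast
    ring

/-- At zero exponents each block is a power of the zero mode. The initial state consists of
reproducing kernels of the last type, so the final pairing reads off a coefficient of `P_λ`. -/
theorem matrixElement_zero (hq : Transcendental ℚ q) (hβ : 0 < β) {r : Fin N → ℕ}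
    (hr : StrictMono r) (n : ℕ) (s' : ℤ) (μ : Fin n →₀ ℕ) :
    matrixElement q β r s n s' 0 μ = (∏ a, stepConst q β r s a) *
      (toVars n (rectP q β r s N)).coeff μ := by
  have h1 : (fun a : Fin N => (List.ofFn fun j : Fin (r a) => vertexMode q (q ^ β) β a.castSucc
      ((0 : (Σ a : Fin N, Fin (r a)) → ℤ) ⟨a, j⟩)).prod) =
      fun a => vertexMode q (q ^ β) β a.castSucc 0 ^ (r a) := by
    ext1 a
    simp only [Pi.zero_apply, List.ofFn_const, List.prod_replicate]
  have hkeep : ∀ m, keepHom K (N + 1) N (intCoeff (creationExp K (Fin.last N)) m) =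
      intCoeff (creationExp K (Fin.last N)) m := by
    intro m
    have := map_intCoeff (keepHom K (N + 1) N).toRingHom (creationExp K (Fin.last N)) m
    rwa [map_keepHom_creationExp (by simp)] at this
  have htheta : ∀ m : ℕ, thetaHom q (q ^ β) (N + 1) N (intCoeff (creationExp K (Fin.last N)) m) =
      PowerSeries.coeff m (adjointSeries q (q ^ β) fun _ => 1) := by
    intro m
    have := map_intCoeff (thetaHom q (q ^ β) (N + 1) N).toRingHom (creationExp K (Fin.last N)) m
    have h2 := map_thetaHom_creationExp q (q ^ β) (Fin.last N)
    rw [Fin.val_last] at h2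
    rw [h2, intCoeff_natCast] at this
    exact this
  have h3 := bra_take_prod s hq hβ hr n s' N le_rfl
    (∏ i, intCoeff (creationExp K (Fin.last N)) (μ i)) (by
      rw [map_prod]; exact Finset.prod_congr rfl fun i _ => hkeep _)
  have hb : below N N = Finset.univ := by ext a; simp [below]
  rw [map_prod, Finset.prod_congr rfl fun i _ => htheta (μ i),
    scalarForm_prod_adjointSeries (powerNorm_ne_zero hq hβ), hb, charge_last,
    ← prod_expPhiNonpos (q := q) (q ^ β), List.take_of_length_le (by simp), ← h1] at h3
  exact h3

/-- The factors are inverse block by block. Both norms of each partial diagram must be nonzero, and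
for the constant term norm this requires at most `r a` rows. -/
theorem cPlus_mul_signPower (hq : Transcendental ℚ q) (hβ : 0 < β) {r : Fin N → ℕ}
    (hr : StrictMono r) : cPlus q β r s * signPower q β r * ∏ a, stepConst q β r s a = 1 := by
  have hq0 := ne_zero_of_transcendental hq
  have hI : ∀ a : Fin N, Finset.Iic a = below N (a + 1) := by
    intro a
    ext b
    simp only [Finset.mem_Iic, below, Finset.mem_filter, Finset.mem_univ, true_and, Fin.le_def,
      Nat.lt_succ_iff]
  rw [cPlus, signPower, ← Finset.prod_pow_eq_pow_sum, ← Finset.prod_mul_distrib, ← Finset.prod_mul_distrib]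
  refine Finset.prod_eq_one fun a _ => ?_
  rw [hI, stepConst, exchangeSign]
  have h1 := scalarForm_macP_self_ne_zero hq hβ (rectPartition r s (below N (a + 1)))
  have h2 := scalarPrime_macP_self_ne_zero (n := r a) hq hβ
    (lam := rectPartition r s (below N (a + 1)))
    (card_rectPartition_le s fun b hb => le_of_mem_below hr hb)
  have h3 : ((r a).factorial : K) ≠ 0 := Nat.cast_ne_zero.mpr (Nat.factorial_ne_zero _)
  have h4 : ((-1) ^ β * q ^ β.choose 2 : K) ≠ 0 :=
    mul_ne_zero (pow_ne_zero _ (neg_ne_zero.mpr one_ne_zero)) (pow_ne_zero _ hq0)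
  rw [scalarForm_apply] at h1 ⊢
  dsimp only
  set A := scalarQT q (q ^ β) (rectP q β r s (a + 1)) (rectP q β r s (a + 1))
  set B := scalarPrime q β (r a) (toVars (r a) (rectP q β r s (a + 1)))
    (toVars (r a) (rectP q β r s (a + 1)))
  set D := ((-1) ^ β * q ^ β.choose 2 : K) ^ (r a).choose 2 with hD
  have hD0 : D ≠ 0 := pow_ne_zero _ h4
  rw [inv_pow, ← hD]
  field_simp

end Induction

end

end MacBoson

theorem proposition4p1 {K : Type*} [Field K] [CharZero K]
    (q : K) (hq : Transcendental ℚ q) (β : ℕ) (hβ : 0 < β)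
    (N : ℕ) (r s : Fin N → ℕ) (hr : StrictMono r) (hr0 : ∀ a, 0 < r a) (hs : ∀ a, 0 < s a)
    (n : ℕ) (s' : ℤ) :
    ((toVars n (macdonaldP q (q ^ β) (rectPartition r s Finset.univ)) : MvPolynomial (Fin n) K) :
        MvPowerSeries (Fin n) K) =
      (cPlus q β r s * signPower q β r) • oint (matrixElement q β r s n s') := by
  ext μ
  have h := matrixElement_zero s hq hβ hr n s' μ
  have hb : below N N = Finset.univ := by ext a; simp [below]
  rw [MvPolynomial.coeff_coe, MvPowerSeries.coeff_smul]
  change _ = cPlus q β r s * signPower q β r * matrixElement q β r s n s' 0 μ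
  rw [h, ← mul_assoc, cPlus_mul_signPower s hq hβ hr, one_mul, rectP, hb]
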